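/- Let $X$ be a complex manifold of dimension $n$, and let $\kappa,m\ge 0$ be integers. Let $\mathcal E^{GG}_{\kappa,m}T_X^*$ be the Green--Griffiths bundle: its fibre at $x\in X$ consists of the jet polynomials $$\sum_{|\alpha_1|+2|\alpha_2|+\cdots+\kappa|\alpha_\kappa|=m} c_{\alpha_1,\dots,\alpha_\kappa}\,(x')^{\alpha_1}(x'')^{\alpha_2}\cdots(x^{(\kappa)})^{\alpha_\kappa},\qquad \alpha_\lambda\in\mathbb N^n,\ c_{\alpha_1,\dots,\alpha_\kappa}\in\mathbb C,$$ viewed as functions of the $\kappa$-jets of holomorphic discs through $x$, where $x^{(\lambda)}$ denotes the derivative of order $\lambda$ in a local chart, and its holomorphic sections are those with holomorphic coefficients in every chart. Filter it first by the degree in $x^{(\kappa)}$, then filter each graded piece by the degree in $x^{(\kappa-1)}$, and so on. Equivalently, for $d=(d_1,\dots,d_\kappa)\in\mathbb N^\kappa$ with $d_1+2d_2+\cdots+\kappa d_\kappa=m$, let $\mathcal F_{\le d}$ (resp. $\mathcal F_{<d}$) be spanned by the monomials whose multidegree $(|\alpha_1|,\dots,|\alpha_\kappa|)$ is $\le d$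 (resp. $<d$) in the colexicographic order (last entry most significant), and put $$\mathrm{Gr}^\bullet\mathcal E^{GG}_{\kappa,m}T_X^*=\bigoplus_{d}\mathcal F_{\le d}/\mathcal F_{<d}.$$ For integers $\ell_1\ge\cdots\ge\ell_n\ge0$ let $\mathcal S^{(\ell_1,\dots,\ell_n)}T_X^*\subset (T_X^*)^{\otimes(\ell_1+\cdots+\ell_n)}$ be the Schur bundle, the image of the Young symmetrizer (symmetrization along the rows followed by antisymmetrization along the columns) of the Young diagram with row lengths $\ell_1,\dots,\ell_n$, and let $M^{\kappa,m}_{\ell_1,\dots,\ell_n}$ be the number of semi-standard Young tableaux (rows nondecreasing, columns strictly increasing) of this shape with entries in $\{1,\dots,\kappa\}$ whose entries have sum $m$. Then $\mathcal E^{GG}_{\kappa,m}T_X^*$, $\mathrm{Gr}^\bullet\mathcal E^{GG}_{\kappa,m}T_X^*$ and all $\mathcal S^{(\ell_1,\dots,\ell_n)}T_X^*$ are holomorphic vector bundles on $X$, there is an isomorphism of holomorphic vector bundles $$\mathrm{Gr}^\bullet\mathcal E^{GG}_{\kappa,m}T_X^*\;\cong\;\bigoplus_{\ell_1\ge\cdots\ge\ell_n\ge0}\bigl(\mathcal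 S^{(\ell_1,\dots,\ell_n)}T_X^*\bigr)^{\oplus M^{\kappa,m}_{\ell_1,\dots,\ell_n}},$$ and for every $q\ge0$ the dimensions $h^q=\dim_{\mathbb C}H^q$ of the cohomology spaces of the sheaves of holomorphic sections satisfy $$h^q\bigl(X,\mathcal E^{GG}_{\kappa,m}T_X^*\bigr)\;\le\;\sum_{\ell_1\ge\cdots\ge\ell_n\ge0}M^{\kappa,m}_{\ell_1,\dots,\ell_n}\,h^q\bigl(X,\mathcal S^{(\ell_1,\dots,\ell_n)}T_X^*\bigr)$$ (as an inequality of cardinal numbers if $X$ is not compact and some dimensions are infinite). -/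

import Mathlib

open CategoryTheory TopologicalSpace
open scoped Manifold ContDiff TensorProduct DirectSum

noncomputable section

namespace GreenGriffiths

/-! ### Holomorphic functions, holomorphic vector bundles and their cohomology

Throughout, an `n`-dimensional complex manifold is a topological space `X` with
`[ChartedSpace (Fin n → ℂ) X] [IsManifold 𝓘(ℂ, Fin n → ℂ) ω X]`. -/

/-- `f` is a holomorphic function on the open subset `U` of the complex manifold `X`. -/
def IsHolFun (n : ℕ) {X : Type} [TopologicalSpace X] [ChartedSpace (Fin n → ℂ) X]
    {U : Opens X} (f : U → ℂ) : Prop :=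
  ContMDiff 𝓘(ℂ, Fin n → ℂ) 𝓘(ℂ) ω f

lemma IsHolFun.res {n : ℕ} {X : Type} [TopologicalSpace X] [ChartedSpace (Fin n → ℂ) X]
    {U V : Opens X} (h : V ≤ U) {f : U → ℂ} (hf : IsHolFun n f) :
    IsHolFun n (fun x : V => f ⟨x.1, h x.2⟩) :=
  ContMDiff.comp (I' := 𝓘(ℂ, Fin n → ℂ)) hf (contMDiff_inclusion h)

/-- A family of complex vector spaces `Fib x`, `x ∈ X`, together with the sheaf of its holomorphic
sections, which is a sheaf of modules over the sheaf of holomorphic functions. It is a holomorphic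
vector bundle as soon as it has local holomorphic frames, see `HolPrebundle.IsVectorBundle`. -/
structure HolPrebundle (n : ℕ) (X : Type) [TopologicalSpace X] [ChartedSpace (Fin n → ℂ) X] where
  /-- the fibre over a point -/
  Fib : X → Type
  [addCommGroup : ∀ x, AddCommGroup (Fib x)]
  [module : ∀ x, Module ℂ (Fib x)]
  /-- the property of a section over an open set to be holomorphic; it is a local property -/
  hol : TopCat.LocalPredicate (X := TopCat.of X) Fib
  zero_mem : ∀ U : Opens X, hol.pred (U := U) (fun _ => 0)
  add_mem : ∀ {U : Opens X} (s t : ∀ x : U, Fib x), hol.pred (U := U) s → hol.pred (U := U) t →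
    hol.pred (U := U) (fun x => s x + t x)
  smul_mem : ∀ {U : Opens X} (f : U → ℂ) (s : ∀ x : U, Fib x), IsHolFun n f →
    hol.pred (U := U) s → hol.pred (U := U) (fun x => f x • s x)

attribute [instance] HolPrebundle.addCommGroup HolPrebundle.module

namespace HolPrebundle

variable {n : ℕ} {X : Type} [TopologicalSpace X] [ChartedSpace (Fin n → ℂ) X]

/-- The section `s` of `E` over the open set `U` is holomorphic. -/
def IsHol (E : HolPrebundle n X) {U : Opens X} (s : ∀ x : U, E.Fib x) : Prop :=
  E.hol.pred (U := U) s

/-- `E` is a holomorphic vector bundle: near every point there are bases of the fibres for which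
a section is holomorphic if and only if its components are holomorphic functions. -/
def IsVectorBundle (E : HolPrebundle n X) : Prop :=
  ∀ x₀ : X, ∃ (U : Opens X) (_ : x₀ ∈ U) (r : ℕ)
    (b : ∀ x : U, Module.Basis (Fin r) ℂ (E.Fib x)),
    ∀ (V : Opens X) (hVU : V ≤ U) (s : ∀ x : V, E.Fib x),
      E.IsHol s ↔ ∀ i, IsHolFun n (fun x : V => (b ⟨x.1, hVU x.2⟩).repr (s x) i)

/-- An isomorphism of holomorphic vector bundles over the identity of `X`: linear isomorphisms
of the fibres under which the holomorphic sections correspond to each other. -/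
structure Iso (E F : HolPrebundle n X) where
  toEquiv : ∀ x, E.Fib x ≃ₗ[ℂ] F.Fib x
  isHol_iff : ∀ (U : Opens X) (s : ∀ x : U, E.Fib x),
    E.IsHol s ↔ F.IsHol (fun x : U => toEquiv x (s x))

/-- The space of holomorphic sections of `E` over `U`. -/
def sections (E : HolPrebundle n X) (U : Opens X) : Submodule ℂ (∀ x : U, E.Fib x) where
  carrier := {s | E.IsHol s}
  zero_mem' := E.zero_mem U
  add_mem' hs ht := E.add_mem _ _ hs ht
  smul_mem' c s hs := E.smul_mem (fun _ => c) s contMDiff_const hs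

/-- The presheaf of holomorphic sections of `E`. -/
def sectionsPresheaf (E : HolPrebundle n X) :
    TopCat.Presheaf (ModuleCat.{0} ℂ) (TopCat.of X) where
  obj U := ModuleCat.of ℂ (E.sections U.unop)
  map i := ModuleCat.ofHom
    { toFun := fun s => ⟨fun x => s.1 ⟨x.1, i.unop.le x.2⟩, E.hol.res i.unop s.1 s.2⟩
      map_add' := fun _ _ => rfl
      map_smul' := fun _ _ => rfl }

lemma sectionsPresheaf_isSheaf (E : HolPrebundle n X) : E.sectionsPresheaf.IsSheaf := by
  rw [TopCat.Presheaf.isSheaf_iff_isSheaf_comp (forget (ModuleCat.{0} ℂ))]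
  refine TopCat.Presheaf.isSheaf_of_iso ?_ (TopCat.subpresheafToTypes.isSheaf E.hol)
  exact NatIso.ofComponents (fun U => Iso.refl _) (fun _ => rfl)

/-- The sheaf of holomorphic sections of `E`, as a sheaf of complex vector spaces. -/
def sheaf (E : HolPrebundle n X) :
    Sheaf (Opens.grothendieckTopology X) (ModuleCat.{0} ℂ) :=
  ⟨E.sectionsPresheaf, E.sectionsPresheaf_isSheaf⟩

/-- The sheaf cohomology space `H^q(X, E)` of the sheaf of holomorphic sections of `E`, that is,
the `q`-th `Ext` space from the constant sheaf `ℂ` in the category of sheaves of complex vector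
spaces. -/
abbrev cohomology (E : HolPrebundle n X) (q : ℕ) : Type :=
  Abelian.Ext ((constantSheaf (Opens.grothendieckTopology X) (ModuleCat.{0} ℂ)).obj
    (ModuleCat.of ℂ ℂ)) E.sheaf q

/-- The dimension `h^q(X, E)` over `ℂ`. -/
def h (q : ℕ) (E : HolPrebundle n X) : Cardinal.{0} := Module.rank ℂ (E.cohomology q)

/-! ### Constructions of bundles -/

/-- Let `A x` be vector spaces, `W x` a subspace of `A x` and, for every chart `e`, let
`b e i x ∈ A x` be finitely many vectors depending on the point `x`. The family of the `W x`,
where a section over `U` is holomorphic if in every chart `e` it is, locally on `U ∩ e.source`,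
a combination of the `b e i` with holomorphic coefficients. -/
def ofFrames (A : X → Type) [∀ x, AddCommGroup (A x)] [∀ x, Module ℂ (A x)]
    (W : ∀ x, Submodule ℂ (A x)) (B : Type) [Fintype B]
    (b : OpenPartialHomeomorph X (Fin n → ℂ) → B → ∀ x, A x) : HolPrebundle n X where
  Fib x := W x
  hol :=
    { pred := fun {U : Opens X} s => ∀ e ∈ atlas (Fin n → ℂ) X, ∀ x₀ : U, x₀.1 ∈ e.source →
        ∃ (V : Opens X) (hVU : V ≤ U) (_ : x₀.1 ∈ V) (c : B → V → ℂ), (∀ i, IsHolFun n (c i)) ∧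
          ∀ y : V, (s ⟨y.1, hVU y.2⟩ : A y.1) = ∑ i, c i y • b e i y.1
      res := by
        intro U' U j s hs e he x₀ hx₀
        obtain ⟨V, hVU, hxV, c, hc, h⟩ := hs e he ⟨x₀.1, j.le x₀.2⟩ hx₀
        refine ⟨V ⊓ U', inf_le_right, ⟨hxV, x₀.2⟩, fun i y => c i ⟨y.1, y.2.1⟩,
          fun i => (hc i).res inf_le_left, fun y => h ⟨y.1, y.2.1⟩⟩
      locality := by
        intro U s hs e he x₀ hx₀
        obtain ⟨U', hx', j, h'⟩ := hs x₀
        obtain ⟨V, hVU, hxV, c, hc, h⟩ := h' e he ⟨x₀.1, hx'⟩ hx₀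
        exact ⟨V, hVU.trans j.le, hxV, c, hc, h⟩ }
  zero_mem U := by
    intro e _ x₀ _
    exact ⟨U, le_rfl, x₀.2, fun _ _ => 0, fun _ => contMDiff_const, fun y => by simp⟩
  add_mem {U} s t hs ht := by
    intro e he x₀ hx₀
    obtain ⟨V, hVU, hxV, c, hc, h⟩ := hs e he x₀ hx₀
    obtain ⟨V', hVU', hxV', c', hc', h'⟩ := ht e he x₀ hx₀
    refine ⟨V ⊓ V', inf_le_left.trans hVU, ⟨hxV, hxV'⟩,
      fun i y => c i ⟨y.1, y.2.1⟩ + c' i ⟨y.1, y.2.2⟩,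
      fun i => ContMDiff.add ((hc i).res inf_le_left) ((hc' i).res inf_le_right), fun y => ?_⟩
    have h1 := h ⟨y.1, y.2.1⟩
    have h2 := h' ⟨y.1, y.2.2⟩
    simp only [Submodule.coe_add, add_smul, Finset.sum_add_distrib]
    exact congrArg₂ _ h1 h2
  smul_mem {U} f s hf hs := by
    intro e he x₀ hx₀
    obtain ⟨V, hVU, hxV, c, hc, h⟩ := hs e he x₀ hx₀
    refine ⟨V, hVU, hxV, fun i y => f ⟨y.1, hVU y.2⟩ * c i y,
      fun i => ContMDiff.mul (hf.res hVU) (hc i), fun y => ?_⟩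
    simp only [Submodule.coe_smul, mul_smul, ← Finset.smul_sum]
    exact congrArg _ (h y)

/-- The quotient of `E` by a family of subspaces of its fibres; a section of the quotient is
holomorphic if it lifts locally to holomorphic sections of `E`. -/
def quotient (E : HolPrebundle n X) (W : ∀ x, Submodule ℂ (E.Fib x)) : HolPrebundle n X where
  Fib x := E.Fib x ⧸ W x
  hol :=
    { pred := fun {U : Opens X} s => ∀ x₀ : U, ∃ (V : Opens X) (hVU : V ≤ U) (_ : x₀.1 ∈ V)
        (t : ∀ y : V, E.Fib y), E.IsHol t ∧ ∀ y : V, s ⟨y.1, hVU y.2⟩ = (W y.1).mkQ (t y)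
      res := by
        intro U' U j s hs x₀
        obtain ⟨V, hVU, hxV, t, ht, h⟩ := hs ⟨x₀.1, j.le x₀.2⟩
        exact ⟨V ⊓ U', inf_le_right, ⟨hxV, x₀.2⟩, fun y => t ⟨y.1, y.2.1⟩,
          E.hol.res (U := V ⊓ U') (homOfLE inf_le_left) t ht, fun y => h ⟨y.1, y.2.1⟩⟩
      locality := by
        intro U s hs x₀
        obtain ⟨U', hx', j, h'⟩ := hs x₀
        obtain ⟨V, hVU, hxV, t, ht, h⟩ := h' ⟨x₀.1, hx'⟩
        exact ⟨V, hVU.trans j.le, hxV, t, ht, h⟩ }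
  zero_mem U x₀ := ⟨U, le_rfl, x₀.2, fun _ => 0, E.zero_mem U, fun y => by simp⟩
  add_mem {U} s s' hs hs' := by
    intro x₀
    obtain ⟨V, hVU, hxV, t, ht, h⟩ := hs x₀
    obtain ⟨V', hVU', hxV', t', ht', h'⟩ := hs' x₀
    refine ⟨V ⊓ V', inf_le_left.trans hVU, ⟨hxV, hxV'⟩,
      fun y => t ⟨y.1, y.2.1⟩ + t' ⟨y.1, y.2.2⟩,
      E.add_mem _ _ (E.hol.res (U := V ⊓ V') (homOfLE inf_le_left) t ht)
        (E.hol.res (U := V ⊓ V') (homOfLE inf_le_right) t' ht'), fun y => ?_⟩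
    have h1 := h ⟨y.1, y.2.1⟩
    have h2 := h' ⟨y.1, y.2.2⟩
    rw [map_add]
    exact congrArg₂ _ h1 h2
  smul_mem {U} f s hf hs := by
    intro x₀
    obtain ⟨V, hVU, hxV, t, ht, h⟩ := hs x₀
    refine ⟨V, hVU, hxV, fun y => f ⟨y.1, hVU y.2⟩ • t y,
      E.smul_mem _ _ (hf.res hVU) ht, fun y => ?_⟩
    rw [map_smul]
    exact congrArg _ (h y)

/-- The direct sum of the `E i` (used for finite index types `ι` only). -/
def directSum {ι : Type} (E : ι → HolPrebundle n X) : HolPrebundle n X where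
  Fib x := ⨁ i, (E i).Fib x
  hol :=
    { pred := fun {U : Opens X} s => ∀ i, (E i).IsHol (fun x : U => s x i)
      res := by
        intro U' U j s hs i
        exact (E i).hol.res j (fun x : U => s x i) (hs i)
      locality := by
        intro U s hs i
        refine (E i).hol.locality (fun x : U => s x i) fun x => ?_
        obtain ⟨V, hxV, j, h⟩ := hs x
        exact ⟨V, hxV, j, h i⟩ }
  zero_mem U i := (E i).zero_mem U
  add_mem s t hs ht i := (E i).add_mem _ _ (hs i) (ht i)
  smul_mem f s hf hs i := (E i).smul_mem f _ hf (hs i)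

end HolPrebundle

/-! ### The Green-Griffiths jet bundles -/

section Jets

variable {n : ℕ} {X : Type} [TopologicalSpace X] [ChartedSpace (Fin n → ℂ) X]

/-- A map `ℂ → X` with value `x` at `0` which is holomorphic near `0`; only its germ at `0`,
a holomorphic disc through `x`, will matter. -/
structure Disc (n : ℕ) {X : Type} [TopologicalSpace X] [ChartedSpace (Fin n → ℂ) X] (x : X) where
  toFun : ℂ → X
  map_zero : toFun 0 = x
  hol : ContMDiffAt 𝓘(ℂ) 𝓘(ℂ, Fin n → ℂ) ω toFun 0

/-- The exponents `(α_1, …, α_κ)` with `α_λ ∈ ℕ^n` of the monomials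
`(x')^{α_1} (x'')^{α_2} ⋯ (x^{(κ)})^{α_κ}` of weight `|α_1| + 2 |α_2| + ⋯ + κ |α_κ| = m`.
The index `l : Fin κ` stands for the derivative of order `l + 1`. -/
def JetExponent (n κ m : ℕ) : Type :=
  {α : Fin κ → Fin n → ℕ // ∑ l, (l.1 + 1) * ∑ i, α l i = m}

lemma jetExponent_finite (n κ m : ℕ) : Finite (JetExponent n κ m) := by
  refine Set.Finite.to_subtype (s := {α : Fin κ → Fin n → ℕ | _})
    ((Set.finite_Iic (fun _ _ => m : Fin κ → Fin n → ℕ)).subset ?_)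
  intro α hα l i
  have h1 : α l i ≤ ∑ i, α l i := Finset.single_le_sum (fun _ _ => Nat.zero_le _) (Finset.mem_univ i)
  have h2 : (l.1 + 1) * ∑ i, α l i ≤ ∑ l : Fin κ, (l.1 + 1) * ∑ i, α l i :=
    Finset.single_le_sum (f := fun l : Fin κ => (l.1 + 1) * ∑ i, α l i)
      (fun _ _ => Nat.zero_le _) (Finset.mem_univ l)
  have h3 : ∑ i, α l i ≤ (l.1 + 1) * ∑ i, α l i := Nat.le_mul_of_pos_left _ (Nat.succ_pos _)
  exact h1.trans (h3.trans (h2.trans (le_of_eq hα)))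

instance (n κ m : ℕ) : Fintype (JetExponent n κ m) :=
  @Fintype.ofFinite _ (jetExponent_finite n κ m)

/-- The multidegree `(|α_1|, …, |α_κ|)`. -/
def JetExponent.deg {n κ m : ℕ} (α : JetExponent n κ m) : Fin κ → ℕ := fun l => ∑ i, α.1 l i

/-- The jet monomial `(x')^{α_1} ⋯ (x^{(κ)})^{α_κ}` of the coordinates of the chart `e`, as a
function of discs `f` through `x`: every `x_i^{(λ)}` is replaced by the derivative of order `λ`
at `0` of the `i`-th component of `f` in the chart `e`. -/
def jetMonomial {κ m : ℕ} (e : OpenPartialHomeomorph X (Fin n → ℂ)) (α : JetExponent n κ m)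
    (x : X) : Disc n x → ℂ :=
  fun f => ∏ l, ∏ i, (iteratedDeriv (l.1 + 1) (fun t : ℂ => e (f.toFun t) i) 0) ^ (α.1 l i)

/-- The jet polynomials at `x` all of whose monomials, in the coordinates of the preferred chart
at `x`, have exponents in `S`. -/
def jetPolynomials {κ m : ℕ} (S : Set (JetExponent n κ m)) (x : X) :
    Submodule ℂ (Disc n x → ℂ) :=
  Submodule.span ℂ ((fun α => jetMonomial (chartAt (Fin n → ℂ) x) α x) '' S)

/-- The families of jet polynomials all of whose exponents lie in `S`; holomorphic sections are
those whose coefficients with respect to the jet monomials of every chart are holomorphic. -/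
def jetBundle {κ m : ℕ} (X : Type) [TopologicalSpace X] [ChartedSpace (Fin n → ℂ) X]
    (S : Set (JetExponent n κ m)) : HolPrebundle n X :=
  HolPrebundle.ofFrames (fun x => Disc n x → ℂ) (jetPolynomials S) (JetExponent n κ m)
    jetMonomial

/-- The Green-Griffiths bundle `E^{GG}_{κ,m} T_X^*` of jet polynomials of order `κ` and
weight `m`. -/
def EGG (n κ m : ℕ) (X : Type) [TopologicalSpace X] [ChartedSpace (Fin n → ℂ) X] :
    HolPrebundle n X :=
  jetBundle X (Set.univ : Set (JetExponent n κ m))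

/-- The multidegrees `(ℓ_1, …, ℓ_κ)` with `ℓ_1 + 2 ℓ_2 + ⋯ + κ ℓ_κ = m`. -/
def MultiDegree (κ m : ℕ) : Type := {d : Fin κ → ℕ // ∑ l, (l.1 + 1) * d l = m}

/-- The filtration of `E^{GG}_{κ,m} T_X^*` obtained by filtering first by the degree in
`x^{(κ)}`, then each graded piece by the degree in `x^{(κ-1)}`, and so on: the member of index
`ℓ` consists of the polynomials with multidegrees at most `ℓ` in the colexicographic order,
for which the last entry is the most significant one. -/
def filtration {κ m : ℕ} (n : ℕ) (X : Type) [TopologicalSpace X] [ChartedSpace (Fin n → ℂ) X]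
    (d : MultiDegree κ m) : HolPrebundle n X :=
  jetBundle X {α : JetExponent n κ m | toColex α.deg ≤ toColex d.1}

/-- In the fibre at `x` of the filtration member of index `d`, the sum of the preceding ones. -/
def filtrationLT {κ m : ℕ} (d : MultiDegree κ m) (x : X) :
    Submodule ℂ ((filtration n X d).Fib x) :=
  Submodule.comap (jetPolynomials {α : JetExponent n κ m | toColex α.deg ≤ toColex d.1} x).subtype
    (jetPolynomials {α : JetExponent n κ m | toColex α.deg < toColex d.1} x)

/-- The graded bundle `Gr^• E^{GG}_{κ,m} T_X^*` associated with the filtration. -/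
def GrEGG (n κ m : ℕ) (X : Type) [TopologicalSpace X] [ChartedSpace (Fin n → ℂ) X] :
    HolPrebundle n X :=
  HolPrebundle.directSum fun d : MultiDegree κ m => (filtration n X d).quotient (filtrationLT d)

end Jets

/-! ### Young diagrams, Schur bundles -/

/-- The sequences `ℓ_1 ≥ ℓ_2 ≥ ⋯ ≥ ℓ_n ≥ 0`. -/
def Shape (n : ℕ) : Type := {ℓ : Fin n → ℕ // Antitone ℓ}

/-- The Young diagram with row lengths `ℓ_1, …, ℓ_n`. -/
def Shape.diagram {n : ℕ} (ℓ : Shape n) : YoungDiagram :=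
  YoungDiagram.ofRowLens (List.ofFn ℓ.1) (List.sortedGE_ofFn_iff.2 ℓ.2)

/-- The number of semi-standard tableaux of shape `ℓ` with entries in `{1, …, κ}` whose entries
have sum `m`. -/
def Shape.multiplicity {n : ℕ} (ℓ : Shape n) (κ m : ℕ) : ℕ :=
  Nat.card {T : SemistandardYoungTableau ℓ.diagram //
    (∀ c ∈ ℓ.diagram.cells, 1 ≤ T c.1 c.2 ∧ T c.1 c.2 ≤ κ) ∧
      ∑ c ∈ ℓ.diagram.cells, T c.1 c.2 = m}

section Schur

/-- The Young symmetrizer of the diagram `μ` on the tensor power of `V` with factors indexed by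
the cells of `μ`: symmetrization along the rows followed by antisymmetrization along the
columns, without the nonzero scalar which would make it idempotent. -/
def youngSymmetrizer (μ : YoungDiagram) (V : Type) [AddCommGroup V] [Module ℂ V] :
    (⨂[ℂ] _ : μ.cells, V) →ₗ[ℂ] (⨂[ℂ] _ : μ.cells, V) :=
  ∑ q : Equiv.Perm μ.cells with ∀ c, (q c).1.2 = c.1.2,
    ∑ p : Equiv.Perm μ.cells with ∀ c, (p c).1.1 = c.1.1,
      ((Equiv.Perm.sign q : ℤ) : ℂ) •
        ((PiTensorProduct.reindex ℂ (fun _ : μ.cells => V) q).toLinearMap ∘ₗ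
          (PiTensorProduct.reindex ℂ (fun _ : μ.cells => V) p).toLinearMap)

/-- The Schur power of `V`, the image of the Young symmetrizer. -/
def schurPower (μ : YoungDiagram) (V : Type) [AddCommGroup V] [Module ℂ V] :
    Submodule ℂ (⨂[ℂ] _ : μ.cells, V) :=
  LinearMap.range (youngSymmetrizer μ V)

variable {n : ℕ} {X : Type} [TopologicalSpace X] [ChartedSpace (Fin n → ℂ) X]

/-- The cotangent space at `x`. -/
abbrev Cotangent (n : ℕ) {X : Type} [TopologicalSpace X] [ChartedSpace (Fin n → ℂ) X]
    (x : X) : Type :=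
  TangentSpace 𝓘(ℂ, Fin n → ℂ) x →L[ℂ] ℂ

/-- The differential at `x` of the `i`-th coordinate of the chart `e`. -/
def coordDiff (e : OpenPartialHomeomorph X (Fin n → ℂ)) (i : Fin n) (x : X) : Cotangent n x :=
  mfderiv 𝓘(ℂ, Fin n → ℂ) 𝓘(ℂ) (fun y => e y i) x

/-- The Schur bundle `S^{(ℓ_1, …, ℓ_n)} T_X^*`, a subbundle of a tensor power of the cotangent
bundle: holomorphic sections are those whose coefficients with respect to the tensor products
of the differentials of the coordinates of every chart are holomorphic. -/
def schurBundle (X : Type) [TopologicalSpace X] [ChartedSpace (Fin n → ℂ) X] (ℓ : Shape n) :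
    HolPrebundle n X :=
  HolPrebundle.ofFrames (fun x => ⨂[ℂ] _ : ℓ.diagram.cells, Cotangent n x)
    (fun x => schurPower ℓ.diagram (Cotangent n x)) (ℓ.diagram.cells → Fin n)
    (fun e I x => PiTensorProduct.tprod ℂ fun c => coordDiff e (I c) x)

end Schur

end GreenGriffiths

end

/-! Changing charts, the formula of Faà di Bruno writes each derivative of order λ as the Jacobian
applied to the derivatives of order λ in the old chart, plus products of derivatives of lower order.
These products have colexicographically smaller multidegree, and leading parts are multiplicative
(`isLeading_chainPoly`, `isLeading_jetChange`). So the filtration does not depend on the chart, and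
on the graded bundle only the linear substitution by the Jacobian survives (`grTriv_eq`). The
typical fibre is the space of polynomials of weight m in the κn variables x_i^{(λ)}, on which
matrices act by linear substitution in the index i.

It remains to decompose this space. To a semistandard tableau T of shape ℓ and weight m and a tensor
s in the Schur power of shape ℓ, with coordinates s(I), attach the polynomial Σ_I s(I) ∏_c
x_{I(c)}^{(T(c))}, the product being over the cells c of the diagram. The sum of these maps over all
T is compatible with linear substitutions (`tensorCoeff_eq_sum`), so it gives the isomorphism of
bundles as soon as it is bijective.

Injectivity (`eq_zero_of_sum_content_eq_zero`) is a triangularity argument. Among the tableaux with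
a nonzero tensor, take one which is maximal for dominance of the shape and then for a row weight of
the filling. A coefficient of the polynomial is, up to a factor, a sum over bijections between
cells. After symmetrizing along the rows of the chosen diagram, a bijection sending two cells of a
column to one row contributes 0 because the tensors alternate along columns. Any other bijection
makes one shape dominate the other, and in the case of equality it factors as a row permutation
times a column permutation, which then forces equal tableaux. What survives is a positive multiple
of the row symmetrization of the chosen tensor, and this determines the tensor
(`eq_zero_of_rowSymm_eq_zero`).

Surjectivity is a count of dimensions. The Robinson-Schensted-Knuth map, built from growth diagrams,
embeds the monomials into pairs of tableaux of the same shape (`rsk_injective`), and the Schur power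
of an n-dimensional space has dimension at least the number of tableaux with entries at most n
(`card_boundedTableau_le`). Only inequalities are needed: together with the injectivity above they
close up.

For cohomology, multidegrees are split off one at a time. Each step is a short exact sequence of
sheaves, along which dimensions of Ext are subadditive (`h_jetBundle_le`), and in finite direct sums
these dimensions add up. -/

noncomputable section

namespace GreenGriffiths

/-! ### Growth diagrams and the Robinson-Schensted-Knuth injection -/

section Growth

/-- The growth diagram of a matrix `M` of natural numbers: `growth M i j` is the partition attached
by the Robinson-Schensted-Knuth correspondence to the upper left `i × j` block of `M`. -/
def growth (M : ℕ → ℕ → ℕ) : ℕ → ℕ → ℕ → ℕ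
  | 0, _, _ => 0
  | _ + 1, 0, _ => 0
  | i + 1, j + 1, 0 => max (growth M i (j + 1) 0) (growth M (i + 1) j 0) + M i j
  -- This is Fomin's local rule. The subtraction is never truncated, since the partition at `(i, j)`
  -- is contained in both of its neighbours (`growth_interlace`).
  | i + 1, j + 1, k + 1 => max (growth M i (j + 1) (k + 1)) (growth M (i + 1) j (k + 1)) +
      min (growth M i (j + 1) k) (growth M (i + 1) j k) - growth M i j k

variable (M : ℕ → ℕ → ℕ)

@[simp] lemma growth_zero_left (j k : ℕ) : growth M 0 j k = 0 := by rw [growth]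

@[simp] lemma growth_zero_right (i k : ℕ) : growth M i 0 k = 0 := by
  cases i <;> rw [growth]

lemma growth_succ_zero (i j : ℕ) : growth M (i + 1) (j + 1) 0 =
    max (growth M i (j + 1) 0) (growth M (i + 1) j 0) + M i j := by rw [growth]

lemma growth_succ_succ (i j k : ℕ) : growth M (i + 1) (j + 1) (k + 1) =
    max (growth M i (j + 1) (k + 1)) (growth M (i + 1) j (k + 1)) +
      min (growth M i (j + 1) k) (growth M (i + 1) j k) - growth M i j k := by rw [growth]

/-- Neighbouring partitions of a growth diagram differ by horizontal strips. -/
lemma growth_interlace (i : ℕ) : ∀ j,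
    ((∀ k, growth M i j k ≤ growth M i (j + 1) k) ∧
      ∀ k, growth M i (j + 1) (k + 1) ≤ growth M i j k) ∧
    ((∀ k, growth M i j k ≤ growth M (i + 1) j k) ∧
      ∀ k, growth M (i + 1) j (k + 1) ≤ growth M i j k) := by
  -- In each cell of the grid, the strip conditions on the two edges at the corner `(i, j)` force
  -- them on the two opposite edges; the induction then sweeps the grid.
  have cell : ∀ i j,
      ((∀ k, growth M i j k ≤ growth M i (j + 1) k) ∧
        ∀ k, growth M i (j + 1) (k + 1) ≤ growth M i j k) →
      ((∀ k, growth M i j k ≤ growth M (i + 1) j k) ∧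
        ∀ k, growth M (i + 1) j (k + 1) ≤ growth M i j k) →
      ((∀ k, growth M (i + 1) j k ≤ growth M (i + 1) (j + 1) k) ∧
        ∀ k, growth M (i + 1) (j + 1) (k + 1) ≤ growth M (i + 1) j k) ∧
      ((∀ k, growth M i (j + 1) k ≤ growth M (i + 1) (j + 1) k) ∧
        ∀ k, growth M (i + 1) (j + 1) (k + 1) ≤ growth M i (j + 1) k) := by
    rintro i j ⟨h1, h2⟩ ⟨h3, h4⟩
    refine ⟨⟨fun k => ?_, fun k => ?_⟩, ⟨fun k => ?_, fun k => ?_⟩⟩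
    · cases k with
      | zero => rw [growth_succ_zero]; omega
      | succ k => have := h1 k; have := h3 k; rw [growth_succ_succ]; omega
    · have := h1 k; have := h2 k; have := h3 k; have := h4 k; rw [growth_succ_succ]; omega
    · cases k with
      | zero => rw [growth_succ_zero]; omega
      | succ k => have := h1 k; have := h3 k; rw [growth_succ_succ]; omega
    · have := h1 k; have := h2 k; have := h3 k; have := h4 k; rw [growth_succ_succ]; omega
  induction i with
  | zero =>
    intro j
    induction j with
    | zero => simp
    | succ j ih => exact ⟨by simp, (cell 0 j ih.1 ih.2).2⟩
  | succ i hi =>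
    intro j
    induction j with
    | zero => exact ⟨(cell i 0 (hi 0).1 (hi 0).2).1, by simp⟩
    | succ j ih =>
      exact ⟨(cell i (j + 1) (hi (j + 1)).1 (hi (j + 1)).2).1, (cell (i + 1) j ih.1 ih.2).2⟩

lemma growth_antitone (i j : ℕ) : Antitone (growth M i j) := by
  refine antitone_nat_of_succ_le fun k => ?_
  cases i with
  | zero => simp
  | succ i => exact ((growth_interlace M i j).2.2 k).trans ((growth_interlace M i j).2.1 k)

/-- A horizontal strip adds at most one new row, so after `i` steps from the empty partition there
are at most `i` rows. -/
lemma growth_eq_zero (i : ℕ) : ∀ j k, i ≤ k → growth M i j k = 0 := by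
  induction i with
  | zero => simp
  | succ i hi =>
    intro j k hk
    obtain ⟨k, rfl⟩ : ∃ k', k = k' + 1 := ⟨k - 1, by omega⟩
    have h := (growth_interlace M i j).2.2 k
    rw [hi j k (by omega)] at h
    omega

/-- Since max plus min is the sum, the local rule says that opposite corners of a cell have the same
total size as the other two corners, up to the matrix entry. Hence sizes of partitions are block
sums of the matrix. -/
lemma sum_growth (L i : ℕ) (hi : i ≤ L) : ∀ j, ∑ k ∈ Finset.range (L + 1), growth M i j k =
    ∑ j' ∈ Finset.range j, ∑ i' ∈ Finset.range i, M i' j' := by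
  induction i with
  | zero => simp
  | succ i ih =>
    intro j
    induction j with
    | zero => simp
    | succ j ihj =>
      have key : ∑ k ∈ Finset.range (L + 1), growth M (i + 1) (j + 1) k +
          ∑ k ∈ Finset.range (L + 1), growth M i j k =
          ∑ k ∈ Finset.range (L + 1), growth M i (j + 1) k +
          ∑ k ∈ Finset.range (L + 1), growth M (i + 1) j k + M i j := by
        -- Row `L` is empty, so the shift of the index by one between the maxima and the minima
        -- loses no term.
        have h0 : ∀ j, growth M i j L = 0 := fun j => growth_eq_zero M i j L (by omega)
        rw [Finset.sum_range_succ' (growth M (i + 1) (j + 1)),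
          Finset.sum_range_succ (growth M i j), h0, growth_succ_zero, add_zero, add_right_comm,
          ← Finset.sum_add_distrib]
        have h1 : ∀ k ∈ Finset.range L, growth M (i + 1) (j + 1) (k + 1) + growth M i j k =
            max (growth M i (j + 1) (k + 1)) (growth M (i + 1) j (k + 1)) +
            min (growth M i (j + 1) k) (growth M (i + 1) j k) := by
          intro k _
          have := (growth_interlace M i j).1.1 k
          have := (growth_interlace M i j).2.1 k
          rw [growth_succ_succ]; omega
        rw [Finset.sum_congr rfl h1, Finset.sum_add_distrib]
        have h2 := Finset.sum_range_succ'
          (fun k => max (growth M i (j + 1) k) (growth M (i + 1) j k)) L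
        have h3 := Finset.sum_range_succ
          (fun k => min (growth M i (j + 1) k) (growth M (i + 1) j k)) L
        have h4 : ∑ k ∈ Finset.range (L + 1), growth M i (j + 1) k +
            ∑ k ∈ Finset.range (L + 1), growth M (i + 1) j k =
            ∑ k ∈ Finset.range (L + 1), max (growth M i (j + 1) k) (growth M (i + 1) j k) +
            ∑ k ∈ Finset.range (L + 1), min (growth M i (j + 1) k) (growth M (i + 1) j k) := by
          rw [← Finset.sum_add_distrib, ← Finset.sum_add_distrib]
          exact Finset.sum_congr rfl fun k _ => (max_add_min _ _).symm
        rw [h4, h2, h3, h0 (j + 1), Nat.zero_min]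
        omega
      rw [ih (by omega), ih (by omega), ihj, Finset.sum_range_succ (fun j' =>
        ∑ i' ∈ Finset.range i, M i' j')] at key
      rw [Finset.sum_range_succ (fun j' => ∑ i' ∈ Finset.range (i + 1), M i' j') j,
        Finset.sum_range_succ (fun i' => M i' j)]
      omega

/-- A matrix is determined by the boundary of its growth diagram. -/
lemma growth_boundary_injective {M M' : ℕ → ℕ → ℕ} {n κ : ℕ}
    (hn : ∀ j ≤ κ, growth M n j = growth M' n j) (hκ : ∀ i ≤ n, growth M i κ = growth M' i κ)
    {i j : ℕ} (hi : i < n) (hj : j < κ) : M i j = M' i j := by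
  -- The local rule can be solved for the partition at `(i, j)` given the three other corners, so
  -- the diagram is rebuilt from its far boundary; `a` and `b` are the distances to it.
  have main : ∀ a i, i + a = n → ∀ b j, j + b = κ → growth M i j = growth M' i j := by
    intro a
    induction a with
    | zero =>
      rintro i rfl b j hb
      exact hn j (by omega)
    | succ a iha =>
      intro i hia b
      induction b with
      | zero =>
        rintro j rfl
        exact hκ i (by omega)
      | succ b ihb =>
        intro j hjb
        ext k
        have e1 := congrFun (iha (i + 1) (by omega) (b + 1) j hjb)
        have e2 := congrFun (iha (i + 1) (by omega) b (j + 1) (by omega)) (k + 1)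
        have e3 := congrFun (ihb (j + 1) (by omega))
        have a1 := (growth_interlace M i j).1.1 k
        have a2 := (growth_interlace M i j).2.1 k
        have a3 := (growth_interlace M' i j).1.1 k
        have a4 := (growth_interlace M' i j).2.1 k
        rw [growth_succ_succ, growth_succ_succ, e1, e1, e3, e3] at e2
        rw [e1] at a2
        rw [e3] at a1
        omega
  -- With the whole diagram known, the matrix entry is read off from the rule for the first row.
  have e1 := congrFun (main (n - i - 1) (i + 1) (by omega) (κ - j) j (by omega)) 0
  have e2 := congrFun (main (n - i - 1) (i + 1) (by omega) (κ - j - 1) (j + 1) (by omega)) 0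
  have e3 := congrFun (main (n - i) i (by omega) (κ - j - 1) (j + 1) (by omega)) 0
  rw [growth_succ_zero, growth_succ_zero, e1, e3] at e2
  omega

end Growth

/-! ### Semistandard tableaux as chains of partitions -/

section Chains

/-- The Young diagram of a shape. -/
lemma Shape.mem_diagram {n : ℕ} (ℓ : Shape n) {c : ℕ × ℕ} :
    c ∈ ℓ.diagram ↔ ∃ h : c.1 < n, c.2 < ℓ.1 ⟨c.1, h⟩ := by
  simp [Shape.diagram, YoungDiagram.mem_ofRowLens]

/-- The semi-standard tableaux of shape `ℓ` with entries in `{1, …, κ}`. -/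
abbrev BoundedTableau {n : ℕ} (ℓ : Shape n) (κ : ℕ) : Type :=
  {T : SemistandardYoungTableau ℓ.diagram //
    ∀ c ∈ ℓ.diagram.cells, 1 ≤ T c.1 c.2 ∧ T c.1 c.2 ≤ κ}

/-- The semi-standard tableaux of shape `ℓ` with entries in `{1, …, κ}` of sum `m`. -/
abbrev WeightedTableau {n : ℕ} (ℓ : Shape n) (κ m : ℕ) : Type :=
  {T : SemistandardYoungTableau ℓ.diagram //
    (∀ c ∈ ℓ.diagram.cells, 1 ≤ T c.1 c.2 ∧ T c.1 c.2 ≤ κ) ∧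
      ∑ c ∈ ℓ.diagram.cells, T c.1 c.2 = m}

/-- A chain `0 = g 0 ⊆ g 1 ⊆ ⋯ ⊆ g κ` of partitions whose steps are horizontal strips. -/
structure IsStripChain (g : ℕ → ℕ → ℕ) : Prop where
  zero : ∀ k, g 0 k = 0
  mono : ∀ k, Monotone fun j => g j k
  strip : ∀ j k, g (j + 1) (k + 1) ≤ g j k

/-- The number of `j < κ` with `g j k ≤ c`: the entry in the cell `(k, c)` of the tableau attached
to a chain. -/
def chainEntry (g : ℕ → ℕ → ℕ) (κ k c : ℕ) : ℕ := ((Finset.range κ).filter (g · k ≤ c)).card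

/-- By monotonicity the indices `j` with `g j k ≤ c` form an initial segment, so their number is the
first index at which the cell `(k, c)` belongs to the chain. -/
lemma chainEntry_le_iff {g : ℕ → ℕ → ℕ} (hg : IsStripChain g) {κ k c j : ℕ} (hj : j ≤ κ)
    (hc : c < g κ k) : chainEntry g κ k c ≤ j ↔ c < g j k := by
  constructor
  · intro h
    by_contra! hlt
    have hjκ : j < κ := lt_of_le_of_ne hj (by rintro rfl; omega)
    have : Finset.range (j + 1) ⊆ (Finset.range κ).filter (g · k ≤ c) := fun i hi => by
      rw [Finset.mem_range] at hi
      exact Finset.mem_filter.2 ⟨Finset.mem_range.2 (by omega),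
        (hg.mono k (show i ≤ j by omega)).trans hlt⟩
    have := Finset.card_le_card this
    rw [Finset.card_range] at this
    rw [chainEntry] at h
    omega
  · intro h
    have : (Finset.range κ).filter (g · k ≤ c) ⊆ Finset.range j := fun i hi => by
      rw [Finset.mem_filter] at hi
      rw [Finset.mem_range]
      by_contra! hle
      have := hg.mono k hle
      simp only at this
      omega
    simpa [chainEntry] using Finset.card_le_card this

lemma chainEntry_pos {g : ℕ → ℕ → ℕ} (hg : IsStripChain g) {κ k c : ℕ} (hc : c < g κ k) :
    1 ≤ chainEntry g κ k c := by
  by_contra! h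
  have := (chainEntry_le_iff hg (Nat.zero_le κ) hc).1 (by omega)
  rw [hg.zero] at this
  omega

/-- A horizontal strip has no two cells in one column: if the cell `(k + 1, c)` is present at step
`j' + 1`, the cell above it was already present at step `j'`. -/
lemma chainEntry_lt_chainEntry_succ {g : ℕ → ℕ → ℕ} (hg : IsStripChain g) {κ k c : ℕ}
    (hc : c < g κ (k + 1)) : chainEntry g κ k c < chainEntry g κ (k + 1) c := by
  by_contra! hle
  set j := chainEntry g κ k c with hj
  have h1 : 1 ≤ j := (chainEntry_pos hg hc).trans hle
  have hjκ : j ≤ κ := (Finset.card_filter_le _ _).trans (by simp)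
  have h2 : c < g j (k + 1) := (chainEntry_le_iff hg hjκ hc).1 hle
  obtain ⟨j', h'⟩ : ∃ j', j = j' + 1 := ⟨j - 1, by omega⟩
  rw [h'] at h2
  have h3 : c < g j' k := h2.trans_le (hg.strip j' k)
  have h4 : c < g κ k := h3.trans_le (hg.mono k (by omega))
  have := (chainEntry_le_iff hg (show j' ≤ κ by omega) h4).2 h3
  omega

variable {n : ℕ}

/-- The tableau attached to a chain of partitions ending in `ℓ`: the entry in a cell is the index
of the first member of the chain which contains it. -/
def chainTableau {g : ℕ → ℕ → ℕ} (hg : IsStripChain g) (κ : ℕ) (ℓ : Shape n)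
    (hℓ : ∀ k : Fin n, ℓ.1 k = g κ k) : BoundedTableau ℓ κ := by
  have hmem : ∀ {c : ℕ × ℕ}, c ∈ ℓ.diagram → c.2 < g κ c.1 := fun {c} hc => by
    obtain ⟨h, hlt⟩ := ℓ.mem_diagram.1 hc
    exact hlt.trans_eq (hℓ ⟨c.1, h⟩)
  refine ⟨{ entry := fun k c => if (k, c) ∈ ℓ.diagram then chainEntry g κ k c else 0
            row_weak' := ?_, col_strict' := ?_, zeros' := fun h => if_neg h }, ?_⟩
  · intro k c₁ c₂ hc h
    rw [if_pos h, if_pos (ℓ.diagram.up_left_mem le_rfl hc.le h)]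
    exact Finset.card_le_card (Finset.monotone_filter_right _ fun j _ (hj : g j k ≤ c₁) => hj.trans hc.le)
  · intro k₁ k₂ c hk h
    rw [if_pos h, if_pos (ℓ.diagram.up_left_mem hk.le le_rfl h)]
    have step : ∀ d, (k₁ + 1 + d, c) ∈ ℓ.diagram →
        chainEntry g κ k₁ c < chainEntry g κ (k₁ + 1 + d) c := by
      intro d
      induction d with
      | zero => exact fun h => chainEntry_lt_chainEntry_succ hg (hmem h)
      | succ d ih =>
        exact fun h => (ih (ℓ.diagram.up_left_mem (by omega) le_rfl h)).trans
          (chainEntry_lt_chainEntry_succ hg (hmem h))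
    have := step (k₂ - (k₁ + 1)) (by rwa [Nat.add_sub_cancel' hk])
    rwa [Nat.add_sub_cancel' hk] at this
  · intro c hc
    change 1 ≤ (if (c.1, c.2) ∈ ℓ.diagram then chainEntry g κ c.1 c.2 else 0) ∧
      (if (c.1, c.2) ∈ ℓ.diagram then chainEntry g κ c.1 c.2 else 0) ≤ κ
    rw [if_pos ((YoungDiagram.mem_cells _).1 hc)]
    exact ⟨chainEntry_pos hg (hmem ((YoungDiagram.mem_cells _).1 hc)),
      (Finset.card_filter_le _ _).trans (by simp)⟩

lemma chainTableau_apply {g : ℕ → ℕ → ℕ} (hg : IsStripChain g) {κ : ℕ} {ℓ : Shape n}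
    (hℓ : ∀ k : Fin n, ℓ.1 k = g κ k) {k c : ℕ} (h : (k, c) ∈ ℓ.diagram) :
    (chainTableau hg κ ℓ hℓ).1 k c = chainEntry g κ k c :=
  if_pos h

/-- The tableau gives back the chain: below the length of the row, `c < g j k` means that the entry
at `(k, c)` is at most `j`; beyond that length both chains have no cell. -/
lemma chainTableau_injective {g g' : ℕ → ℕ → ℕ} (hg : IsStripChain g) (hg' : IsStripChain g')
    {κ : ℕ} {ℓ : Shape n} (hℓ : ∀ k : Fin n, ℓ.1 k = g κ k) (hℓ' : ∀ k : Fin n, ℓ.1 k = g' κ k)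
    (h : chainTableau hg κ ℓ hℓ = chainTableau hg' κ ℓ hℓ') {j : ℕ} (hj : j ≤ κ) (k : Fin n) :
    g j k = g' j k := by
  refine eq_of_forall_lt_iff fun c => ?_
  have e : g κ k = g' κ k := by rw [← hℓ, ← hℓ']
  by_cases hc : c < g κ k
  · have hmem : ((k : ℕ), c) ∈ ℓ.diagram := ℓ.mem_diagram.2 ⟨k.2, by rw [hℓ]; exact hc⟩
    rw [← chainEntry_le_iff hg hj hc, ← chainEntry_le_iff hg' hj (e ▸ hc),
      ← chainTableau_apply hg hℓ hmem, ← chainTableau_apply hg' hℓ' hmem, h]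
  · have h1 := hg.mono k hj
    have h2 := hg'.mono k hj
    simp only at h1 h2
    constructor <;> intro h3 <;> omega

lemma Shape.sum_diagram (ℓ : Shape n) (f : ℕ → ℕ → ℕ) :
    ∑ c ∈ ℓ.diagram.cells, f c.1 c.2 = ∑ k : Fin n, ∑ c ∈ Finset.range (ℓ.1 k), f k c := by
  rw [Finset.sum_sigma']
  symm
  refine Finset.sum_bij (fun x _ => ((x.1 : ℕ), x.2)) ?_ ?_ ?_ fun _ _ => rfl
  · rintro ⟨k, c⟩ h
    simp only [Finset.mem_sigma, Finset.mem_univ, Finset.mem_range, true_and] at h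
    exact (YoungDiagram.mem_cells _).2 (ℓ.mem_diagram.2 ⟨k.2, h⟩)
  · rintro ⟨k, c⟩ _ ⟨k', c'⟩ _ h
    simp only [Prod.mk.injEq] at h
    obtain ⟨h1, rfl⟩ := h
    obtain rfl := Fin.ext h1
    rfl
  · rintro ⟨k, c⟩ h
    obtain ⟨h1, h2⟩ := ℓ.mem_diagram.1 ((YoungDiagram.mem_cells (k, c)).1 h)
    exact ⟨⟨⟨k, h1⟩, c⟩, by simpa using h2, rfl⟩

/-- Double counting in a rectangle of size `κ` by `g κ k`: each pair `(j, c)` satisfies either `g j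
k ≤ c` or `c < g j k`. -/
lemma sum_chainEntry_add (g : ℕ → ℕ → ℕ) (hg : IsStripChain g) (κ k : ℕ) :
    ∑ c ∈ Finset.range (g κ k), chainEntry g κ k c + ∑ j ∈ Finset.range κ, g j k = κ * g κ k := by
  simp only [chainEntry, Finset.card_filter]
  rw [Finset.sum_comm, ← Finset.sum_add_distrib]
  have : ∀ j ∈ Finset.range κ,
      (∑ c ∈ Finset.range (g κ k), if g j k ≤ c then 1 else 0) + g j k = g κ k := by
    intro j hj
    have hle : g j k ≤ g κ k := hg.mono k (Finset.mem_range.1 hj).le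
    rw [← Finset.sum_filter, ← Finset.card_eq_sum_ones,
      show (Finset.range (g κ k)).filter (g j k ≤ ·) = Finset.Ico (g j k) (g κ k) by
        ext; simp; tauto, Nat.card_Ico]
    omega
  rw [Finset.sum_congr rfl this]
  simp

/-- The step from `j` to `j + 1` adds `d j` cells, all with entry `j + 1`. The computation is a
summation by parts (`h3`) from the row count of `sum_chainEntry_add`. -/
lemma sum_chainTableau {g : ℕ → ℕ → ℕ} (hg : IsStripChain g) {κ : ℕ} {ℓ : Shape n}
    (hℓ : ∀ k : Fin n, ℓ.1 k = g κ k) {d : ℕ → ℕ}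
    (hd : ∀ j, ∑ k : Fin n, g j k = ∑ j' ∈ Finset.range j, d j') :
    ∑ c ∈ ℓ.diagram.cells, (chainTableau hg κ ℓ hℓ).1 c.1 c.2 =
      ∑ j ∈ Finset.range κ, (j + 1) * d j := by
  have h1 : ∑ c ∈ ℓ.diagram.cells, (chainTableau hg κ ℓ hℓ).1 c.1 c.2 =
      ∑ k : Fin n, ∑ c ∈ Finset.range (g κ k), chainEntry g κ k c := by
    rw [Finset.sum_congr rfl fun c hc => chainTableau_apply hg hℓ ((YoungDiagram.mem_cells _).1 hc),
      ℓ.sum_diagram]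
    simp only [hℓ]
  have h2 : ∑ k : Fin n, ∑ c ∈ Finset.range (g κ k), chainEntry g κ k c +
      ∑ j ∈ Finset.range κ, ∑ j' ∈ Finset.range j, d j' =
      κ * ∑ j' ∈ Finset.range κ, d j' := by
    simp only [← hd]
    rw [Finset.sum_comm, ← Finset.sum_add_distrib, Finset.mul_sum]
    exact Finset.sum_congr rfl fun k _ => sum_chainEntry_add g hg κ k
  have h3 : ∀ κ : ℕ, ∑ j ∈ Finset.range κ, (j + 1) * d j +
      ∑ j ∈ Finset.range κ, ∑ j' ∈ Finset.range j, d j' = κ * ∑ j' ∈ Finset.range κ, d j' := by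
    intro κ
    induction κ with
    | zero => simp
    | succ κ ih =>
      simp only [Finset.sum_range_succ _ κ]
      linarith
  rw [h1]
  have := h3 κ
  omega

end Chains

/-! ### The Robinson-Schensted-Knuth map on exponents -/

section RSK

variable {n κ m : ℕ}

/-- The exponents of a jet monomial as a matrix. -/
def JetExponent.matrix (α : JetExponent n κ m) (i l : ℕ) : ℕ :=
  if h : i < n ∧ l < κ then α.1 ⟨l, h.2⟩ ⟨i, h.1⟩ else 0

lemma isStripChain_growth_left (M : ℕ → ℕ → ℕ) (n : ℕ) : IsStripChain (growth M n) where
  zero := by simp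
  mono k := monotone_nat_of_le_succ fun j => (growth_interlace M n j).1.1 k
  strip j k := (growth_interlace M n j).1.2 k

lemma isStripChain_growth_right (M : ℕ → ℕ → ℕ) (κ : ℕ) :
    IsStripChain fun i => growth M i κ where
  zero := by simp
  mono k := monotone_nat_of_le_succ fun i => (growth_interlace M i κ).2.1 k
  strip i k := (growth_interlace M i κ).2.2 k

/-- The common shape of the pair of tableaux attached to the exponents of a jet monomial. -/
def JetExponent.shape (α : JetExponent n κ m) : Shape n :=
  ⟨fun k => growth α.matrix n κ k, fun _ _ h => growth_antitone _ _ _ h⟩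

lemma JetExponent.sum_matrix (α : JetExponent n κ m) :
    ∑ l ∈ Finset.range κ, (l + 1) * ∑ i ∈ Finset.range n, α.matrix i l = m := by
  refine Eq.trans ?_ α.2
  rw [← Fin.sum_univ_eq_sum_range (fun l => (l + 1) * ∑ i ∈ Finset.range n, α.matrix i l)]
  refine Finset.sum_congr rfl fun l _ => ?_
  rw [← Fin.sum_univ_eq_sum_range (fun i => α.matrix i l)]
  simp [JetExponent.matrix]

/-- The Robinson-Schensted-Knuth map. -/
def rsk (α : JetExponent n κ m) :
    Σ ℓ : Shape n, BoundedTableau ℓ n × WeightedTableau ℓ κ m :=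
  ⟨α.shape, chainTableau (isStripChain_growth_right α.matrix κ) n α.shape fun _ => rfl,
    (chainTableau (isStripChain_growth_left α.matrix n) κ α.shape fun _ => rfl).1,
    (chainTableau (isStripChain_growth_left α.matrix n) κ α.shape fun _ => rfl).2, by
      -- The number of entries `l + 1` is the sum of column `l` of the matrix, so the sum of the
      -- entries is the weight of the monomial. In `sum_growth` the extra row of index `n` is empty.
      refine (sum_chainTableau (isStripChain_growth_left α.matrix n) (fun _ => rfl)
        (d := fun l => ∑ i ∈ Finset.range n, α.matrix i l) fun j => ?_).trans α.sum_matrix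
      rw [← sum_growth α.matrix n n le_rfl j, Finset.sum_range_succ,
        growth_eq_zero _ n j n le_rfl, add_zero, Finset.sum_range]⟩

/-- The two tableaux encode the two far sides of the growth diagram, which determine the matrix.
Surjectivity is not needed. -/
lemma rsk_injective : Function.Injective (rsk : JetExponent n κ m → _) := by
  intro α β h
  obtain ⟨hs, h⟩ := Sigma.mk.inj h
  have key : ∀ ℓ (hα : ∀ k : Fin n, ℓ.1 k = growth α.matrix n κ k)
      (hβ : ∀ k : Fin n, ℓ.1 k = growth β.matrix n κ k),
      chainTableau (isStripChain_growth_right α.matrix κ) n ℓ hα =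
        chainTableau (isStripChain_growth_right β.matrix κ) n ℓ hβ →
      chainTableau (isStripChain_growth_left α.matrix n) κ ℓ hα =
        chainTableau (isStripChain_growth_left β.matrix n) κ ℓ hβ → α = β := by
    intro ℓ hα hβ h1 h2
    have h1' : ∀ i ≤ n, growth α.matrix i κ = growth β.matrix i κ := by
      intro i hi
      ext k
      by_cases hk : k < n
      · exact chainTableau_injective (isStripChain_growth_right α.matrix κ)
          (isStripChain_growth_right β.matrix κ) hα hβ h1 hi ⟨k, hk⟩
      · rw [growth_eq_zero _ i κ k (by omega), growth_eq_zero _ i κ k (by omega)]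
    have h2' : ∀ j ≤ κ, growth α.matrix n j = growth β.matrix n j := by
      intro j hj
      ext k
      by_cases hk : k < n
      · exact chainTableau_injective _ _ hα hβ h2 hj ⟨k, hk⟩
      · rw [growth_eq_zero _ n j k (by omega), growth_eq_zero _ n j k (by omega)]
    refine Subtype.ext (funext fun l => funext fun i => ?_)
    have := growth_boundary_injective h2' h1' i.2 l.2
    simpa [JetExponent.matrix] using this
  have hβ : ∀ k : Fin n, α.shape.1 k = growth β.matrix n κ k := fun k => by
    rw [hs]; rfl
  -- The shape is made a variable so that the heterogeneous equality of the pairs of tableaux can be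
  -- eliminated.
  have tr : ∀ ℓ (e : α.shape = ℓ) (hℓ : ∀ k : Fin n, ℓ.1 k = growth β.matrix n κ k)
      (T : WeightedTableau ℓ κ m)
      (_ : T.1 = (chainTableau (isStripChain_growth_left β.matrix n) κ ℓ hℓ).1),
      (rsk α).2 ≍ (⟨chainTableau (isStripChain_growth_right β.matrix κ) n ℓ hℓ, T⟩ :
        BoundedTableau ℓ n × WeightedTableau ℓ κ m) → α = β := by
    rintro _ rfl hℓ T hT h
    have h := eq_of_heq h
    exact key _ (fun _ => rfl) hℓ (congrArg Prod.fst h)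
      (Subtype.ext ((congrArg (fun x => x.2.1) h).trans hT))
  exact tr _ hs (fun _ => rfl) _ rfl h

end RSK

end GreenGriffiths

end

noncomputable section

namespace GreenGriffiths

/-! ### Young symmetrizers in coordinates -/

section YoungSymmetrizer

variable (μ : YoungDiagram)

/-- The permutations of the cells which preserve the rows. -/
def rowPerms : Finset (Equiv.Perm μ.cells) := {p | ∀ c, (p c).1.1 = c.1.1}

/-- The permutations of the cells which preserve the columns. -/
def colPerms : Finset (Equiv.Perm μ.cells) := {q | ∀ c, (q c).1.2 = c.1.2}

variable {μ}

lemma mem_rowPerms {p : Equiv.Perm μ.cells} : p ∈ rowPerms μ ↔ ∀ c, (p c).1.1 = c.1.1 := by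
  simp [rowPerms]

lemma mem_colPerms {q : Equiv.Perm μ.cells} : q ∈ colPerms μ ↔ ∀ c, (q c).1.2 = c.1.2 := by
  simp [colPerms]

lemma one_mem_rowPerms : (1 : Equiv.Perm μ.cells) ∈ rowPerms μ := mem_rowPerms.2 fun _ => rfl

lemma one_mem_colPerms : (1 : Equiv.Perm μ.cells) ∈ colPerms μ := mem_colPerms.2 fun _ => rfl

lemma mul_mem_rowPerms {p p' : Equiv.Perm μ.cells} (hp : p ∈ rowPerms μ) (hp' : p' ∈ rowPerms μ) :
    p * p' ∈ rowPerms μ :=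
  mem_rowPerms.2 fun c => (mem_rowPerms.1 hp _).trans (mem_rowPerms.1 hp' c)

lemma mul_mem_colPerms {q q' : Equiv.Perm μ.cells} (hq : q ∈ colPerms μ) (hq' : q' ∈ colPerms μ) :
    q * q' ∈ colPerms μ :=
  mem_colPerms.2 fun c => (mem_colPerms.1 hq _).trans (mem_colPerms.1 hq' c)

lemma inv_mem_rowPerms {p : Equiv.Perm μ.cells} (hp : p ∈ rowPerms μ) : p⁻¹ ∈ rowPerms μ :=
  mem_rowPerms.2 fun c => by
    simpa using (mem_rowPerms.1 hp (p⁻¹ c)).symm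

lemma inv_mem_colPerms {q : Equiv.Perm μ.cells} (hq : q ∈ colPerms μ) : q⁻¹ ∈ colPerms μ :=
  mem_colPerms.2 fun c => by
    simpa using (mem_colPerms.1 hq (q⁻¹ c)).symm

variable {ι : Type}

/-- Symmetrization along the rows of a tensor given by its coordinates. -/
def rowSymm (μ : YoungDiagram) (ι : Type) :
    ((μ.cells → ι) → ℂ) →ₗ[ℂ] ((μ.cells → ι) → ℂ) where
  toFun t I := ∑ p ∈ rowPerms μ, t (I ∘ p)
  map_add' t t' := by ext I; simp [Finset.sum_add_distrib]
  map_smul' a t := by ext I; simp [Finset.mul_sum]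

/-- Antisymmetrization along the columns of a tensor given by its coordinates. -/
def colAlt (μ : YoungDiagram) (ι : Type) :
    ((μ.cells → ι) → ℂ) →ₗ[ℂ] ((μ.cells → ι) → ℂ) where
  toFun t I := ∑ q ∈ colPerms μ, ((Equiv.Perm.sign q : ℤ) : ℂ) * t (I ∘ q)
  map_add' t t' := by ext I; simp [Finset.sum_add_distrib, mul_add]
  map_smul' a t := by ext I; simp [Finset.mul_sum, mul_left_comm]

lemma rowSymm_apply (t : (μ.cells → ι) → ℂ) (I : μ.cells → ι) :
    rowSymm μ ι t I = ∑ p ∈ rowPerms μ, t (I ∘ p) := rfl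

lemma colAlt_apply (t : (μ.cells → ι) → ℂ) (I : μ.cells → ι) :
    colAlt μ ι t I = ∑ q ∈ colPerms μ, ((Equiv.Perm.sign q : ℤ) : ℂ) * t (I ∘ q) := rfl

/-- The coordinates of the tensors in the Schur power of `ι → ℂ`. -/
def schurCoord (μ : YoungDiagram) (ι : Type) : Submodule ℂ ((μ.cells → ι) → ℂ) :=
  LinearMap.range (colAlt μ ι ∘ₗ rowSymm μ ι)

lemma sum_rowPerms_mul_right (p₀ : Equiv.Perm μ.cells) (hp₀ : p₀ ∈ rowPerms μ)
    (f : Equiv.Perm μ.cells → ℂ) : ∑ p ∈ rowPerms μ, f (p * p₀) = ∑ p ∈ rowPerms μ, f p :=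
  Finset.sum_bij' (fun p _ => p * p₀) (fun p _ => p * p₀⁻¹)
    (fun _ h => mul_mem_rowPerms h hp₀) (fun _ h => mul_mem_rowPerms h (inv_mem_rowPerms hp₀))
    (by simp) (by simp) (by simp)

lemma sum_colPerms_mul_left (q₀ : Equiv.Perm μ.cells) (hq₀ : q₀ ∈ colPerms μ)
    (f : Equiv.Perm μ.cells → ℂ) : ∑ q ∈ colPerms μ, f (q₀ * q) = ∑ q ∈ colPerms μ, f q :=
  Finset.sum_bij' (fun q _ => q₀ * q) (fun q _ => q₀⁻¹ * q)
    (fun _ h => mul_mem_colPerms hq₀ h) (fun _ h => mul_mem_colPerms (inv_mem_colPerms hq₀) h)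
    (by simp) (by simp) (by simp)

lemma sign_mul_self (q : Equiv.Perm μ.cells) :
    ((Equiv.Perm.sign q : ℤ) : ℂ) * ((Equiv.Perm.sign q : ℤ) : ℂ) = 1 := by
  rcases Int.units_eq_one_or (Equiv.Perm.sign q) with h | h <;> simp [h]

lemma colAlt_comp_colPerm (t : (μ.cells → ι) → ℂ) {q₀ : Equiv.Perm μ.cells}
    (hq₀ : q₀ ∈ colPerms μ) (I : μ.cells → ι) :
    colAlt μ ι t (I ∘ q₀) = ((Equiv.Perm.sign q₀ : ℤ) : ℂ) * colAlt μ ι t I := by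
  rw [colAlt_apply, colAlt_apply, ← sum_colPerms_mul_left q₀ hq₀
    (fun q => ((Equiv.Perm.sign q : ℤ) : ℂ) * t (I ∘ q)), Finset.mul_sum]
  refine Finset.sum_congr rfl fun q _ => ?_
  rw [← mul_assoc, Equiv.Perm.sign_mul, Units.val_mul, Int.cast_mul, ← mul_assoc, sign_mul_self,
    one_mul]
  rfl

/-- Column antisymmetrization comes last in the Young symmetrizer, so its image alternates along
columns. This is the property of Schur tensors used in the vanishing arguments. -/
lemma schurCoord_comp_colPerm {s : (μ.cells → ι) → ℂ} (hs : s ∈ schurCoord μ ι)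
    {q₀ : Equiv.Perm μ.cells} (hq₀ : q₀ ∈ colPerms μ) (I : μ.cells → ι) :
    s (I ∘ q₀) = ((Equiv.Perm.sign q₀ : ℤ) : ℂ) * s I := by
  obtain ⟨t, rfl⟩ := hs
  exact colAlt_comp_colPerm _ hq₀ I

/-- A tensor in the Schur power whose row symmetrization vanishes is zero. -/
lemma eq_zero_of_rowSymm_eq_zero [Fintype ι] {s : (μ.cells → ι) → ℂ}
    (hs : s ∈ schurCoord μ ι) (h : rowSymm μ ι s = 0) : s = 0 := by
  classical
  have hs' := hs
  obtain ⟨v, hv⟩ := hs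
  -- For the standard Hermitian form on coordinates the adjoint of a permutation is its inverse.
  -- Hence row symmetrization is self-adjoint, and pairing a column antisymmetrization with the
  -- alternating tensor `s` only multiplies by the number of column permutations.
  have reindex : ∀ (p : Equiv.Perm μ.cells) (f g : (μ.cells → ι) → ℂ),
      ∑ I, f (I ∘ p) * star (g I) = ∑ I, f I * star (g (I ∘ (p⁻¹ : Equiv.Perm μ.cells))) := by
    intro p f g
    refine Fintype.sum_equiv (Equiv.arrowCongr p⁻¹ (Equiv.refl ι)) _ _ fun I => ?_
    have h1 : (Equiv.arrowCongr p⁻¹ (Equiv.refl ι)) I = I ∘ p := by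
      ext c; simp [Equiv.arrowCongr]; rfl
    have h2 : (I ∘ p) ∘ (p⁻¹ : Equiv.Perm μ.cells) = I := by ext c; simp
    rw [h1, h2]
  have hrow : ∀ f g : (μ.cells → ι) → ℂ,
      ∑ I, rowSymm μ ι f I * star (g I) = ∑ I, f I * star (rowSymm μ ι g I) := by
    intro f g
    simp only [rowSymm_apply, Finset.sum_mul, star_sum, Finset.mul_sum]
    rw [Finset.sum_comm, Finset.sum_comm (s := Finset.univ)]
    refine Finset.sum_bij' (fun p _ => p⁻¹) (fun p _ => p⁻¹) (fun _ h => inv_mem_rowPerms h)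
      (fun _ h => inv_mem_rowPerms h) (by simp) (by simp) fun p _ => reindex p f g
  have hcol : ∑ I, colAlt μ ι (rowSymm μ ι v) I * star (s I) =
      (colPerms μ).card * ∑ I, rowSymm μ ι v I * star (s I) := by
    simp only [colAlt_apply, Finset.sum_mul]
    rw [Finset.sum_comm, ← nsmul_eq_mul, ← Finset.sum_const]
    refine Finset.sum_congr rfl fun q hq => ?_
    simp only [mul_assoc, ← Finset.mul_sum]
    rw [reindex, Finset.mul_sum]
    refine Finset.sum_congr rfl fun I _ => ?_
    rw [schurCoord_comp_colPerm hs' (inv_mem_colPerms hq), Equiv.Perm.sign_inv, star_mul']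
    have : star ((Equiv.Perm.sign q : ℤ) : ℂ) = ((Equiv.Perm.sign q : ℤ) : ℂ) := by simp
    rw [this, mul_left_comm (rowSymm μ ι v I), ← mul_assoc, sign_mul_self, one_mul]
  -- With `C` and `R` for the two symmetrizers and `s = C R v`, the form gives `⟨s, s⟩ = |C| ⟨R v,
  -- s⟩ = |C| ⟨v, R s⟩ = 0`, where `|C|` is the number of column permutations.
  have h0 : ∑ I, s I * star (s I) = 0 := by
    calc ∑ I, s I * star (s I) = ∑ I, colAlt μ ι (rowSymm μ ι v) I * star (s I) := by
          rw [← hv]; rfl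
      _ = 0 := by rw [hcol, hrow, h]; simp
  have h1 : ∑ I, Complex.normSq (s I) = 0 := by
    rw [← Complex.ofReal_inj, Complex.ofReal_sum, Complex.ofReal_zero, ← h0]
    exact Finset.sum_congr rfl fun I _ => (Complex.mul_conj _).symm
  ext I
  exact Complex.normSq_eq_zero.1 ((Finset.sum_eq_zero_iff_of_nonneg
    fun _ _ => Complex.normSq_nonneg _).1 h1 I (Finset.mem_univ I))

end YoungSymmetrizer

/-! ### Dominance and factorization of bijections between cells -/

section Dominance

/-- The number of cells in the first `i` rows. -/
def rowCount (μ : YoungDiagram) (i : ℕ) : ℕ :=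
  (Finset.univ.filter fun c : μ.cells => c.1.1 < i).card

variable {μ ν : YoungDiagram}

/-- A filling which is injective on the columns has in each column at most as many entries `< i` as
there are cells in the first `i` rows. -/
lemma card_col_lt_le (R : μ.cells → ℕ) (hR : ∀ c c', c.1.2 = c'.1.2 → R c = R c' → c = c')
    (i j : ℕ) : (Finset.univ.filter fun c : μ.cells => R c < i ∧ c.1.2 = j).card ≤
      (Finset.univ.filter fun c : μ.cells => c.1.1 < i ∧ c.1.2 = j).card := by
  -- The entries below `i` in a column are distinct, so there are at most `i` of them and at most
  -- the length of the column; the minimum of these is the number of cells of the column in the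
  -- first `i` rows.
  have h1 : (Finset.univ.filter fun c : μ.cells => R c < i ∧ c.1.2 = j).card ≤ i := by
    rw [← Finset.card_range i]
    refine Finset.card_le_card_of_injOn R (fun c hc => ?_) fun c hc c' hc' h => ?_
    · simpa using (Finset.mem_filter.1 hc).2.1
    · exact hR c c' ((Finset.mem_filter.1 hc).2.2.trans (Finset.mem_filter.1 hc').2.2.symm) h
  have h2 : (Finset.univ.filter fun c : μ.cells => R c < i ∧ c.1.2 = j).card ≤ μ.colLen j := by
    rw [← Finset.card_range (μ.colLen j)]
    refine Finset.card_le_card_of_injOn (fun c => c.1.1) (fun c hc => ?_) fun c hc c' hc' h => ?_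
    · have hc2 := (Finset.mem_filter.1 hc).2.2
      rw [Finset.coe_range, Set.mem_Iio, ← YoungDiagram.mem_iff_lt_colLen, ← hc2]
      exact (YoungDiagram.mem_cells _).1 c.2
    · exact Subtype.ext (Prod.ext h
        ((Finset.mem_filter.1 hc).2.2.trans (Finset.mem_filter.1 hc').2.2.symm))
  refine (le_min h1 h2).trans ?_
  rw [← Finset.card_range (min i (μ.colLen j))]
  refine (Finset.card_le_card fun r hr => ?_).trans
    (Finset.card_image_le (f := fun c : μ.cells => c.1.1))
  have hr := Finset.mem_range.1 hr
  have hmem : (r, j) ∈ μ.cells := (YoungDiagram.mem_cells _).2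
    (YoungDiagram.mem_iff_lt_colLen.2 (hr.trans_le (min_le_right _ _)))
  exact Finset.mem_image.2 ⟨⟨(r, j), hmem⟩, by simpa using hr.trans_le (min_le_left _ _), rfl⟩

lemma card_lt_eq_sum (R : μ.cells → ℕ) (i : ℕ) :
    (Finset.univ.filter fun c : μ.cells => R c < i).card =
      ∑ j ∈ Finset.univ.image fun c : μ.cells => c.1.2,
        (Finset.univ.filter fun c : μ.cells => R c < i ∧ c.1.2 = j).card := by
  rw [Finset.card_eq_sum_card_fiberwise (f := fun c : μ.cells => c.1.2)
    (t := Finset.univ.image fun c : μ.cells => c.1.2)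
    fun c _ => Finset.mem_coe.2 (Finset.mem_image_of_mem _ (Finset.mem_univ c))]
  exact Finset.sum_congr rfl fun j _ => by rw [Finset.filter_filter]

/-- If no two cells in the same column of `μ` are sent by `σ` to the same row of `ν`, then `μ`
dominates `ν`. -/
lemma rowCount_le_rowCount (σ : μ.cells ≃ ν.cells)
    (hσ : ∀ c c', c.1.2 = c'.1.2 → (σ c).1.1 = (σ c').1.1 → c = c') (i : ℕ) :
    rowCount ν i ≤ rowCount μ i := by
  have h1 : rowCount ν i = (Finset.univ.filter fun c : μ.cells => (σ c).1.1 < i).card := by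
    refine (Finset.card_bij (fun c _ => σ c) (fun c hc => ?_) (fun c _ c' _ h => σ.injective h)
      fun c hc => ?_).symm
    · simpa using hc
    · exact ⟨σ.symm c, by simpa using hc, by simp⟩
  rw [h1, rowCount, card_lt_eq_sum (fun c => (σ c).1.1), card_lt_eq_sum (fun c => c.1.1)]
  exact Finset.sum_le_sum fun j _ => card_col_lt_le _ hσ i j

/-- A permutation of the cells which sends no two cells in the same column to the same row is a
product of a permutation preserving the rows and a permutation preserving the columns. -/
lemma exists_eq_row_mul_col (σ : Equiv.Perm μ.cells)
    (hσ : ∀ c c', c.1.2 = c'.1.2 → (σ c).1.1 = (σ c').1.1 → c = c') :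
    ∃ p ∈ rowPerms μ, ∃ q ∈ colPerms μ, σ = p * q := by
  have h1 : ∀ i, (Finset.univ.filter fun c : μ.cells => (σ c).1.1 < i).card = rowCount μ i := by
    intro i
    refine Finset.card_bij (fun c _ => σ c) (fun c hc => ?_) (fun c _ c' _ h => σ.injective h)
      fun c hc => ?_
    · simpa using hc
    · exact ⟨σ.symm c, by simpa using hc, by simp⟩
  -- The columnwise inequalities add up to an equality, because `σ` permutes the cells; so each of
  -- them is an equality.
  have h2 : ∀ i, ∀ j ∈ Finset.univ.image fun c : μ.cells => c.1.2,
      (Finset.univ.filter fun c : μ.cells => (σ c).1.1 < i ∧ c.1.2 = j).card =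
        (Finset.univ.filter fun c : μ.cells => c.1.1 < i ∧ c.1.2 = j).card := by
    intro i
    refine (Finset.sum_eq_sum_iff_of_le fun j _ => card_col_lt_le _ hσ i j).1 ?_
    rw [← card_lt_eq_sum (fun c => (σ c).1.1), ← card_lt_eq_sum (fun c => c.1.1), h1, rowCount]
  -- Taking `i` to be the length of the column shows that `σ` sends its cells to rows which that
  -- column meets. So there is a cell in the row of `σ c` and the column of `c`, and moving `c`
  -- there is the column factor `q`.
  have h3 : ∀ c : μ.cells, ((σ c).1.1, c.1.2) ∈ μ.cells := by
    intro c
    have h := h2 (μ.colLen c.1.2) c.1.2 (Finset.mem_image_of_mem _ (Finset.mem_univ c))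
    have h4 : (Finset.univ.filter fun d : μ.cells => d.1.1 < μ.colLen c.1.2 ∧ d.1.2 = c.1.2) =
        Finset.univ.filter fun d : μ.cells => d.1.2 = c.1.2 := by
      ext d
      simp only [Finset.mem_filter, Finset.mem_univ, true_and, and_iff_right_iff_imp]
      intro hd
      rw [← hd]
      exact YoungDiagram.mem_iff_lt_colLen.1 ((YoungDiagram.mem_cells _).1 d.2)
    have h5 : (Finset.univ.filter fun d : μ.cells => (σ d).1.1 < μ.colLen c.1.2 ∧ d.1.2 = c.1.2) =
        Finset.univ.filter fun d : μ.cells => d.1.2 = c.1.2 := by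
      refine Finset.eq_of_subset_of_card_le (fun d hd => ?_) ?_
      · simp only [Finset.mem_filter, Finset.mem_univ, true_and] at hd ⊢
        exact hd.2
      · rw [h, h4]
    have h6 : c ∈ Finset.univ.filter fun d : μ.cells => d.1.2 = c.1.2 := by simp
    rw [← h5] at h6
    exact (YoungDiagram.mem_cells _).2
      (YoungDiagram.mem_iff_lt_colLen.2 (Finset.mem_filter.1 h6).2.1)
  let q₀ : μ.cells → μ.cells := fun c => ⟨((σ c).1.1, c.1.2), h3 c⟩
  have hinj : Function.Injective q₀ := fun c c' h => by
    have h' := congrArg Subtype.val h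
    simp only [q₀, Prod.mk.injEq] at h'
    exact hσ c c' h'.2 h'.1
  let q : Equiv.Perm μ.cells := Equiv.ofBijective q₀ (Finite.injective_iff_bijective.1 hinj)
  have hq : ∀ c, q c = q₀ c := fun c => rfl
  refine ⟨σ * q⁻¹, mem_rowPerms.2 fun c => ?_, q, mem_colPerms.2 fun c => rfl, by simp⟩
  have : (q (q⁻¹ c)).1.1 = (σ (q⁻¹ c)).1.1 := rfl
  rw [← Equiv.Perm.mul_apply, mul_inv_cancel] at this
  exact this.symm

end Dominance

/-! ### Triangularity of semistandard fillings -/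

section Semistandard

variable {μ : YoungDiagram}

/-- A function and its composition with a permutation agree if both are monotone along each of the
blocks `k = const`, which the permutation preserves. -/
lemma comp_perm_eq_of_monotone {C : Type*} [Finite C] (k r f : C → ℕ) (p : Equiv.Perm C)
    (hp : ∀ c, k (p c) = k c) (hf : ∀ c c', k c = k c' → r c ≤ r c' → f c ≤ f c')
    (hfp : ∀ c c', k c = k c' → r c ≤ r c' → f (p c) ≤ f (p c')) (c : C) : f (p c) = f c := by
  classical
  have := Fintype.ofFinite C
  -- If `f c < g c`, then within the block of `c` the values of `g` at most `f c` sit at strictly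
  -- fewer places than those of `f`, although `p` carries one filling to the other.
  have aux : ∀ (f g : C → ℕ) (p : Equiv.Perm C), (∀ c, k (p c) = k c) →
      (∀ c, f (p c) = g c) → (∀ c c', k c = k c' → r c ≤ r c' → f c ≤ f c') →
      (∀ c c', k c = k c' → r c ≤ r c' → g c ≤ g c') → ∀ c, g c ≤ f c := by
    intro f g p hp hpfg hf hg c
    by_contra! hlt
    have h1 : (Finset.univ.filter fun d => k d = k c ∧ g d ≤ f c).card =
        (Finset.univ.filter fun d => k d = k c ∧ f d ≤ f c).card := by
      refine Finset.card_bij (fun d _ => p d) (fun d hd => ?_) (fun c _ c' _ h => p.injective h)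
        fun d hd => ⟨p.symm d, ?_, by simp⟩
      · simpa [hp, hpfg] using hd
      · have h2 := hp (p.symm d)
        have h3 := hpfg (p.symm d)
        rw [Equiv.apply_symm_apply] at h2 h3
        simpa [← h2, ← h3] using hd
    have h2 : (Finset.univ.filter fun d => k d = k c ∧ g d ≤ f c) ⊂
        Finset.univ.filter fun d => k d = k c ∧ f d ≤ f c := by
      refine Finset.ssubset_iff_subset_ne.2 ⟨fun d hd => ?_, fun h => ?_⟩
      · simp only [Finset.mem_filter, Finset.mem_univ, true_and] at hd ⊢
        refine ⟨hd.1, hf d c hd.1 ?_⟩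
        by_contra! hr
        exact absurd (hg c d hd.1.symm hr.le) (by omega)
      · have h3 : c ∈ Finset.univ.filter fun d => k d = k c ∧ f d ≤ f c := by simp
        rw [← h] at h3
        simp only [Finset.mem_filter, Finset.mem_univ, true_and] at h3
        omega
    exact absurd (Finset.card_lt_card h2) (by omega)
  refine le_antisymm (aux f (fun c => f (p c)) p hp (fun _ => rfl) hf hfp c)
    (aux (fun c => f (p c)) f p⁻¹ (fun c => ?_) (fun c => by simp) hfp hf c)
  simpa using (hp (p⁻¹ c)).symm

/-- A filling is semi-standard if its rows are nondecreasing and its columns are increasing. -/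
structure IsSemistandard (f : μ.cells → ℕ) : Prop where
  row_weak : ∀ c c', c.1.1 = c'.1.1 → c.1.2 ≤ c'.1.2 → f c ≤ f c'
  col_strict : ∀ c c', c.1.2 = c'.1.2 → c.1.1 < c'.1.1 → f c < f c'

/-- The sum of the entries of a filling, weighted by the numbers of their rows. -/
def rowWeight (f : μ.cells → ℕ) : ℕ := ∑ c, f c * c.1.1

lemma rowWeight_comp_rowPerm (f : μ.cells → ℕ) {p : Equiv.Perm μ.cells} (hp : p ∈ rowPerms μ) :
    rowWeight (f ∘ p) = rowWeight f :=
  Fintype.sum_equiv p _ _ fun c => by rw [mem_rowPerms.1 hp]; rfl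

/-- This is the rearrangement inequality in each column. Entries and row numbers both increase
strictly downwards, so the identity is the only column permutation which maximizes the row weight.
-/
lemma IsSemistandard.eq_one_of_rowWeight_le {f : μ.cells → ℕ} (hf : IsSemistandard f)
    {q : Equiv.Perm μ.cells} (hq : q ∈ colPerms μ) (h : rowWeight f ≤ rowWeight (f ∘ q)) :
    q = 1 := by
  classical
  obtain ⟨K, hK⟩ : ∃ K, ∀ c : μ.cells, f c < K ∧ c.1.1 < K := by
    obtain ⟨K, hK⟩ := Finite.bddAbove_range fun c : μ.cells => f c + c.1.1
    exact ⟨K + 1, fun c => by have := hK ⟨c, rfl⟩; simp only at this; omega⟩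
  -- Adding a multiple of the column number, with `K` above all entries and row numbers, orders the
  -- cells by column first. One rearrangement inequality on the whole diagram then treats all
  -- columns at once.
  let F : μ.cells → ℤ := fun c => f c + K * c.1.2
  let G : μ.cells → ℤ := fun c => c.1.1 + K * c.1.2
  have hcol := mem_colPerms.1 hq
  have hmono : Monovary F G := by
    intro c c' hlt
    simp only [F, G] at *
    have h1 := hK c
    have h2 := hK c'
    rcases lt_trichotomy c.1.2 c'.1.2 with h3 | h3 | h3
    · have : (c.1.2 : ℤ) + 1 ≤ c'.1.2 := by exact_mod_cast h3
      have h4 : (f c : ℤ) < K := by exact_mod_cast h1.1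
      have h5 : (0 : ℤ) ≤ f c' := by positivity
      nlinarith
    · rw [h3] at hlt ⊢
      have := (hf.col_strict c c' h3 (by omega)).le
      omega
    · exfalso
      have : (c'.1.2 : ℤ) + 1 ≤ c.1.2 := by exact_mod_cast h3
      have h4 : (c'.1.1 : ℤ) < K := by exact_mod_cast h2.2
      have h5 : (0 : ℤ) ≤ c.1.1 := by positivity
      nlinarith
  -- A column permutation changes the pairing of `F` and `G` only through the row weight; the other
  -- terms do not depend on it.
  have hsum : ∀ q : Equiv.Perm μ.cells, (∀ c, (q c).1.2 = c.1.2) → ∑ c, F (q c) * G c =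
      rowWeight (f ∘ q) + (∑ c : μ.cells, (K * c.1.2 * f c : ℤ) +
        ∑ c : μ.cells, (K * c.1.2 : ℤ) * (c.1.1 + K * c.1.2)) := by
    intro q hq
    rw [← Equiv.sum_comp q (fun c : μ.cells => (K * c.1.2 * f c : ℤ)), rowWeight]
    push_cast
    rw [← Finset.sum_add_distrib, ← Finset.sum_add_distrib]
    refine Finset.sum_congr rfl fun c _ => ?_
    simp only [F, G, hq, Function.comp]
    ring
  have hle := hmono.sum_comp_perm_mul_le_sum_mul (σ := q)
  have heq : ∑ c, F (q c) * G c = ∑ c, F c * G c := by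
    refine le_antisymm hle ?_
    have h1 := hsum 1 fun _ => rfl
    simp only [Equiv.Perm.one_apply] at h1
    rw [h1, hsum q hcol]
    have : (rowWeight (f ∘ (1 : Equiv.Perm μ.cells)) : ℤ) ≤ rowWeight (f ∘ q) := by
      exact_mod_cast h
    linarith
  -- The equality case says that `f ∘ q` still increases down the columns, hence equals `f`;
  -- strictness of the columns then gives `q = 1`.
  have hmono' := hmono.sum_comp_perm_mul_eq_sum_mul_iff.1 heq
  have hf' : ∀ c c' : μ.cells, c.1.2 = c'.1.2 → c.1.1 ≤ c'.1.1 → f c ≤ f c' := by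
    intro c c' h1 h2
    rcases h2.lt_or_eq with h2 | h2
    · exact (hf.col_strict c c' h1 h2).le
    · rw [Subtype.ext (Prod.ext h2 h1)]
  have key := comp_perm_eq_of_monotone (fun c : μ.cells => c.1.2) (fun c => c.1.1) f q hcol hf' (by
    intro c c' h1 h2
    rcases h2.lt_or_eq with h2 | h2
    · have h3 : G c < G c' := by simp only [G, h1]; omega
      have h4 := hmono' h3
      simp only [F, Function.comp, hcol, h1] at h4
      omega
    · rw [Subtype.ext (Prod.ext h2 h1)])
  ext1 c
  have h1 := key c
  rcases lt_trichotomy (q c).1.1 c.1.1 with h2 | h2 | h2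
  · exact absurd h1 (hf.col_strict _ _ (hcol c) h2).ne
  · exact Subtype.ext (Prod.ext h2 (hcol c))
  · exact absurd h1 (hf.col_strict _ _ (hcol c).symm h2).ne'

/-- The triangularity of the action of row and column permutations on semi-standard fillings. -/
lemma IsSemistandard.eq_of_comp_eq {f g : μ.cells → ℕ} (hf : IsSemistandard f)
    (hg : IsSemistandard g) {p q : Equiv.Perm μ.cells} (hp : p ∈ rowPerms μ) (hq : q ∈ colPerms μ)
    (h : f ∘ q = g ∘ p) (hle : rowWeight f ≤ rowWeight g) : q = 1 ∧ f = g := by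
  -- Row permutations do not change the row weight, so `f ∘ q` has the weight of `g`, which is at
  -- least that of `f`.
  have hq1 := hf.eq_one_of_rowWeight_le hq (by rwa [h, rowWeight_comp_rowPerm g hp])
  subst hq1
  have h' : ∀ c, g (p c) = f c := fun c => (congrFun h c).symm
  refine ⟨rfl, funext fun c => ?_⟩
  rw [← h']
  refine comp_perm_eq_of_monotone (fun c : μ.cells => c.1.1) (fun c => c.1.2) g p
    (mem_rowPerms.1 hp) hg.row_weak (fun c c' h1 h2 => ?_) c
  rw [h', h']
  exact hf.row_weak c c' h1 h2

end Semistandard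

end GreenGriffiths

end

noncomputable section

namespace GreenGriffiths

/-! ### The multiplicity space decomposition -/

section Content

/-- The multiset of the values of a function on a finite type. -/
def content {A Z : Type} [Fintype A] (f : A → Z) : Z →₀ ℕ := ∑ a, Finsupp.single (f a) 1

open Classical in
lemma content_apply {A Z : Type} [Fintype A] (f : A → Z) (z : Z) :
    content f z = Fintype.card {a // f a = z} := by
  rw [content, Finsupp.finsetSum_apply, Fintype.card_subtype, Finset.card_filter]
  exact Finset.sum_congr rfl fun a _ => Finsupp.single_apply

lemma content_comp_equiv {A A₀ Z : Type} [Fintype A] [Fintype A₀] (σ : A ≃ A₀) (f : A₀ → Z) :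
    content (f ∘ σ) = content f :=
  Fintype.sum_equiv σ _ _ fun _ => rfl

open Classical in
-- The bijections carrying `f₀` to `f` either do not exist or form a torsor under the stabilizer of
-- `f₀`.
lemma card_equiv_comp_eq {A A₀ Z : Type} [Fintype A] [Fintype A₀] (f : A → Z) (f₀ : A₀ → Z) :
    (Finset.univ.filter fun σ : A ≃ A₀ => f₀ ∘ σ = f).card =
      if content f = content f₀ then
        (Finset.univ.filter fun τ : Equiv.Perm A₀ => f₀ ∘ τ = f₀).card else 0 := by
  split_ifs with h
  · have hσ : ∀ z, Nonempty ({a // f a = z} ≃ {a // f₀ a = z}) := fun z => by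
      rw [← Fintype.card_eq, ← content_apply, ← content_apply, h]
    let σ₀ : A ≃ A₀ := Equiv.ofFiberEquiv fun z => (hσ z).some
    have hσ₀ : f₀ ∘ σ₀ = f := funext fun a => Equiv.ofFiberEquiv_map _ a
    refine Finset.card_bij' (fun σ _ => σ₀.symm.trans σ) (fun τ _ => σ₀.trans τ) ?_ ?_ ?_ ?_
    · intro σ hσ
      have := (Finset.mem_filter.1 hσ).2
      refine Finset.mem_filter.2 ⟨Finset.mem_univ _, ?_⟩
      rw [Equiv.coe_trans, ← Function.comp_assoc, this, ← hσ₀, Function.comp_assoc,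
        Equiv.self_comp_symm, Function.comp_id]
    · intro τ hτ
      have := (Finset.mem_filter.1 hτ).2
      refine Finset.mem_filter.2 ⟨Finset.mem_univ _, ?_⟩
      rw [Equiv.coe_trans, ← Function.comp_assoc, this, hσ₀]
    · intro σ _; ext; simp
    · intro τ _; ext; simp
  · rw [Finset.card_eq_zero, Finset.filter_eq_empty_iff]
    rintro σ - rfl
    exact h (content_comp_equiv σ f₀)

open Classical in
-- Group the bijections by the filling `I₀ ∘ σ`: the number giving a prescribed filling is 0 or the
-- order of a fixed stabilizer. This turns the coefficient of a monomial into a sum over bijections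
-- of cells.
lemma sum_equiv_comp {A A₀ K ι : Type} [Fintype A] [Fintype A₀] [Fintype ι] (T : A → K)
    (T₀ : A₀ → K) (I₀ : A₀ → ι) (s : (A → ι) → ℂ) :
    ∑ σ ∈ Finset.univ.filter (fun σ : A ≃ A₀ => T₀ ∘ σ = T), s (I₀ ∘ σ) =
      (Finset.univ.filter fun τ : Equiv.Perm A₀ =>
        (fun c => (T₀ c, I₀ c)) ∘ τ = fun c => (T₀ c, I₀ c)).card *
      ∑ I : A → ι with content (fun c => (T c, I c)) = content (fun c => (T₀ c, I₀ c)), s I := by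
  rw [← Finset.sum_fiberwise (g := fun σ : A ≃ A₀ => I₀ ∘ σ), Finset.sum_filter, Finset.mul_sum]
  refine Finset.sum_congr rfl fun I _ => ?_
  have h1 : (Finset.univ.filter fun σ : A ≃ A₀ => T₀ ∘ σ = T).filter (fun σ : A ≃ A₀ => I₀ ∘ σ = I) =
      Finset.univ.filter fun σ : A ≃ A₀ => (fun c => (T₀ c, I₀ c)) ∘ σ = fun c => (T c, I c) := by
    ext σ
    simp only [Finset.mem_filter, Finset.mem_univ, true_and, funext_iff, Function.comp,
      Prod.mk.injEq, forall_and]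
  have h2 : ∀ σ ∈ Finset.univ.filter (fun σ : A ≃ A₀ =>
      (fun c => (T₀ c, I₀ c)) ∘ σ = fun c => (T c, I c)), s (I₀ ∘ σ) = s I := fun σ hσ =>
    congrArg s (funext fun c => congrArg Prod.snd (congrFun (Finset.mem_filter.1 hσ).2 c))
  rw [h1, Finset.sum_congr rfl h2, Finset.sum_const, nsmul_eq_mul]
  have h3 := congrArg (fun k : ℕ => (k : ℂ) * s I)
    (card_equiv_comp_eq (fun c => (T c, I c)) fun c => (T₀ c, I₀ c))
  simp only [Nat.cast_ite, Nat.cast_zero, ite_mul, zero_mul] at h3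
  rw [mul_ite, mul_zero]
  convert h3 <;> rfl

end Content

/-! ### Tableaux as fillings, and finiteness -/

section Filling

variable {n κ m : ℕ} {ℓ : Shape n}

/-- The filling of the cells by the entries of a tableau, the entry `l + 1` being represented by
`l : Fin κ`. -/
def BoundedTableau.fill (T : BoundedTableau ℓ κ) (c : ℓ.diagram.cells) : Fin κ :=
  ⟨T.1 c.1.1 c.1.2 - 1, by have := T.2 c.1 c.2; omega⟩

lemma BoundedTableau.fill_add_one (T : BoundedTableau ℓ κ) (c : ℓ.diagram.cells) :
    (T.fill c : ℕ) + 1 = T.1 c.1.1 c.1.2 := Nat.sub_add_cancel (T.2 c.1 c.2).1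

lemma BoundedTableau.fill_injective :
    Function.Injective (BoundedTableau.fill : BoundedTableau ℓ κ → _) := by
  intro T T' h
  refine Subtype.ext (SemistandardYoungTableau.ext fun i j => ?_)
  by_cases hc : (i, j) ∈ ℓ.diagram
  · have hc' := (YoungDiagram.mem_cells _).2 hc
    rw [← T.fill_add_one ⟨_, hc'⟩, ← T'.fill_add_one ⟨_, hc'⟩, h]
  · rw [T.1.zeros hc, T'.1.zeros hc]

lemma BoundedTableau.isSemistandard (T : BoundedTableau ℓ κ) :
    IsSemistandard fun c => (T.fill c : ℕ) where
  row_weak := by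
    rintro ⟨⟨i, j⟩, hc⟩ ⟨⟨i', j'⟩, hc'⟩ (rfl : i = i') hj
    rcases hj.lt_or_eq with hj | (rfl : j = j')
    · have : T.1 i j ≤ T.1 i j' := T.1.row_weak hj ((YoungDiagram.mem_cells _).1 hc')
      have h1 := T.fill_add_one ⟨_, hc⟩
      have h2 := T.fill_add_one ⟨_, hc'⟩
      simp only at h1 h2 ⊢
      omega
    · exact le_rfl
  col_strict := by
    rintro ⟨⟨i, j⟩, hc⟩ ⟨⟨i', j'⟩, hc'⟩ (rfl : j = j') hi
    have : T.1 i j < T.1 i' j := T.1.col_strict hi ((YoungDiagram.mem_cells _).1 hc')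
    have h1 := T.fill_add_one ⟨_, hc⟩
    have h2 := T.fill_add_one ⟨_, hc'⟩
    simp only at h1 h2 ⊢
    omega

instance : Finite (BoundedTableau ℓ κ) := Finite.of_injective _ BoundedTableau.fill_injective

/-- A tableau with entries in `{1, …, κ}` of sum `m`, without the condition on the sum. -/
def WeightedTableau.toBounded (T : WeightedTableau ℓ κ m) : BoundedTableau ℓ κ := ⟨T.1, T.2.1⟩

lemma WeightedTableau.toBounded_injective :
    Function.Injective (WeightedTableau.toBounded : WeightedTableau ℓ κ m → _) :=
  fun _ _ h => Subtype.ext (congrArg (fun T => T.1) h)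

instance : Finite (WeightedTableau ℓ κ m) :=
  Finite.of_injective _ WeightedTableau.toBounded_injective

/-- Entries are at least 1, so a diagram of weight `m` has at most `m` cells. Hence only finitely
many shapes carry a tableau of weight `m`. -/
lemma WeightedTableau.shape_le (T : WeightedTableau ℓ κ m) (k : Fin n) : ℓ.1 k ≤ m := by
  have h1 : ∑ c ∈ ℓ.diagram.cells, 1 ≤ m := by
    rw [← T.2.2]
    exact Finset.sum_le_sum fun c hc => (T.2.1 c hc).1
  rw [ℓ.sum_diagram fun _ _ => 1] at h1
  have h2 := Finset.single_le_sum (f := fun k : Fin n => ∑ _c ∈ Finset.range (ℓ.1 k), 1)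
    (fun _ _ => Nat.zero_le _) (Finset.mem_univ k)
  simp only [Finset.sum_const, Finset.card_range, smul_eq_mul, mul_one] at h1 h2
  omega

instance : Finite (Σ ℓ : Shape n, WeightedTableau ℓ κ m) := by
  have : Finite {ℓ : Shape n // ∀ k, ℓ.1 k ≤ m} :=
    Finite.of_injective (fun ℓ (k : Fin n) => (⟨ℓ.1.1 k, Nat.lt_succ_of_le (ℓ.2 k)⟩ : Fin (m + 1)))
      fun ℓ ℓ' h => Subtype.ext (Subtype.ext (funext fun k =>
        congrArg Fin.val (congrFun h k)))
  refine Finite.of_injective (fun x : Σ ℓ : Shape n, WeightedTableau ℓ κ m =>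
    (⟨⟨x.1, x.2.shape_le⟩, x.2⟩ : Σ ℓ : {ℓ : Shape n // ∀ k, ℓ.1 k ≤ m},
      WeightedTableau ℓ.1 κ m)) ?_
  rintro ⟨ℓ, T⟩ ⟨ℓ', T'⟩ h
  obtain ⟨h1, h2⟩ := Sigma.mk.inj h
  obtain rfl : ℓ = ℓ' := congrArg Subtype.val h1
  obtain rfl : T = T' := eq_of_heq h2
  rfl

instance : Fintype (Σ ℓ : Shape n, WeightedTableau ℓ κ m) := Fintype.ofFinite _

lemma Shape.rowCount_diagram (ℓ : Shape n) (i : ℕ) :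
    rowCount ℓ.diagram i = ∑ k : Fin n, if k.1 < i then ℓ.1 k else 0 := by
  have h := ℓ.sum_diagram fun k _ => if k < i then 1 else 0
  have h1 : rowCount ℓ.diagram i = ∑ c ∈ ℓ.diagram.cells, if c.1 < i then 1 else 0 := by
    rw [rowCount, Finset.card_filter]
    exact Finset.sum_coe_sort ℓ.diagram.cells fun c => if c.1 < i then 1 else 0
  rw [h1, h]
  refine Finset.sum_congr rfl fun k _ => ?_
  split_ifs <;> simp

lemma Shape.eq_of_rowCount_eq {ℓ ℓ' : Shape n}
    (h : ∀ i ≤ n, rowCount ℓ.diagram i = rowCount ℓ'.diagram i) : ℓ = ℓ' := by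
  have key : ∀ (ℓ : Shape n) (k : Fin n),
      rowCount ℓ.diagram (k + 1) = rowCount ℓ.diagram k + ℓ.1 k := by
    intro ℓ k
    rw [ℓ.rowCount_diagram, ℓ.rowCount_diagram]
    have h1 : ℓ.1 k = ∑ j : Fin n, if j = k then ℓ.1 j else 0 := by simp
    rw [h1, ← Finset.sum_add_distrib]
    refine Finset.sum_congr rfl fun j _ => ?_
    by_cases hjk : j = k
    · simp [hjk]
    · have : (j : ℕ) ≠ k := fun h => hjk (Fin.ext h)
      rw [if_neg hjk, add_zero]
      exact if_congr (by omega) rfl rfl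
  refine Subtype.ext (funext fun k => ?_)
  have h1 := key ℓ k
  have h2 := key ℓ' k
  have h3 := h k k.2.le
  have h4 := h (k + 1) k.2
  omega

end Filling

/-! ### Injectivity of the map from tensors to polynomials -/

section Injectivity

variable {n κ m : ℕ} {ι : Type}

/-- If `σ` sends two cells in the same column of `μ` to the same row of `ν`, then the row
symmetrization over `ν` of a tensor which is alternating along the columns of `μ` vanishes. -/
lemma sum_rowPerms_eq_zero {μ ν : YoungDiagram} {s : (μ.cells → ι) → ℂ} (hs : s ∈ schurCoord μ ι)
    (σ : μ.cells ≃ ν.cells) {c c' : μ.cells} (hne : c ≠ c') (hcol : c.1.2 = c'.1.2)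
    (hrow : (σ c).1.1 = (σ c').1.1) (I : ν.cells → ι) :
    ∑ p ∈ rowPerms ν, s (I ∘ p ∘ σ) = 0 := by
  classical
  have hρ : Equiv.swap (σ c) (σ c') ∈ rowPerms ν := mem_rowPerms.2 fun d => by
    rcases eq_or_ne d (σ c) with rfl | h1
    · rw [Equiv.swap_apply_left, hrow]
    rcases eq_or_ne d (σ c') with rfl | h2
    · rw [Equiv.swap_apply_right, hrow]
    rw [Equiv.swap_apply_of_ne_of_ne h1 h2]
  have hτ : Equiv.swap c c' ∈ colPerms μ := mem_colPerms.2 fun d => by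
    rcases eq_or_ne d c with rfl | h1
    · rw [Equiv.swap_apply_left, hcol]
    rcases eq_or_ne d c' with rfl | h2
    · rw [Equiv.swap_apply_right, hcol]
    rw [Equiv.swap_apply_of_ne_of_ne h1 h2]
  -- Exchanging `σ c` and `σ c'` permutes the terms of the sum, but each term changes sign because
  -- `s` alternates in `c` and `c'`.
  have h1 := sum_rowPerms_mul_right _ hρ fun p => s (I ∘ p ∘ σ)
  have h2 : ∀ p : Equiv.Perm ν.cells, s (I ∘ (p * Equiv.swap (σ c) (σ c') : Equiv.Perm _) ∘ σ) =
      - s (I ∘ p ∘ σ) := by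
    intro p
    have h3 : I ∘ (p * Equiv.swap (σ c) (σ c') : Equiv.Perm _) ∘ σ =
        (I ∘ p ∘ σ) ∘ Equiv.swap c c' := by
      ext d
      simp [Equiv.swap_apply_def, Function.comp]
      congr 2
      split_ifs <;> rfl
    rw [h3, schurCoord_comp_colPerm hs hτ, Equiv.Perm.sign_swap hne]
    simp
  simp only [h2, Finset.sum_neg_distrib] at h1
  exact self_eq_neg.1 h1.symm

/-- The sum of the dominance partial sums of a shape. -/
def Shape.dominance (ℓ : Shape n) : ℕ := ∑ i ∈ Finset.range (n + 1), rowCount ℓ.diagram i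

open Classical in
/-- Tensors in the Schur powers, attached to distinct semi-standard tableaux, are zero if the sum of
the polynomials which they define vanishes. -/
theorem eq_zero_of_sum_content_eq_zero [Fintype ι]
    (s : ∀ i : Σ ℓ : Shape n, WeightedTableau ℓ κ m, (i.1.diagram.cells → ι) → ℂ)
    (hs : ∀ i, s i ∈ schurCoord i.1.diagram ι)
    (h : ∀ e : Fin κ × ι →₀ ℕ, ∑ i, ∑ I : i.1.diagram.cells → ι with
      content (fun c => (i.2.toBounded.fill c, I c)) = e, s i I = 0) (i) : s i = 0 := by
  by_contra hi
  -- The order for the triangularity: dominance of the shape first, then the row weight of the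
  -- filling. A nonzero tensor maximal for it is isolated below.
  let w : (Σ ℓ : Shape n, WeightedTableau ℓ κ m) → ℕ ×ₗ ℕ := fun i =>
    toLex (i.1.dominance, rowWeight fun c => (i.2.toBounded.fill c : ℕ))
  obtain ⟨⟨ℓ₀, T₀⟩, h₀, hmax⟩ := Finset.exists_max_image (Finset.univ.filter fun i => s i ≠ 0) w
    ⟨i, by simpa using hi⟩
  have h₀ : s ⟨ℓ₀, T₀⟩ ≠ 0 := (Finset.mem_filter.1 h₀).2
  have hmax : ∀ i, s i ≠ 0 → w i ≤ w ⟨ℓ₀, T₀⟩ := fun i hi => hmax i (by simpa using hi)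
  refine h₀ (eq_zero_of_rowSymm_eq_zero (hs _) (funext fun I₀ => ?_))
  set f₀ := T₀.toBounded.fill with hf₀
  -- the contribution of each summand
  have hterm : ∀ (i : Σ ℓ : Shape n, WeightedTableau ℓ κ m)
      (σ : i.1.diagram.cells ≃ ℓ₀.diagram.cells), f₀ ∘ σ = i.2.toBounded.fill →
      i ≠ ⟨ℓ₀, T₀⟩ → ∑ p ∈ rowPerms ℓ₀.diagram, s i (I₀ ∘ p ∘ σ) = 0 := by
    rintro ⟨ℓ, T⟩ σ hσ hne
    by_cases hs0 : s ⟨ℓ, T⟩ = 0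
    · simp [hs0]
    -- If `σ` separates the cells of each column into different rows, then `ℓ` dominates `ℓ₀`.
    -- Maximality makes the shapes equal, and the factorization of `σ` then makes the tableaux
    -- equal, contrary to `hne`.
    by_cases hgood : ∀ c c', c.1.2 = c'.1.2 → (σ c).1.1 = (σ c').1.1 → c = c'
    · exfalso
      have hle := hmax _ hs0
      have hdom := rowCount_le_rowCount σ hgood
      have hD : ℓ.dominance ≤ ℓ₀.dominance := (Prod.Lex.toLex_le_toLex.1 hle).elim le_of_lt
        fun h => h.1.le
      have hD' := Finset.sum_le_sum fun i (_ : i ∈ Finset.range (n + 1)) => hdom i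
      have heq := (Finset.sum_eq_sum_iff_of_le
        fun i (_ : i ∈ Finset.range (n + 1)) => hdom i).1 (le_antisymm hD' hD)
      obtain rfl : ℓ₀ = ℓ := Shape.eq_of_rowCount_eq fun i hi =>
        heq i (Finset.mem_range.2 (by omega))
      obtain ⟨p, hp, q, hq, rfl⟩ := exists_eq_row_mul_col σ hgood
      have hW : rowWeight (fun c => (T.toBounded.fill c : ℕ)) ≤
          rowWeight fun c => (f₀ c : ℕ) :=
        (Prod.Lex.toLex_le_toLex.1 hle).elim (fun h => absurd h (lt_irrefl _)) fun h => h.2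
      have hcomp : (fun c => (T.toBounded.fill c : ℕ)) ∘ (q⁻¹ : Equiv.Perm _) =
          (fun c => (f₀ c : ℕ)) ∘ p := by
        ext c
        simp [← hσ]
      have := (T.toBounded.isSemistandard.eq_of_comp_eq T₀.toBounded.isSemistandard hp
        (inv_mem_colPerms hq) hcomp hW).2
      refine hne (congrArg _ (WeightedTableau.toBounded_injective
        (BoundedTableau.fill_injective (funext fun c => Fin.ext (congrFun this c)))))
    · push Not at hgood
      obtain ⟨c, c', hcol, hrow, hcc⟩ := hgood
      exact sum_rowPerms_eq_zero (hs _) σ hcc hcol hrow I₀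
  -- For the chosen tableau, triangularity removes the column factor, so a surviving `σ` is a row
  -- permutation and is absorbed in the row symmetrization.
  have hterm₀ : ∀ σ : Equiv.Perm ℓ₀.diagram.cells, f₀ ∘ σ = f₀ →
      ∑ p ∈ rowPerms ℓ₀.diagram, s ⟨ℓ₀, T₀⟩ (I₀ ∘ p ∘ σ) =
        if ∀ c c', c.1.2 = c'.1.2 → (σ c).1.1 = (σ c').1.1 → c = c' then
          rowSymm ℓ₀.diagram ι (s ⟨ℓ₀, T₀⟩) I₀ else 0 := by
    intro σ hσ
    split_ifs with hgood
    · obtain ⟨p, hp, q, hq, rfl⟩ := exists_eq_row_mul_col σ hgood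
      have hcomp : (fun c => (f₀ c : ℕ)) ∘ (q⁻¹ : Equiv.Perm _) = (fun c => (f₀ c : ℕ)) ∘ p := by
        ext c
        conv_lhs => rw [← hσ]
        simp
      obtain ⟨hq1, -⟩ := T₀.toBounded.isSemistandard.eq_of_comp_eq T₀.toBounded.isSemistandard hp
        (inv_mem_colPerms hq) hcomp le_rfl
      obtain rfl : q = 1 := inv_eq_one.1 hq1
      rw [rowSymm_apply, ← sum_rowPerms_mul_right p hp fun p => s ⟨ℓ₀, T₀⟩ (I₀ ∘ p), mul_one]
      rfl
    · push Not at hgood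
      obtain ⟨c, c', hcol, hrow, hcc⟩ := hgood
      exact sum_rowPerms_eq_zero (hs ⟨ℓ₀, T₀⟩) σ hcc hcol hrow I₀
  -- the sum of all contributions vanishes
  have hzero : ∀ I' : ℓ₀.diagram.cells → ι,
      ∑ i, ∑ σ ∈ Finset.univ.filter (fun σ : i.1.diagram.cells ≃ ℓ₀.diagram.cells =>
        f₀ ∘ σ = i.2.toBounded.fill), s i (I' ∘ σ) = 0 := by
    intro I'
    have h1 : ∀ i : Σ ℓ : Shape n, WeightedTableau ℓ κ m,
        ∑ σ ∈ Finset.univ.filter (fun σ : i.1.diagram.cells ≃ ℓ₀.diagram.cells =>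
          f₀ ∘ σ = i.2.toBounded.fill), s i (I' ∘ σ) =
        (Finset.univ.filter fun τ : Equiv.Perm ℓ₀.diagram.cells =>
          (fun c => (f₀ c, I' c)) ∘ τ = fun c => (f₀ c, I' c)).card *
        ∑ I : i.1.diagram.cells → ι with content (fun c => (i.2.toBounded.fill c, I c)) =
          content (fun c => (f₀ c, I' c)), s i I := fun i => by
      convert sum_equiv_comp i.2.toBounded.fill f₀ I' (s i)
    rw [Finset.sum_congr rfl fun i _ => h1 i, ← Finset.mul_sum, h, mul_zero]
  have hsum : ∑ i, ∑ σ ∈ Finset.univ.filter (fun σ : i.1.diagram.cells ≃ ℓ₀.diagram.cells =>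
      f₀ ∘ σ = i.2.toBounded.fill), ∑ p ∈ rowPerms ℓ₀.diagram, s i (I₀ ∘ p ∘ σ) = 0 := by
    refine Eq.trans ?_ (Finset.sum_eq_zero fun p (_ : p ∈ rowPerms ℓ₀.diagram) => hzero (I₀ ∘ p))
    rw [Finset.sum_comm]
    refine Finset.sum_congr rfl fun i _ => ?_
    rw [Finset.sum_comm]
    rfl
  rw [Finset.sum_eq_single ⟨ℓ₀, T₀⟩ (fun i _ hi => Finset.sum_eq_zero fun σ hσ =>
    hterm i σ (Finset.mem_filter.1 hσ).2 hi) (by simp),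
    Finset.sum_congr rfl fun σ hσ => hterm₀ σ (Finset.mem_filter.1 hσ).2, Finset.sum_ite,
    Finset.sum_const_zero, add_zero, Finset.sum_const, nsmul_eq_mul] at hsum
  -- The remaining factor counts the surviving bijections, among which is the identity.
  refine (mul_eq_zero.1 hsum).resolve_left (Nat.cast_ne_zero.2 (Finset.card_ne_zero_of_mem
    (a := Equiv.refl _) ?_))
  simp only [Finset.mem_filter, Finset.mem_univ, true_and]
  exact ⟨rfl, fun c c' h1 h2 => Subtype.ext (Prod.ext h2 h1)⟩

end Injectivity

/-! ### Lower bound for the dimension of a Schur power -/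

section Independence

variable {n : ℕ}

/-- The dimension of a Schur power of an `n`-dimensional space is at least the number of the
semi-standard tableaux with entries in `{1, …, n}`. -/
theorem card_boundedTableau_le (ℓ : Shape n) :
    Nat.card (BoundedTableau ℓ n) ≤ Module.finrank ℂ (schurCoord ℓ.diagram (Fin n)) := by
  classical
  have := Fintype.ofFinite (BoundedTableau ℓ n)
  let v : BoundedTableau ℓ n → schurCoord ℓ.diagram (Fin n) := fun S =>
    ⟨_, LinearMap.mem_range_self (colAlt ℓ.diagram (Fin n) ∘ₗ rowSymm ℓ.diagram (Fin n))
      (Pi.single S.fill 1)⟩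
  rw [Nat.card_eq_fintype_card]
  refine LinearIndependent.fintype_card_le_finrank (b := v) ?_
  rw [Fintype.linearIndependent_iff]
  intro g hg S
  by_contra hS
  -- The relation is evaluated at the filling of a tableau of minimal row weight among those with
  -- nonzero coefficient. By triangularity only that tableau with `q = 1` contributes, and it
  -- contributes the positive number of row permutations fixing its filling.
  obtain ⟨S₀, h₀, hmin⟩ := Finset.exists_min_image (Finset.univ.filter fun S => g S ≠ 0)
    (fun S => rowWeight fun c => (S.fill c : ℕ)) ⟨S, by simpa using hS⟩
  have h₀ : g S₀ ≠ 0 := (Finset.mem_filter.1 h₀).2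
  have hg' : ∑ S, g S * ∑ q ∈ colPerms ℓ.diagram, ((Equiv.Perm.sign q : ℤ) : ℂ) *
      ∑ p ∈ rowPerms ℓ.diagram, (if (S₀.fill ∘ q) ∘ p = S.fill then 1 else 0) = 0 := by
    have := congrFun (congrArg Subtype.val hg) S₀.fill
    simpa [v, colAlt_apply, rowSymm_apply, Pi.single_apply] using this
  have key : ∀ S, g S ≠ 0 → ∀ q ∈ colPerms ℓ.diagram, ∀ p ∈ rowPerms ℓ.diagram,
      (S₀.fill ∘ q) ∘ p = S.fill → q = 1 ∧ S = S₀ := by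
    intro S hS q hq p hp h
    have hle := hmin S (by simpa using hS)
    have hcomp : (fun c => (S₀.fill c : ℕ)) ∘ q =
        (fun c => (S.fill c : ℕ)) ∘ (p⁻¹ : Equiv.Perm _) := by
      ext c
      simp [← h]
    obtain ⟨h1, h2⟩ := S₀.isSemistandard.eq_of_comp_eq S.isSemistandard (inv_mem_rowPerms hp) hq
      hcomp hle
    exact ⟨h1, (BoundedTableau.fill_injective (funext fun c => Fin.ext (congrFun h2 c))).symm⟩
  rw [Finset.sum_eq_single S₀, Finset.sum_eq_single 1] at hg'
  · refine h₀ ((mul_eq_zero.1 hg').resolve_right ?_)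
    rw [Finset.sum_boole]
    simp only [Equiv.Perm.sign_one, Units.val_one, Int.cast_one, one_mul]
    exact Nat.cast_ne_zero.2 (Finset.card_ne_zero_of_mem (a := 1)
      (Finset.mem_filter.2 ⟨one_mem_rowPerms, rfl⟩))
  · intro q hq hq1
    rw [Finset.sum_eq_zero fun p hp => if_neg fun h => hq1 (key S₀ h₀ q hq p hp h).1, mul_zero]
  · exact fun h => absurd one_mem_colPerms h
  · intro S _ hS
    by_cases hgS : g S = 0
    · rw [hgS, zero_mul]
    rw [Finset.sum_eq_zero fun q hq => by
      rw [Finset.sum_eq_zero fun p hp => if_neg fun h => hS (key S hgS q hq p hp h).2, mul_zero],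
      mul_zero]
  · simp

end Independence

end GreenGriffiths

end

noncomputable section

namespace GreenGriffiths

/-! ### Bundles trivialized over the charts -/

section HolFun

variable {n : ℕ} {X : Type} [TopologicalSpace X] [ChartedSpace (Fin n → ℂ) X]

lemma isHolFun_iff {U : Opens X} (F : X → ℂ) :
    IsHolFun n (fun x : U => F x) ↔ ∀ x ∈ U, ContMDiffAt 𝓘(ℂ, Fin n → ℂ) 𝓘(ℂ) ω F x :=
  ⟨fun h x hx => contMDiffAt_subtype_iff.1 (h ⟨x, hx⟩),
    fun h x => contMDiffAt_subtype_iff.2 (h x.1 x.2)⟩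

lemma IsHolFun.of_local {U : Opens X} {f : U → ℂ}
    (h : ∀ x : U, ∃ (V : Opens X) (hVU : V ≤ U) (_ : x.1 ∈ V),
      IsHolFun n (fun y : V => f ⟨y.1, hVU y.2⟩)) : IsHolFun n f := by
  classical
  -- Extension by 0 is harmless: holomorphy is tested only at points of the open set `U`.
  let F : X → ℂ := fun x => if hx : x ∈ U then f ⟨x, hx⟩ else 0
  have hF : f = fun x : U => F x := funext fun x => by simp [F]
  rw [hF, isHolFun_iff]
  intro x hx
  obtain ⟨V, hVU, hxV, h⟩ := h ⟨x, hx⟩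
  have h2 : (fun y : V => f ⟨y.1, hVU y.2⟩) = fun y : V => F y := funext fun y => by
    simp [F, hVU y.2]
  rw [h2, isHolFun_iff] at h
  exact h x hxV

lemma IsHolFun.const {U : Opens X} (c : ℂ) : IsHolFun n (fun _ : U => c) := contMDiff_const

lemma IsHolFun.add {U : Opens X} {f g : U → ℂ} (hf : IsHolFun n f) (hg : IsHolFun n g) :
    IsHolFun n (fun x => f x + g x) := ContMDiff.add hf hg

lemma IsHolFun.mul {U : Opens X} {f g : U → ℂ} (hf : IsHolFun n f) (hg : IsHolFun n g) :
    IsHolFun n (fun x => f x * g x) := ContMDiff.mul hf hg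

lemma IsHolFun.sum {U : Opens X} {ι : Type*} (s : Finset ι) {f : ι → U → ℂ}
    (hf : ∀ i ∈ s, IsHolFun n (f i)) : IsHolFun n (fun x => ∑ i ∈ s, f i x) := by
  classical
  induction s using Finset.induction_on with
  | empty => simpa using IsHolFun.const 0
  | insert i s his ih =>
    simp only [Finset.sum_insert his]
    exact (hf i (Finset.mem_insert_self i s)).add
      (ih fun j hj => hf j (Finset.mem_insert_of_mem hj))

end HolFun

/-! ### Trivializations over charts and constructions with them -/

namespace HolPrebundle

variable {n : ℕ} {X : Type} [TopologicalSpace X] [ChartedSpace (Fin n → ℂ) X]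

lemma IsHol.res {E : HolPrebundle n X} {U V : Opens X} {s : ∀ x : U, E.Fib x} (hs : E.IsHol s)
    (h : V ≤ U) : E.IsHol (fun x : V => s ⟨x.1, h x.2⟩) :=
  E.hol.res (homOfLE h) s hs

lemma IsHol.of_local {E : HolPrebundle n X} {U : Opens X} {s : ∀ x : U, E.Fib x}
    (h : ∀ x : U, ∃ (V : Opens X) (hVU : V ≤ U) (_ : x.1 ∈ V),
      E.IsHol (fun y : V => s ⟨y.1, hVU y.2⟩)) : E.IsHol s :=
  E.hol.locality s fun x => by
    obtain ⟨V, hVU, hxV, h⟩ := h x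
    exact ⟨V, hxV, homOfLE hVU, h⟩

/-- The source of a chart as an open set. -/
def chartDomain (e : OpenPartialHomeomorph X (Fin n → ℂ)) : Opens X := ⟨e.source, e.open_source⟩

/-- Trivializations over the domains of the charts of the atlas, with fibre `W`, for which the
holomorphic sections are those with holomorphic components. -/
structure Triv (E : HolPrebundle n X) (W : Type) [AddCommGroup W] [Module ℂ W] where
  /-- the identification of the fibres in a chart -/
  equiv : ∀ e ∈ atlas (Fin n → ℂ) X, ∀ x ∈ e.source, W ≃ₗ[ℂ] E.Fib x
  isHol_iff : ∀ (e) (he : e ∈ atlas (Fin n → ℂ) X) (V : Opens X)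
    (hV : ∀ x ∈ V, x ∈ e.source) (s : ∀ x : V, E.Fib x), E.IsHol s ↔
      ∀ φ : W →ₗ[ℂ] ℂ, IsHolFun n fun x : V => φ ((equiv e he x.1 (hV x.1 x.2)).symm (s x))

namespace Triv

variable {E F : HolPrebundle n X} {W W' : Type} [AddCommGroup W] [Module ℂ W] [AddCommGroup W']
  [Module ℂ W']

lemma isVectorBundle (τ : Triv E W) [FiniteDimensional ℂ W] : E.IsVectorBundle := by
  intro x₀
  refine ⟨chartDomain (chartAt (Fin n → ℂ) x₀), mem_chart_source _ x₀, Module.finrank ℂ W,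
    fun x => (Module.finBasis ℂ W).map (τ.equiv _ (chart_mem_atlas _ x₀) x.1 x.2),
    fun V hVU s => ?_⟩
  rw [τ.isHol_iff _ (chart_mem_atlas _ x₀) V (fun x hx => hVU hx) s]
  refine ⟨fun h i => h ((Module.finBasis ℂ W).coord i), fun h φ => ?_⟩
  have : (fun x : V => φ ((τ.equiv _ (chart_mem_atlas _ x₀) x.1 (hVU x.2)).symm (s x))) =
      fun x : V => ∑ i, (Module.finBasis ℂ W).repr
        ((τ.equiv _ (chart_mem_atlas _ x₀) x.1 (hVU x.2)).symm (s x)) i *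
          φ (Module.finBasis ℂ W i) := by
    ext x
    conv_lhs => rw [← (Module.finBasis ℂ W).sum_repr
      ((τ.equiv _ (chart_mem_atlas _ x₀) x.1 (hVU x.2)).symm (s x)), map_sum]
    simp
  rw [this]
  exact IsHolFun.sum _ fun i _ => (h i).mul (IsHolFun.const _)

/-- An isomorphism of the typical fibres compatible with the changes of charts defines an
isomorphism of bundles. -/
def iso (τ : Triv E W) (τ' : Triv F W') (Ψ : W ≃ₗ[ℂ] W')
    (h : ∀ e he e' he' x hx hx' v, τ'.equiv e he x hx (Ψ ((τ.equiv e he x hx).symm v)) =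
      τ'.equiv e' he' x hx' (Ψ ((τ.equiv e' he' x hx').symm v))) : Iso E F where
  toEquiv x := ((τ.equiv _ (chart_mem_atlas _ x) x (mem_chart_source _ x)).symm.trans Ψ).trans
    (τ'.equiv _ (chart_mem_atlas _ x) x (mem_chart_source _ x))
  isHol_iff U s := by
    have key : ∀ (e) (he : e ∈ atlas (Fin n → ℂ) X) (V : Opens X) (hV : ∀ x ∈ V, x ∈ e.source)
        (hVU : V ≤ U), E.IsHol (fun y : V => s ⟨y.1, hVU y.2⟩) ↔
        F.IsHol (fun y : V => (((τ.equiv _ (chart_mem_atlas _ y.1) y.1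
          (mem_chart_source _ y.1)).symm.trans Ψ).trans
          (τ'.equiv _ (chart_mem_atlas _ y.1) y.1 (mem_chart_source _ y.1))) (s ⟨y.1, hVU y.2⟩)) := by
      intro e he V hV hVU
      rw [τ.isHol_iff e he V hV, τ'.isHol_iff e he V hV]
      -- The isomorphism is defined with the preferred chart at each point; by `h` it is given by
      -- `Ψ` in the chart `e` as well.
      have h2 : ∀ y : V, (τ'.equiv e he y.1 (hV y.1 y.2)).symm ((((τ.equiv _ (chart_mem_atlas _ y.1) y.1
          (mem_chart_source _ y.1)).symm.trans Ψ).trans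
          (τ'.equiv _ (chart_mem_atlas _ y.1) y.1 (mem_chart_source _ y.1))) (s ⟨y.1, hVU y.2⟩)) =
          Ψ ((τ.equiv e he y.1 (hV y.1 y.2)).symm (s ⟨y.1, hVU y.2⟩)) := by
        intro y
        rw [LinearEquiv.symm_apply_eq, LinearEquiv.trans_apply, LinearEquiv.trans_apply]
        exact h _ _ _ _ _ _ _ _
      simp only [h2]
      refine ⟨fun h φ => h (φ ∘ₗ Ψ.toLinearMap), fun h φ => ?_⟩
      simpa using h (φ ∘ₗ Ψ.symm.toLinearMap)
    constructor
    · intro hs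
      refine IsHol.of_local fun x => ⟨U ⊓ chartDomain (chartAt (Fin n → ℂ) x.1), inf_le_left,
        ⟨x.2, mem_chart_source _ _⟩, ?_⟩
      exact (key _ (chart_mem_atlas _ x.1) (U ⊓ chartDomain (chartAt (Fin n → ℂ) x.1))
        (fun _ hy => hy.2) inf_le_left).1 (hs.res inf_le_left)
    · intro hs
      refine IsHol.of_local fun x => ⟨U ⊓ chartDomain (chartAt (Fin n → ℂ) x.1), inf_le_left,
        ⟨x.2, mem_chart_source _ _⟩, ?_⟩
      exact (key _ (chart_mem_atlas _ x.1) (U ⊓ chartDomain (chartAt (Fin n → ℂ) x.1))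
        (fun _ hy => hy.2) inf_le_left).2
        (IsHol.res (E := F) hs inf_le_left)

/-- Trivializations with an isomorphic typical fibre. -/
def congr (τ : Triv E W) (Ψ : W' ≃ₗ[ℂ] W) : Triv E W' where
  equiv e he x hx := Ψ.trans (τ.equiv e he x hx)
  isHol_iff e he V hV s := by
    rw [τ.isHol_iff e he V hV s]
    refine ⟨fun h φ => h (φ ∘ₗ Ψ.symm.toLinearMap), fun h φ => ?_⟩
    simpa using h (φ ∘ₗ Ψ.toLinearMap)

/-- The trivializations of a quotient by subspaces which are constant in the trivializations. -/
def quotient (τ : Triv E W) (N : ∀ x, Submodule ℂ (E.Fib x)) (N₀ : Submodule ℂ W)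
    (hN : ∀ e he x hx, N₀.map (τ.equiv e he x hx).toLinearMap = N x) :
    Triv (E.quotient N) (W ⧸ N₀) where
  equiv e he x hx := Submodule.Quotient.equiv N₀ (N x) (τ.equiv e he x hx) (hN e he x hx)
  isHol_iff e he V hV s := by
    let Q : ∀ x (_ : x ∈ e.source), (W ⧸ N₀) ≃ₗ[ℂ] (E.quotient N).Fib x := fun x hx =>
      Submodule.Quotient.equiv N₀ (N x) (τ.equiv e he x hx) (hN e he x hx)
    have hsymm : ∀ x hx (t : E.Fib x),
        (Q x hx).symm ((N x).mkQ t) = N₀.mkQ ((τ.equiv e he x hx).symm t) := by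
      intro x hx t
      refine (LinearEquiv.symm_apply_eq _).2 ?_
      exact (congrArg (N x).mkQ ((τ.equiv e he x hx).apply_symm_apply t)).symm
    change _ ↔ ∀ φ : (W ⧸ N₀) →ₗ[ℂ] ℂ,
      IsHolFun n fun x : V => φ ((Q x.1 (hV x.1 x.2)).symm (s x))
    constructor
    · intro hs φ
      refine IsHolFun.of_local fun x₀ => ?_
      obtain ⟨V', hV', hx, t, ht, h⟩ := hs x₀
      refine ⟨V', hV', hx, ?_⟩
      have h2 := (τ.isHol_iff e he V' (fun y hy => hV y (hV' hy)) t).1 ht (φ ∘ₗ N₀.mkQ)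
      have h3 : (fun y : V' => φ ((Q y.1 (hV y.1 (hV' y.2))).symm (s ⟨y.1, hV' y.2⟩))) =
          fun y : V' => (φ ∘ₗ N₀.mkQ) ((τ.equiv e he y.1 (hV y.1 (hV' y.2))).symm (t y)) :=
        funext fun y => congrArg φ ((congrArg _ (h y)).trans (hsymm y.1 _ (t y)))
      exact h3 ▸ h2
    · intro hs x₀
      -- A linear section of the quotient map of the typical fibres lifts holomorphic sections of
      -- the quotient over the whole of `V`.
      obtain ⟨σ, hσ⟩ := N₀.mkQ.exists_rightInverse_of_surjective N₀.range_mkQ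
      refine ⟨V, le_rfl, x₀.2, fun y => τ.equiv e he y.1 (hV y.1 y.2) (σ
        ((Q y.1 (hV y.1 y.2)).symm (s y))), ?_, fun y => ?_⟩
      · rw [τ.isHol_iff e he V hV]
        intro φ
        simp only [LinearEquiv.symm_apply_apply]
        exact hs (φ ∘ₗ σ)
      · refine (Q y.1 (hV y.1 y.2)).symm.injective (Eq.trans ?_ (hsymm y.1 _ _).symm)
        rw [LinearEquiv.symm_apply_apply]
        exact (LinearMap.congr_fun hσ _).symm

/-- The trivializations of a finite direct sum. -/
def directSum {ι : Type} [Fintype ι] [DecidableEq ι] {E : ι → HolPrebundle n X} {W : ι → Type}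
    [∀ i, AddCommGroup (W i)] [∀ i, Module ℂ (W i)] (τ : ∀ i, Triv (E i) (W i)) :
    Triv (HolPrebundle.directSum E) (⨁ i, W i) where
  equiv e he x hx := DFinsupp.mapRange.linearEquiv fun i => (τ i).equiv e he x hx
  isHol_iff e he V hV s := by
    have h0 : (HolPrebundle.directSum E).IsHol s ↔ ∀ i (φ : W i →ₗ[ℂ] ℂ), IsHolFun n fun x : V =>
        φ (((τ i).equiv e he x.1 (hV x.1 x.2)).symm ((show ⨁ i, (E i).Fib x.1 from s x) i)) :=
      forall_congr' fun i => (τ i).isHol_iff e he V hV _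
    rw [h0]
    constructor
    · intro h φ
      have h1 : ∀ w : ⨁ i, W i, φ w = ∑ i, φ (DirectSum.lof ℂ ι W i (w i)) := fun w => by
        conv_lhs => rw [← DirectSum.sum_univ_of w, map_sum]
        rfl
      rw [show (fun x : V => φ _) = _ from funext fun x => h1 _]
      exact IsHolFun.sum _ fun i _ => h i (φ ∘ₗ DirectSum.lof ℂ ι W i)
    · intro h i φ
      exact h (φ ∘ₗ DirectSum.component ℂ ι W i)

section OfFrames

variable {A : X → Type} [∀ x, AddCommGroup (A x)] [∀ x, Module ℂ (A x)]
  {N : ∀ x, Submodule ℂ (A x)} {B : Type} [Fintype B]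
  {b : OpenPartialHomeomorph X (Fin n → ℂ) → B → ∀ x, A x}

/-- The identification of coordinates with respect to linearly independent vectors. -/
def coordEquiv {M : Type} [AddCommGroup M] [Module ℂ M] {v : B → M} (hv : LinearIndependent ℂ v)
    (W : Submodule ℂ (B → ℂ)) {N : Submodule ℂ M} (h : W.map (Fintype.linearCombination ℂ v) = N) :
    W ≃ₗ[ℂ] N :=
  (Submodule.equivMapOfInjective (Fintype.linearCombination ℂ v)
    (linearIndependent_iff_injective_fintypeLinearCombination.1 hv) W).trans (LinearEquiv.ofEq _ _ h)

lemma coordEquiv_coe {M : Type} [AddCommGroup M] [Module ℂ M] {v : B → M}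
    (hv : LinearIndependent ℂ v) (W : Submodule ℂ (B → ℂ)) {N : Submodule ℂ M}
    (h : W.map (Fintype.linearCombination ℂ v) = N) (w : W) :
    (coordEquiv hv W h w : M) = ∑ i, w.1 i • v i := rfl

lemma sum_coordEquiv_symm {M : Type} [AddCommGroup M] [Module ℂ M] {v : B → M}
    (hv : LinearIndependent ℂ v) (W : Submodule ℂ (B → ℂ)) {N : Submodule ℂ M}
    (h : W.map (Fintype.linearCombination ℂ v) = N) (x : N) :
    ∑ i, ((coordEquiv hv W h).symm x).1 i • v i = x := by
  rw [← coordEquiv_coe hv W h, LinearEquiv.apply_symm_apply]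

/-- The trivializations defined by frames which depend holomorphically on each other. -/
def ofFrames
    (hli : ∀ e ∈ atlas (Fin n → ℂ) X, ∀ x ∈ e.source, LinearIndependent ℂ fun i => b e i x)
    (htr : ∀ e ∈ atlas (Fin n → ℂ) X, ∀ e' ∈ atlas (Fin n → ℂ) X,
      ∃ θ : B → B → ↥(chartDomain e ⊓ chartDomain e') → ℂ, (∀ i j, IsHolFun n (θ i j)) ∧
        ∀ i x, b e i x.1 = ∑ j, θ i j x • b e' j x.1)
    (W : Submodule ℂ (B → ℂ))
    (hW : ∀ e ∈ atlas (Fin n → ℂ) X, ∀ x ∈ e.source,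
      W.map (Fintype.linearCombination ℂ fun i => b e i x) = N x) :
    Triv (HolPrebundle.ofFrames A N B b) W where
  equiv e he x hx := coordEquiv (hli e he x hx) W (hW e he x hx)
  isHol_iff e he V hV s := by
    classical
    let Q : ∀ x (_ : x ∈ e.source), W ≃ₗ[ℂ] N x := fun x hx =>
      coordEquiv (hli e he x hx) W (hW e he x hx)
    have hcoe : ∀ x hx (v : N x), ∑ i, ((Q x hx).symm v).1 i • b e i x = (v : A x) :=
      fun x hx v => sum_coordEquiv_symm (hli e he x hx) W (hW e he x hx) v
    change _ ↔ ∀ φ : W →ₗ[ℂ] ℂ, IsHolFun n fun x : V => φ ((Q x.1 (hV x.1 x.2)).symm (s x))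
    constructor
    · intro hs φ
      -- Extended to all coordinate vectors, the functional becomes a combination with constant
      -- coefficients of the frame coefficients.
      obtain ⟨ψ, hψ⟩ := φ.exists_extend
      refine IsHolFun.of_local fun x₀ => ?_
      obtain ⟨V', hV', hx, c, hc, h⟩ := hs e he x₀ (hV x₀.1 x₀.2)
      refine ⟨V', hV', hx, ?_⟩
      have h1 : ∀ y : V', ((Q y.1 (hV y.1 (hV' y.2))).symm (s ⟨y.1, hV' y.2⟩)).1 =
          fun i => c i y := by
        intro y
        refine linearIndependent_iff_injective_fintypeLinearCombination.1
          (hli e he y.1 (hV y.1 (hV' y.2))) ?_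
        simp only [Fintype.linearCombination_apply]
        exact (hcoe y.1 (hV y.1 (hV' y.2)) _).trans (h y)
      have h2 : ∀ w : W, φ w = ∑ i, w.1 i * ψ (Pi.single i 1) := by
        intro w
        rw [← hψ, LinearMap.comp_apply, Submodule.subtype_apply]
        conv_lhs => rw [pi_eq_sum_univ' w.1, map_sum]
        refine Finset.sum_congr rfl fun i _ => ?_
        rw [map_smul, smul_eq_mul]
      have h3 : (fun y : V' => φ ((Q y.1 (hV y.1 (hV' y.2))).symm (s ⟨y.1, hV' y.2⟩))) =
          fun y => ∑ i, c i y * ψ (Pi.single i 1) := funext fun y => by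
        rw [h2]
        exact Finset.sum_congr rfl fun i _ => by rw [h1 y]
      rw [h3]
      exact IsHolFun.sum _ fun i _ => (hc i).mul (IsHolFun.const _)
    -- Holomorphy in the single chart `e` has to be carried to every chart `e'`: multiplying by the
    -- holomorphic matrix `θ` gives the coefficients there.
    · intro hs e' he' x₀ hx₀
      obtain ⟨θ, hθ, h⟩ := htr e he e' he'
      have hle : V ⊓ chartDomain e' ≤ chartDomain e ⊓ chartDomain e' :=
        fun y hy => ⟨hV y hy.1, hy.2⟩
      refine ⟨V ⊓ chartDomain e', inf_le_left, ⟨x₀.2, hx₀⟩, fun j y => ∑ i,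
        ((Q y.1 (hV y.1 y.2.1)).symm (s ⟨y.1, y.2.1⟩)).1 i * θ i j ⟨y.1, hle y.2⟩,
        fun j => ?_, fun y => ?_⟩
      · refine IsHolFun.sum _ fun i _ => IsHolFun.mul ?_ ((hθ i j).res hle)
        exact (hs (LinearMap.proj i ∘ₗ W.subtype)).res inf_le_left
      · rw [← hcoe y.1 (hV y.1 y.2.1) (s ⟨y.1, y.2.1⟩)]
        simp only [Finset.sum_smul, mul_smul]
        rw [Finset.sum_comm]
        refine Finset.sum_congr rfl fun i _ => ?_
        rw [← Finset.smul_sum]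
        exact congrArg _ (h i ⟨y.1, hle y.2⟩)

end OfFrames

end Triv

end HolPrebundle

end GreenGriffiths

end

noncomputable section

namespace GreenGriffiths

/-! ### Dimensions of cohomology spaces -/

section Ext

open Abelian

universe w v u

variable {C : Type u} [Category.{v} C] [Abelian C] [Linear ℂ C] [HasExt.{w} C]

/-- The linear map between `Ext` spaces induced by a morphism of the second variable. -/
def extMap (L : C) {Y Z : C} (f : Y ⟶ Z) (q : ℕ) : Ext L Y q →ₗ[ℂ] Ext L Z q :=
  (Ext.bilinearCompOfLinear ℂ L Y Z q 0 q (add_zero q)).flip (Ext.mk₀ f)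

lemma extMap_apply (L : C) {Y Z : C} (f : Y ⟶ Z) (q : ℕ) (x : Ext L Y q) :
    extMap L f q x = x.comp (Ext.mk₀ f) (add_zero q) := rfl

lemma extMap_id (L Y : C) (q : ℕ) : extMap L (𝟙 Y) q = LinearMap.id := by
  ext x
  rw [extMap_apply, Ext.comp_mk₀_id]
  rfl

lemma extMap_comp (L : C) {Y Z T : C} (f : Y ⟶ Z) (g : Z ⟶ T) (q : ℕ) :
    extMap L (f ≫ g) q = extMap L g q ∘ₗ extMap L f q := by
  ext x
  rw [LinearMap.comp_apply, extMap_apply, extMap_apply, extMap_apply, ← Ext.mk₀_comp_mk₀,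
    ← Ext.comp_assoc_of_third_deg_zero]

lemma extMap_sum (L : C) {Y Z : C} {ι : Type*} [Fintype ι] (f : ι → (Y ⟶ Z)) (q : ℕ) :
    extMap L (∑ i, f i) q = ∑ i, extMap L (f i) q := by
  rw [extMap, Ext.mk₀_sum, map_sum]
  rfl

lemma extMap_zero (L Y Z : C) (q : ℕ) : extMap L (0 : Y ⟶ Z) q = 0 := by
  rw [extMap, Ext.mk₀_zero, map_zero]

lemma rank_ext_congr (L : C) {Y Z : C} (e : Y ≅ Z) (q : ℕ) :
    Module.rank ℂ (Ext L Y q) = Module.rank ℂ (Ext L Z q) :=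
  (LinearEquiv.ofLinearMap (extMap L e.hom q) (extMap L e.inv q)
    (by rw [← extMap_comp, e.inv_hom_id, extMap_id])
    (by rw [← extMap_comp, e.hom_inv_id, extMap_id])).rank_eq

/-- The dimensions of `Ext` spaces are subadditive in short exact sequences. -/
lemma rank_ext_le_add (L : C) {S : ShortComplex C} (hS : S.ShortExact) (q : ℕ) :
    Module.rank ℂ (Ext L S.X₂ q) ≤
      Module.rank ℂ (Ext L S.X₁ q) + Module.rank ℂ (Ext L S.X₃ q) := by
  -- Exactness in the middle of the long exact sequence; the bound is then rank-nullity for the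
  -- second map.
  have h1 : LinearMap.ker (extMap L S.g q) ≤ LinearMap.range (extMap L S.f q) := fun x hx =>
    Ext.covariant_sequence_exact₂ L hS x hx
  rw [← LinearMap.rank_range_add_rank_ker (extMap L S.g q), add_comm]
  exact add_le_add ((Submodule.rank_mono h1).trans (rank_range_le _))
    (Submodule.rank_le _)

end Ext

section ExtSum

open Abelian

universe v u

variable {C : Type u} [Category.{v} C] [Abelian C] [Linear ℂ C] [HasExt.{0} C]

/-- The dimensions of `Ext` spaces are additive in finite direct sums. -/
lemma rank_ext_eq_sum (L : C) {ι : Type} [Fintype ι] [DecidableEq ι] {Y : C} {Z : ι → C}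
    (i : ∀ j, Z j ⟶ Y) (p : ∀ j, Y ⟶ Z j) (hip : ∀ j, i j ≫ p j = 𝟙 _)
    (hip' : ∀ j k, j ≠ k → i j ≫ p k = 0) (hsum : ∑ j, p j ≫ i j = 𝟙 Y) (q : ℕ) :
    Module.rank ℂ (Ext.{0} L Y q) = Cardinal.sum fun j => Module.rank ℂ (Ext.{0} L (Z j) q) := by
  have e : Ext.{0} L Y q ≃ₗ[ℂ] (∀ j, Ext.{0} L (Z j) q) := LinearEquiv.ofLinearMap
    (LinearMap.pi fun j => extMap L (p j) q)
    (∑ j, extMap L (i j) q ∘ₗ LinearMap.proj j)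
    (by
      refine LinearMap.ext fun x => funext fun k => ?_
      simp only [LinearMap.comp_apply, LinearMap.sum_apply, LinearMap.pi_apply, map_sum,
        LinearMap.proj_apply, LinearMap.id_apply]
      rw [Finset.sum_eq_single k]
      · rw [← LinearMap.comp_apply, ← extMap_comp, hip, extMap_id]; rfl
      · intro j _ hj
        rw [← LinearMap.comp_apply, ← extMap_comp, hip' j k hj, extMap_zero]; rfl
      · simp)
    (by
      refine LinearMap.ext fun x => ?_
      simp only [LinearMap.comp_apply, LinearMap.sum_apply, LinearMap.pi_apply,
        LinearMap.proj_apply, LinearMap.id_apply]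
      have h := LinearMap.congr_fun (extMap_sum L (fun j => p j ≫ i j) q) x
      rw [hsum, extMap_id, LinearMap.sum_apply] at h
      refine Eq.trans (Finset.sum_congr rfl fun j _ => ?_) h.symm
      rw [extMap_comp]; rfl)
  rw [e.rank_eq, rank_pi]

end ExtSum

/-! ### Cohomology of direct sums and short exact sequences of bundles -/

namespace HolPrebundle

variable {n : ℕ} {X : Type} [TopologicalSpace X] [ChartedSpace (Fin n → ℂ) X]
  {E F G : HolPrebundle n X}

/-- The morphism of sheaves defined by linear maps of the fibres which preserve holomorphic
sections. -/
def sheafMap (f : ∀ x, E.Fib x →ₗ[ℂ] F.Fib x)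
    (hf : ∀ (U : Opens X) (s : ∀ x : U, E.Fib x), E.IsHol s → F.IsHol fun x : U => f x.1 (s x)) :
    E.sheaf ⟶ F.sheaf :=
  ⟨{ app := fun U => ModuleCat.ofHom
      { toFun := fun s => ⟨fun x => f x.1 (s.1 x), hf U.unop s.1 s.2⟩
        map_add' := fun _ _ => Subtype.ext (funext fun x => map_add (f x.1) _ _)
        map_smul' := fun _ _ => Subtype.ext (funext fun x => map_smul (f x.1) _ _) }
     naturality := fun _ _ _ => rfl }⟩

lemma sheafMap_congr {f g : ∀ x, E.Fib x →ₗ[ℂ] F.Fib x} (hf hg) (h : ∀ x v, f x v = g x v) :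
    sheafMap f hf = sheafMap g hg := by
  obtain rfl : f = g := funext fun x => LinearMap.ext (h x)
  rfl

lemma sheafMap_comp (f : ∀ x, E.Fib x →ₗ[ℂ] F.Fib x) (hf) (g : ∀ x, F.Fib x →ₗ[ℂ] G.Fib x) (hg) :
    sheafMap f hf ≫ sheafMap g hg =
      sheafMap (fun x => g x ∘ₗ f x) fun U s hs => hg U _ (hf U s hs) := rfl

lemma sheafMap_id : sheafMap (fun x => (LinearMap.id : E.Fib x →ₗ[ℂ] E.Fib x))
    (fun _ _ hs => hs) = 𝟙 E.sheaf := rfl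

lemma h_congr (e : Iso E F) (q : ℕ) : E.h q = F.h q :=
  rank_ext_congr _
    { hom := sheafMap (fun x => (e.toEquiv x).toLinearMap) fun U s hs => (e.isHol_iff U s).1 hs
      inv := sheafMap (fun x => (e.toEquiv x).symm.toLinearMap) fun U s hs =>
        (e.isHol_iff U _).2 (by simpa using hs)
      hom_inv_id := by
        rw [sheafMap_comp, ← sheafMap_id]
        exact sheafMap_congr _ _ fun x v => (e.toEquiv x).symm_apply_apply v
      inv_hom_id := by
        rw [sheafMap_comp, ← sheafMap_id]
        exact sheafMap_congr _ _ fun x v => (e.toEquiv x).apply_symm_apply v } q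

lemma sheafMap_zero : sheafMap (fun x => (0 : E.Fib x →ₗ[ℂ] F.Fib x))
    (fun U _ _ => F.zero_mem U) = 0 := rfl

lemma sheafMap_sum {ι : Type} (s : Finset ι) (f : ι → ∀ x, E.Fib x →ₗ[ℂ] F.Fib x)
    (hf : ∀ (i) (U : Opens X) (t : ∀ x : U, E.Fib x), E.IsHol t →
      F.IsHol fun x : U => f i x.1 (t x))
    (hs : ∀ (U : Opens X) (t : ∀ x : U, E.Fib x), E.IsHol t →
      F.IsHol fun x : U => (∑ i ∈ s, f i x.1) (t x)) :
    ∑ i ∈ s, sheafMap (f i) (hf i) = sheafMap (fun x => ∑ i ∈ s, f i x) hs := by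
  classical
  induction s using Finset.induction_on with
  | empty => rfl
  | insert i s his ih =>
    -- The hypothesis concerns only the full sum, so the smaller sum preserves holomorphy because it
    -- is the full one minus the term of index `i`.
    have hs' : ∀ (U : Opens X) (t : ∀ x : U, E.Fib x), E.IsHol t →
        F.IsHol fun x : U => (∑ i ∈ s, f i x.1) (t x) := fun U t ht => by
      have h1 : F.IsHol fun x : U => (-1 : ℂ) • f i x.1 (t x) :=
        F.smul_mem (fun _ => -1) _ contMDiff_const (hf i U t ht)
      have h2 := F.add_mem _ _ (hs U t ht) h1
      simp only [Finset.sum_insert his, LinearMap.add_apply] at h2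
      have h3 : (fun x : U => (∑ i ∈ s, f i x.1) (t x)) = fun x : U =>
          f i x.1 (t x) + (∑ i ∈ s, f i x.1) (t x) + (-1 : ℂ) • f i x.1 (t x) := by
        ext x
        module
      rw [h3]
      exact h2
    rw [Finset.sum_insert his, ih hs']
    have h : ∀ x v, (f i x + ∑ i ∈ s, f i x) v = (∑ i ∈ insert i s, f i x) v := fun x v => by
      rw [Finset.sum_insert his]
    exact sheafMap_congr (f := fun x => f i x + ∑ i ∈ s, f i x)
      (g := fun x => ∑ i ∈ insert i s, f i x)
      (fun U t ht => F.add_mem _ _ (hf i U t ht) (hs' U t ht)) hs h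

lemma isHol_lof {ι : Type} [DecidableEq ι] (E : ι → HolPrebundle n X) (i : ι) (U : Opens X)
    (s : ∀ x : U, (E i).Fib x) (hs : (E i).IsHol s) :
    (directSum E).IsHol fun x : U => DirectSum.lof ℂ ι (fun i => (E i).Fib x) i (s x) := by
  intro k
  by_cases h : i = k
  · subst h
    have h1 : (fun x : U => (DirectSum.lof ℂ ι (fun i => (E i).Fib x.1) i (s x)) i) = s :=
      funext fun x => DirectSum.lof_apply (M := fun i => (E i).Fib x.1) ℂ i (s x)
    exact h1.symm ▸ hs
  · have h1 : (fun x : U => (DirectSum.lof ℂ ι (fun i => (E i).Fib x.1) i (s x)) k) = fun _ => 0 :=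
      funext fun x => DirectSum.of_eq_of_ne (β := fun i => (E i).Fib x.1) i k (s x) (Ne.symm h)
    exact h1.symm ▸ (E k).zero_mem U

/-- Inclusions and projections of the fibres preserve holomorphic sections, so the sheaf of the sum
is a biproduct of the sheaves. -/
lemma h_directSum {ι : Type} [Fintype ι] (E : ι → HolPrebundle n X) (q : ℕ) :
    (directSum E).h q = Cardinal.sum fun i => (E i).h q := by
  classical
  let inc : ∀ i, (E i).sheaf ⟶ (directSum E).sheaf := fun i =>
    sheafMap (F := directSum E) (fun x => DirectSum.lof ℂ ι (fun i => (E i).Fib x) i) (isHol_lof E i)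
  let pr : ∀ i, (directSum E).sheaf ⟶ (E i).sheaf := fun i =>
    sheafMap (E := directSum E) (fun x => DirectSum.component ℂ ι (fun i => (E i).Fib x) i)
      fun _ _ hs => hs i
  refine rank_ext_eq_sum _ inc pr (fun i => ?_) (fun i j hij => ?_) ?_ q
  · refine (sheafMap_comp (F := directSum E) _ (isHol_lof E i) _ fun _ _ hs => hs i).trans
      ((sheafMap_congr _ _ fun x v => ?_).trans sheafMap_id)
    exact DirectSum.component.lof_self (M := fun i => (E i).Fib x) ℂ i v
  · refine (sheafMap_comp (F := directSum E) _ (isHol_lof E i) _ fun _ _ hs => hs j).trans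
      ((sheafMap_congr _ _ fun x v => ?_).trans sheafMap_zero)
    exact DirectSum.of_eq_of_ne (β := fun i => (E i).Fib x) i j v (Ne.symm hij)
  · have key : ∀ x (v : ⨁ i, (E i).Fib x), (∑ i, DirectSum.lof ℂ ι (fun i => (E i).Fib x) i ∘ₗ
        DirectSum.component ℂ ι (fun i => (E i).Fib x) i) v = v := fun x v => by
      rw [LinearMap.sum_apply]
      exact DirectSum.sum_univ_of v
    refine (sheafMap_sum (E := directSum E) (F := directSum E) Finset.univ
      (fun i x => DirectSum.lof ℂ ι (fun i => (E i).Fib x) i ∘ₗ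
        DirectSum.component ℂ ι (fun i => (E i).Fib x) i)
      (fun i U s hs => isHol_lof E i U _ (hs i)) fun U s hs => ?_).trans
      ((sheafMap_congr _ _ key).trans sheafMap_id)
    exact (congrArg (directSum E).IsHol (funext fun x : U => key x.1 (s x))).mpr hs

/-- Dimensions of cohomology are subadditive in short exact sequences of bundles. -/
lemma h_le_add (f : ∀ x, E.Fib x →ₗ[ℂ] F.Fib x) (g : ∀ x, F.Fib x →ₗ[ℂ] G.Fib x)
    (hf : ∀ (U : Opens X) (s : ∀ x : U, E.Fib x), E.IsHol s ↔ F.IsHol fun x : U => f x.1 (s x))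
    (hg : ∀ (U : Opens X) (s : ∀ x : U, F.Fib x), F.IsHol s → G.IsHol fun x : U => g x.1 (s x))
    (hinj : ∀ x, Function.Injective (f x)) (hfg : ∀ x, LinearMap.range (f x) = LinearMap.ker (g x))
    (hsurj : ∀ (U : Opens X) (s : ∀ x : U, G.Fib x), G.IsHol s → ∀ x₀ : U, ∃ (V : Opens X)
      (hVU : V ≤ U) (_ : x₀.1 ∈ V) (t : ∀ y : V, F.Fib y), F.IsHol t ∧
        ∀ y : V, s ⟨y.1, hVU y.2⟩ = g y.1 (t y)) (q : ℕ) :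
    F.h q ≤ E.h q + G.h q := by
  have hgf : ∀ x v, g x (f x v) = 0 := fun x v =>
    LinearMap.mem_ker.1 (hfg x ▸ LinearMap.mem_range_self (f x) v)
  let φ : E.sheaf ⟶ F.sheaf := sheafMap f fun U s => (hf U s).1
  let γ : F.sheaf ⟶ G.sheaf := sheafMap g hg
  have hzero : φ ≫ γ = 0 := by
    rw [sheafMap_comp, ← sheafMap_zero]
    exact sheafMap_congr _ _ hgf
  have hmono : Mono φ := ⟨fun {K} a b hab => by
    refine Sheaf.hom_ext (NatTrans.ext (funext fun U => ModuleCat.hom_ext (LinearMap.ext fun v => ?_)))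
    refine Subtype.ext (funext fun x => hinj x.1 ?_)
    have h1 := congrArg (fun c : K ⟶ F.sheaf => (c.hom.app U).hom v) hab
    exact congrFun (congrArg Subtype.val h1) x⟩
  -- Local liftability of sections is local surjectivity, which for sheaves gives an epimorphism.
  have hepi : Epi γ := by
    have : TopCat.Presheaf.IsLocallySurjective (X := TopCat.of X) γ.hom := by
      rw [TopCat.Presheaf.isLocallySurjective_iff]
      intro U t x hx
      obtain ⟨V, hVU, hxV, s, hs, h⟩ := hsurj U t.1 t.2 ⟨x, hx⟩
      exact ⟨V, hVU, ⟨⟨s, hs⟩, Subtype.ext (funext fun y => (h y).symm)⟩, hxV⟩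
    have : CategoryTheory.Sheaf.IsLocallySurjective γ := this
    infer_instance
  let S : ShortComplex (Sheaf (Opens.grothendieckTopology X) (ModuleCat.{0} ℂ)) :=
    ShortComplex.mk φ γ hzero
  -- A morphism killed by `γ` takes values in the ranges of the injective maps `f x`, hence lifts
  -- fibrewise; the lift preserves holomorphy because `hf` is an equivalence.
  have hlim : Limits.IsLimit (Limits.KernelFork.ofι S.f S.zero) :=
    Limits.KernelFork.IsLimit.ofι' _ _ fun {K} k hk => by
      have hk' : ∀ U v x, ((k.hom.app U).hom v).1 x ∈ LinearMap.range (f x.1) := by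
        intro U v x
        rw [hfg]
        have h1 := congrArg (fun c : K ⟶ G.sheaf => (c.hom.app U).hom v) hk
        exact congrFun (congrArg Subtype.val h1) x
      let inv : ∀ x, LinearMap.range (f x) →ₗ[ℂ] E.Fib x := fun x =>
        (LinearEquiv.ofInjective (f x) (hinj x)).symm.toLinearMap
      have hinv : ∀ x v, f x (inv x v) = v.1 := fun x v =>
        congrArg Subtype.val ((LinearEquiv.ofInjective (f x) (hinj x)).apply_symm_apply v)
      let lift : ∀ U, K.obj.obj U →ₗ[ℂ] E.sections U.unop := fun U =>
        { toFun := fun v => ⟨fun x => inv x.1 ⟨_, hk' U v x⟩, (hf U.unop _).2 (by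
            simp only [hinv]
            exact ((k.hom.app U).hom v).2)⟩
          map_add' := fun v w => Subtype.ext (funext fun x => hinj x.1 (by
            refine (hinv _ _).trans (Eq.trans ?_ (map_add (f x.1) _ _).symm)
            refine Eq.trans ?_ (congrArg₂ (· + ·) (hinv _ _) (hinv _ _)).symm
            exact congrFun (congrArg Subtype.val (map_add (k.hom.app U).hom v w)) x))
          map_smul' := fun c v => Subtype.ext (funext fun x => hinj x.1 (by
            refine (hinv _ _).trans (Eq.trans ?_ (map_smul (f x.1) _ _).symm)
            refine Eq.trans ?_ (congrArg (c • ·) (hinv _ _)).symm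
            exact congrFun (congrArg Subtype.val (map_smul (k.hom.app U).hom c v)) x)) }
      have hlift : ∀ U v x, f x.1 ((lift U v).1 x) = ((k.hom.app U).hom v).1 x :=
        fun U v x => hinv _ _
      refine ⟨⟨{ app := fun U => ModuleCat.ofHom (lift U), naturality := fun U V i => ?_ }⟩, ?_⟩
      · refine ModuleCat.hom_ext (LinearMap.ext fun v => Subtype.ext (funext fun x => hinj x.1 ?_))
        refine (hlift V _ x).trans (Eq.trans ?_ (hlift U v ⟨x.1, i.unop.le x.2⟩).symm)
        have h1 := congrArg (fun c => c.hom v) (k.hom.naturality i)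
        exact congrFun (congrArg Subtype.val h1) x
      · refine Sheaf.hom_ext (NatTrans.ext (funext fun U =>
          ModuleCat.hom_ext (LinearMap.ext fun v => Subtype.ext (funext fun x => ?_))))
        exact hlift U v x
  exact rank_ext_le_add _ (S := S)
    { exact := ShortComplex.exact_of_f_is_kernel S hlim, mono_f := hmono, epi_g := hepi } q

end HolPrebundle

end GreenGriffiths

end

noncomputable section

namespace GreenGriffiths

/-! ### Multidegrees of jet polynomials -/

section Colex

variable {κ : ℕ}

lemma toColex_lt_iff {a b : Fin κ → ℕ} :
    toColex a < toColex b ↔ ∃ i, (∀ j, i < j → a j = b j) ∧ a i < b i := Iff.rfl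

lemma toColex_add_lt_add_right {a b : Fin κ → ℕ} (h : toColex a < toColex b) (c : Fin κ → ℕ) :
    toColex (a + c) < toColex (b + c) := by
  obtain ⟨i, h1, h2⟩ := toColex_lt_iff.1 h
  exact toColex_lt_iff.2 ⟨i, fun j hj => by simp [h1 j hj], by simpa using h2⟩

lemma toColex_add_lt_add_left {a b : Fin κ → ℕ} (h : toColex a < toColex b) (c : Fin κ → ℕ) :
    toColex (c + a) < toColex (c + b) := by
  rw [add_comm c, add_comm c]
  exact toColex_add_lt_add_right h c

lemma toColex_add_lt_add {a b c d : Fin κ → ℕ} (h : toColex a < toColex b)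
    (h' : toColex c < toColex d) : toColex (a + c) < toColex (b + d) :=
  (toColex_add_lt_add_right h c).trans (toColex_add_lt_add_left h' b)

end Colex

/-! ### Weights, multidegrees and leading parts of polynomials -/

section JetPolynomials

open MvPolynomial

variable {n κ m : ℕ}

/-- The multidegree of a monomial in the variables `x_i^{(λ)}`. -/
def multidegree (n κ : ℕ) : (Fin κ × Fin n →₀ ℕ) →+ (Fin κ → ℕ) where
  toFun δ l := ∑ i, δ (l, i)
  map_zero' := by ext; simp
  map_add' δ δ' := by ext; simp [Finset.sum_add_distrib]

lemma multidegree_single (p : Fin κ × Fin n) :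
    multidegree n κ (Finsupp.single p 1) = Pi.single p.1 1 := by
  ext l
  change ∑ i, (Finsupp.single p 1 : Fin κ × Fin n →₀ ℕ) (l, i) = _
  obtain ⟨l', i'⟩ := p
  simp only [Finsupp.single_apply, Prod.mk.injEq, Pi.single_apply]
  by_cases h : l' = l
  · simp [h]
  · simp [h, Ne.symm h]

/-- The weight of a multidegree. -/
def weight (κ : ℕ) : (Fin κ → ℕ) →+ ℕ where
  toFun d := ∑ l, (l.1 + 1) * d l
  map_zero' := by simp
  map_add' d d' := by simp [mul_add, Finset.sum_add_distrib]

lemma weight_single (l : Fin κ) : weight κ (Pi.single l 1) = l.1 + 1 := by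
  change ∑ l', (l'.1 + 1) * (Pi.single l 1 : Fin κ → ℕ) l' = _
  simp [Pi.single_apply]

lemma restrictSupport_mul {σ : Type*} {S S' S'' : Set (σ →₀ ℕ)}
    (h : ∀ a ∈ S, ∀ b ∈ S', a + b ∈ S'') {p q : MvPolynomial σ ℂ} (hp : p ∈ restrictSupport ℂ S)
    (hq : q ∈ restrictSupport ℂ S') : p * q ∈ restrictSupport ℂ S'' := by
  classical
  rw [mem_restrictSupport_iff] at *
  intro c hc
  obtain ⟨a, ha, b, hb, rfl⟩ := Finset.mem_add.1 (support_mul p q hc)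
  exact h a (hp ha) b (hq hb)

lemma coeff_eq_zero_of_mem_restrictSupport {σ : Type*} {S : Set (σ →₀ ℕ)} {p : MvPolynomial σ ℂ}
    (hp : p ∈ restrictSupport ℂ S) {a : σ →₀ ℕ} (ha : a ∉ S) : coeff a p = 0 := by
  by_contra h
  exact ha ((mem_restrictSupport_iff ℂ).1 hp (mem_support_iff.2 h))

/-- The polynomial `q` is the part of multidegree `d` of `p`, whose other terms have smaller
multidegrees in the colexicographic order. -/
structure IsLeading (d : Fin κ → ℕ) (p q : MvPolynomial (Fin κ × Fin n) ℂ) : Prop where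
  mem : q ∈ restrictSupport ℂ {δ | multidegree n κ δ = d}
  sub_mem : p - q ∈ restrictSupport ℂ {δ | toColex (multidegree n κ δ) < toColex d}

namespace IsLeading

lemma one : IsLeading 0 (1 : MvPolynomial (Fin κ × Fin n) ℂ) 1 where
  mem := (monomial_mem_restrictSupport ℂ).2 (Or.inl (map_zero _))
  sub_mem := by simp

lemma mul {d d' : Fin κ → ℕ} {p q p' q' : MvPolynomial (Fin κ × Fin n) ℂ} (h : IsLeading d p q)
    (h' : IsLeading d' p' q') : IsLeading (d + d') (p * p') (q * q') where
  mem := restrictSupport_mul (by rintro a rfl b rfl; exact map_add _ _ _) h.mem h'.mem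
  sub_mem := by
    -- Each of the three products contains a factor of strictly smaller multidegree, and the
    -- colexicographic order is compatible with addition.
    have e : p * p' - q * q' = (p - q) * (p' - q') + (p - q) * q' + q * (p' - q') := by ring
    rw [e]
    refine add_mem (add_mem (restrictSupport_mul (fun a ha b hb => ?_) h.sub_mem h'.sub_mem)
      (restrictSupport_mul (fun a ha b hb => ?_) h.sub_mem h'.mem))
      (restrictSupport_mul (fun a ha b hb => ?_) h.mem h'.sub_mem)
    · rw [Set.mem_ofPred_eq, map_add]
      exact toColex_add_lt_add ha hb
    · rw [Set.mem_ofPred_eq, map_add, show multidegree n κ b = d' from hb]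
      exact toColex_add_lt_add_right ha d'
    · rw [Set.mem_ofPred_eq, map_add, show multidegree n κ a = d from ha]
      exact toColex_add_lt_add_left hb d

lemma pow {d : Fin κ → ℕ} {p q : MvPolynomial (Fin κ × Fin n) ℂ} (h : IsLeading d p q) (k : ℕ) :
    IsLeading (k • d) (p ^ k) (q ^ k) := by
  induction k with
  | zero => simpa using one
  | succ k ih =>
    rw [pow_succ, pow_succ, succ_nsmul]
    exact ih.mul h

lemma prod {ι : Type*} (s : Finset ι) {d : ι → Fin κ → ℕ}
    {p q : ι → MvPolynomial (Fin κ × Fin n) ℂ} (h : ∀ i ∈ s, IsLeading (d i) (p i) (q i)) :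
    IsLeading (∑ i ∈ s, d i) (∏ i ∈ s, p i) (∏ i ∈ s, q i) := by
  classical
  induction s using Finset.induction_on with
  | empty => simpa using one
  | insert i s his ih =>
    rw [Finset.sum_insert his, Finset.prod_insert his, Finset.prod_insert his]
    exact (h i (Finset.mem_insert_self i s)).mul
      (ih fun j hj => h j (Finset.mem_insert_of_mem hj))

lemma coeff_eq_zero {d : Fin κ → ℕ} {p q : MvPolynomial (Fin κ × Fin n) ℂ} (h : IsLeading d p q)
    {δ : Fin κ × Fin n →₀ ℕ} (hδ : ¬ toColex (multidegree n κ δ) ≤ toColex d) :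
    coeff δ p = 0 := by
  rw [← sub_add_cancel p q, coeff_add, coeff_eq_zero_of_mem_restrictSupport h.sub_mem,
    coeff_eq_zero_of_mem_restrictSupport h.mem, add_zero]
  · rintro (rfl : _ = _)
    exact hδ le_rfl
  · exact fun h => hδ h.le

lemma coeff_eq {d : Fin κ → ℕ} {p q : MvPolynomial (Fin κ × Fin n) ℂ} (h : IsLeading d p q)
    {δ : Fin κ × Fin n →₀ ℕ} (hδ : multidegree n κ δ = d) : coeff δ p = coeff δ q := by
  rw [← sub_eq_zero, ← coeff_sub, coeff_eq_zero_of_mem_restrictSupport h.sub_mem]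
  rw [← hδ]
  exact lt_irrefl (toColex (multidegree n κ δ))

end IsLeading

/-! ### Derivatives of composite functions -/

section FaaDiBruno

/-- There is at most one ordered partition with exactly one part. -/
lemma orderedFinpartition_eq_of_length_eq_one {k : ℕ} {c c' : OrderedFinpartition k}
    (hc : c.length = 1) (hc' : c'.length = 1) : c = c' := by
  have key : ∀ c : OrderedFinpartition k, ∀ hc : c.length = 1, ∀ i : Fin c.length,
      c.partSize i = k := by
    intro c hc i
    have h := c.sum_sigma_eq_sum (fun _ => 1)
    have : Subsingleton (Fin c.length) := by rw [hc]; infer_instance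
    simp only [Finset.sum_const, Finset.card_univ, Fintype.card_fin, smul_eq_mul, mul_one] at h
    rw [Fintype.sum_subsingleton _ i] at h
    exact h
  obtain ⟨l, s, h1, b, h2, h3, h4, h5⟩ := c
  obtain ⟨l', s', h1', b', h2', h3', h4', h5'⟩ := c'
  obtain rfl : l = 1 := hc
  obtain rfl : l' = 1 := hc'
  have hs : s = fun _ => k := funext (key ⟨1, s, h1, b, h2, h3, h4, h5⟩ rfl)
  have hs' : s' = fun _ => k := funext (key ⟨1, s', h1', b', h2', h3', h4', h5'⟩ rfl)
  subst hs
  subst hs'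
  -- A strictly increasing map is determined by its range, and here the single part is everything.
  have hb : b = b' := by
    funext i
    refine ((h2 i).range_inj (h2' i)).1 ?_
    rw [Set.range_eq_univ.2 (Finite.injective_iff_surjective.1 (h2 i).injective),
      Set.range_eq_univ.2 (Finite.injective_iff_surjective.1 (h2' i).injective)]
  subst hb
  rfl

/-- The ordered partition with one part. -/
def onePart (k : ℕ) (hk : 0 < k) : OrderedFinpartition k where
  length := 1
  partSize _ := k
  partSize_pos _ := hk
  emb _ := id
  emb_strictMono _ := strictMono_id
  parts_strictMono := Subsingleton.strictMono _
  disjoint := by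
    intro i _ j _ hij
    exact absurd (Subsingleton.elim i j) hij
  cover x := ⟨0, x, rfl⟩

lemma iteratedDeriv_pi_apply {ι : Type*} [Fintype ι] {u : ℂ → ι → ℂ} {t : ℂ}
    (hu : ContDiffAt ℂ ω u t) (k : ℕ) (i : ι) :
    iteratedDeriv k u t i = iteratedDeriv k (fun t => u t i) t := by
  rw [iteratedDeriv_eq_iteratedFDeriv, iteratedDeriv_eq_iteratedFDeriv]
  have h := (ContinuousLinearMap.proj (R := ℂ) (φ := fun _ : ι => ℂ) i).iteratedFDeriv_comp_left
    (x := t) (i := k) hu le_top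
  exact (congrArg (fun T => T fun _ => (1 : ℂ)) h).symm

lemma sub_one_lt_of_partSize {l : Fin κ} (c : OrderedFinpartition (l.1 + 1)) (j : Fin c.length) :
    c.partSize j - 1 < κ := by
  have h1 := c.partSize_le j
  have h2 := c.partSize_pos j
  have h3 := l.2
  omega

/-- The variables which occur in a term of the formula of Faà di Bruno. -/
def partVar {l : Fin κ} (c : OrderedFinpartition (l.1 + 1)) (J : Fin c.length → Fin n)
    (j : Fin c.length) : Fin κ × Fin n :=
  (⟨c.partSize j - 1, sub_one_lt_of_partSize c j⟩, J j)

/-- The derivative of order `l + 1` of `g ∘ u` as a polynomial in the derivatives of `u`, at a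
point where `u` takes the value `z`. -/
def chainPoly (g : (Fin n → ℂ) → ℂ) (z : Fin n → ℂ) (l : Fin κ) :
    MvPolynomial (Fin κ × Fin n) ℂ :=
  ∑ c : OrderedFinpartition (l.1 + 1), ∑ J : Fin c.length → Fin n,
    C (iteratedFDeriv ℂ c.length g z fun j => Pi.single (J j) 1) * ∏ j, X (partVar c J j)

/-- Faà di Bruno's formula, with the derivatives of `u` expanded in the standard basis and the
multilinear forms expanded accordingly. -/
lemma eval_chainPoly {g : (Fin n → ℂ) → ℂ} {u : ℂ → Fin n → ℂ} {t : ℂ}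
    (hg : ContDiffAt ℂ ω g (u t)) (hu : ContDiffAt ℂ ω u t) (l : Fin κ) :
    eval (fun p => iteratedDeriv (p.1.1 + 1) (fun t => u t p.2) t) (chainPoly g (u t) l) =
      iteratedDeriv (l.1 + 1) (g ∘ u) t := by
  rw [iteratedDeriv_vcomp_eq_sum_orderedFinpartition hg hu le_top, chainPoly, map_sum]
  refine Finset.sum_congr rfl fun c _ => ?_
  have h1 : (fun j => iteratedDeriv (c.partSize j) u t) = fun j => ∑ i : Fin n,
      iteratedDeriv (c.partSize j) (fun t => u t i) t • (Pi.single i 1 : Fin n → ℂ) := by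
    funext j
    conv_lhs => rw [pi_eq_sum_univ' (iteratedDeriv (c.partSize j) u t)]
    exact Finset.sum_congr rfl fun i _ => by rw [iteratedDeriv_pi_apply hu]
  rw [h1, map_sum]
  refine Eq.trans ?_ ((iteratedFDeriv ℂ c.length g (u t)).toMultilinearMap.map_sum _).symm
  refine Finset.sum_congr rfl fun J _ => ?_
  refine Eq.trans ?_ ((iteratedFDeriv ℂ c.length g (u t)).toMultilinearMap.map_smul_univ
    (fun j => iteratedDeriv (c.partSize j) (fun t => u t (J j)) t)
    fun j => Pi.single (J j) 1).symm
  rw [map_mul, eval_C, map_prod, smul_eq_mul, mul_comm]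
  refine congrArg₂ _ (Finset.prod_congr rfl fun j _ => ?_) rfl
  rw [eval_X]
  simp only [partVar, Nat.sub_add_cancel (c.partSize_pos j)]

lemma prod_X_mem_restrictSupport {ι : Type*} [Fintype ι] (p : ι → Fin κ × Fin n)
    {S : Set (Fin κ × Fin n →₀ ℕ)} (h : ∑ j, Finsupp.single (p j) 1 ∈ S) (a : ℂ) :
    C a * ∏ j, X (p j) ∈ restrictSupport ℂ S := by
  have : (C a * ∏ j, X (p j) : MvPolynomial (Fin κ × Fin n) ℂ) =
      monomial (∑ j, Finsupp.single (p j) 1) a := by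
    rw [← mul_one a, ← C_mul_monomial, monomial_sum_one, mul_one]
    rfl
  rw [this]
  exact (monomial_mem_restrictSupport ℂ).2 (Or.inl h)

lemma multidegree_partVar {l : Fin κ} (c : OrderedFinpartition (l.1 + 1))
    (J : Fin c.length → Fin n) : multidegree n κ (∑ j, Finsupp.single (partVar c J j) 1) =
      ∑ j, Pi.single ⟨c.partSize j - 1, sub_one_lt_of_partSize c j⟩ 1 := by
  rw [map_sum]
  exact Finset.sum_congr rfl fun j _ => multidegree_single _

lemma sum_partSize {k : ℕ} (c : OrderedFinpartition k) : ∑ j, c.partSize j = k := by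
  have h := c.sum_sigma_eq_sum (fun _ => 1)
  simpa using h

/-- The parts of a partition of `l + 1` add up to `l + 1`, so changes of charts preserve the weight.
-/
lemma chainPoly_mem_restrictSupport (g : (Fin n → ℂ) → ℂ) (z : Fin n → ℂ) (l : Fin κ) :
    chainPoly g z l ∈ restrictSupport ℂ {δ | weight κ (multidegree n κ δ) = l.1 + 1} := by
  refine sum_mem fun c _ => sum_mem fun J _ => prod_X_mem_restrictSupport _ ?_ _
  rw [Set.mem_ofPred_eq, multidegree_partVar, map_sum]
  simp only [weight_single, Nat.sub_add_cancel (c.partSize_pos _)]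
  exact sum_partSize c

/-- A linear form in the derivatives of order `l + 1`. -/
def linPoly (a : Fin n → ℂ) (l : Fin κ) : MvPolynomial (Fin κ × Fin n) ℂ :=
  ∑ i, C (a i) * X (l, i)

lemma sum_onePart (g : (Fin n → ℂ) → ℂ) (z : Fin n → ℂ) (l : Fin κ) :
    ∑ J : Fin (onePart (l.1 + 1) l.1.succ_pos).length → Fin n,
      C (iteratedFDeriv ℂ (onePart (l.1 + 1) l.1.succ_pos).length g z fun j =>
        Pi.single (J j) 1) * ∏ j, X (partVar (onePart (l.1 + 1) l.1.succ_pos) J j) =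
      linPoly (fun i => fderiv ℂ g z (Pi.single i 1)) l := by
  refine Fintype.sum_equiv (Equiv.funUnique (Fin 1) (Fin n)) _ _ fun J => ?_
  refine congrArg₂ _ (congrArg C ?_) (Fin.prod_univ_one _)
  exact iteratedFDeriv_one_apply _

/-- The partition with one part gives the linear term in the derivatives of order `l + 1`. Any other
partition has at least two parts, all smaller than `l + 1`, so its term involves only lower
derivatives and is colexicographically smaller. -/
lemma isLeading_chainPoly (g : (Fin n → ℂ) → ℂ) (z : Fin n → ℂ) (l : Fin κ) :
    IsLeading (Pi.single l 1) (chainPoly g z l)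
      (linPoly (fun i => fderiv ℂ g z (Pi.single i 1)) l) where
  mem := by
    refine sum_mem fun i _ => ?_
    rw [C_mul_X_eq_monomial]
    exact (monomial_mem_restrictSupport ℂ).2 (Or.inl (multidegree_single _))
  sub_mem := by
    classical
    rw [chainPoly, ← Finset.add_sum_erase _ _ (Finset.mem_univ (onePart (l.1 + 1) l.1.succ_pos)),
      sum_onePart, add_sub_cancel_left]
    refine sum_mem fun c hc => sum_mem fun J _ => prod_X_mem_restrictSupport _ ?_ _
    have hc1 : c.length ≠ 1 := fun h =>
      Finset.ne_of_mem_erase hc (orderedFinpartition_eq_of_length_eq_one h rfl)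
    have hlt : ∀ j, c.partSize j - 1 < l.1 := by
      intro j
      have hnt : Nontrivial (Fin c.length) := by
        rw [Fin.nontrivial_iff_two_le]
        have := c.length_pos l.1.succ_pos
        omega
      obtain ⟨j', hj'⟩ := exists_ne j
      have h1 : c.partSize j + c.partSize j' ≤ ∑ j, c.partSize j := by
        rw [← Finset.sum_pair hj'.symm]
        exact Finset.sum_le_sum_of_subset (Finset.subset_univ _)
      rw [sum_partSize] at h1
      have h2 := c.partSize_pos j'
      have h3 := c.partSize_pos j
      omega
    rw [Set.mem_ofPred_eq, multidegree_partVar, toColex_lt_iff]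
    -- The multidegree of such a term vanishes from position `l` on, so it is already below that of
    -- the linear term at position `l`.
    have h0 : ∀ l' : Fin κ, l ≤ l' → (∑ j, Pi.single (M := fun _ => ℕ)
        (⟨c.partSize j - 1, sub_one_lt_of_partSize c j⟩ : Fin κ) 1 : Fin κ → ℕ) l' = 0 := by
      intro l' hl'
      rw [Finset.sum_apply]
      refine Finset.sum_eq_zero fun j _ => Pi.single_eq_of_ne ?_ _
      intro h
      have h1 := hlt j
      have h2 : l'.1 = _ := congrArg Fin.val h
      have h3 : l.1 ≤ l'.1 := hl'
      simp only at h2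
      omega
    refine ⟨l, fun l' hl' => ?_, ?_⟩
    · rw [h0 l' hl'.le, Pi.single_eq_of_ne hl'.ne']
    · rw [h0 l le_rfl, Pi.single_eq_same]
      exact one_pos

end FaaDiBruno

/-! ### Jet polynomials in coordinates -/

/-- The exponent as an exponent of a polynomial in the variables `x_i^{(λ)}`. -/
def JetExponent.toFinsupp (α : JetExponent n κ m) : Fin κ × Fin n →₀ ℕ :=
  Finsupp.equivFunOnFinite.symm fun p => α.1 p.1 p.2

lemma JetExponent.toFinsupp_injective :
    Function.Injective (JetExponent.toFinsupp (n := n) (κ := κ) (m := m)) := fun _ _ h =>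
  Subtype.ext (funext fun l => funext fun i => DFunLike.congr_fun h (l, i))

lemma JetExponent.multidegree_toFinsupp (α : JetExponent n κ m) :
    multidegree n κ α.toFinsupp = α.deg := rfl

lemma JetExponent.weight_deg (α : JetExponent n κ m) : weight κ α.deg = m := α.2

lemma JetExponent.exists_toFinsupp_eq {δ : Fin κ × Fin n →₀ ℕ}
    (h : weight κ (multidegree n κ δ) = m) : ∃ α : JetExponent n κ m, α.toFinsupp = δ :=
  ⟨⟨fun l i => δ (l, i), h⟩, Finsupp.ext fun _ => rfl⟩

/-- The substitution of the polynomials `p` in the monomial with exponent `α`. -/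
def substMonomial (p : Fin κ × Fin n → MvPolynomial (Fin κ × Fin n) ℂ) (α : JetExponent n κ m) :
    MvPolynomial (Fin κ × Fin n) ℂ := ∏ v, p v ^ α.toFinsupp v

lemma sum_toFinsupp_smul_single (α : JetExponent n κ m) :
    ∑ v, α.toFinsupp v • (Pi.single v.1 1 : Fin κ → ℕ) = α.deg := by
  rw [← JetExponent.multidegree_toFinsupp]
  conv_rhs => rw [← Finsupp.univ_sum_single α.toFinsupp, map_sum]
  refine Finset.sum_congr rfl fun v _ => ?_
  rw [← multidegree_single, ← map_nsmul, Finsupp.smul_single, smul_eq_mul, mul_one]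

lemma substMonomial_mem_restrictSupport {p : Fin κ × Fin n → MvPolynomial (Fin κ × Fin n) ℂ}
    (hp : ∀ v, p v ∈ restrictSupport ℂ {δ | weight κ (multidegree n κ δ) = v.1.1 + 1})
    (α : JetExponent n κ m) :
    substMonomial p α ∈ restrictSupport ℂ {δ | weight κ (multidegree n κ δ) = m} := by
  classical
  have hpow : ∀ v k, p v ^ k ∈
      restrictSupport ℂ {δ | weight κ (multidegree n κ δ) = k * (v.1.1 + 1)} := by
    intro v k
    induction k with
    | zero => exact (monomial_mem_restrictSupport ℂ).2 (Or.inl (by simp))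
    | succ k ih =>
      rw [pow_succ]
      refine restrictSupport_mul (fun a ha b hb => ?_) ih (hp v)
      rw [Set.mem_ofPred_eq] at *
      rw [map_add, map_add, ha, hb]
      ring
  have hprod : ∀ s : Finset (Fin κ × Fin n), ∏ v ∈ s, p v ^ α.toFinsupp v ∈
      restrictSupport ℂ {δ | weight κ (multidegree n κ δ) =
        ∑ v ∈ s, α.toFinsupp v * (v.1.1 + 1)} := by
    intro s
    induction s using Finset.induction_on with
    | empty => exact (monomial_mem_restrictSupport ℂ).2 (Or.inl (by simp))
    | insert v s hv ih =>
      rw [Finset.prod_insert hv, Finset.sum_insert hv]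
      refine restrictSupport_mul (fun a ha b hb => ?_) (hpow v _) ih
      rw [Set.mem_ofPred_eq] at *
      rw [map_add, map_add, ha, hb]
  have hsum : ∑ v : Fin κ × Fin n, α.toFinsupp v * (v.1.1 + 1) = m := by
    refine Eq.trans ?_ α.weight_deg
    rw [← sum_toFinsupp_smul_single, map_sum]
    refine Finset.sum_congr rfl fun v _ => ?_
    rw [map_nsmul, weight_single, smul_eq_mul]
  have h := hprod Finset.univ
  rwa [hsum] at h

lemma isLeading_substMonomial {p q : Fin κ × Fin n → MvPolynomial (Fin κ × Fin n) ℂ}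
    (h : ∀ v, IsLeading (Pi.single v.1 1) (p v) (q v)) (α : JetExponent n κ m) :
    IsLeading α.deg (substMonomial p α) (substMonomial q α) := by
  rw [← sum_toFinsupp_smul_single]
  exact IsLeading.prod _ fun v _ => (h v).pow _

lemma eval_eq_sum_jetExponent {p : MvPolynomial (Fin κ × Fin n) ℂ}
    (hp : p ∈ restrictSupport ℂ {δ | weight κ (multidegree n κ δ) = m}) (y : Fin κ × Fin n → ℂ) :
    eval y p = ∑ α : JetExponent n κ m, coeff α.toFinsupp p * ∏ v, y v ^ α.toFinsupp v := by
  rw [eval_eq']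
  refine Eq.trans ?_ (Finset.sum_map Finset.univ ⟨_, JetExponent.toFinsupp_injective⟩
    fun δ => coeff δ p * ∏ v, y v ^ δ v)
  refine Finset.sum_subset (fun δ hδ => ?_) fun δ _ hδ => ?_
  · obtain ⟨α, hα⟩ := JetExponent.exists_toFinsupp_eq ((mem_restrictSupport_iff ℂ).1 hp hδ)
    exact Finset.mem_map.2 ⟨α, Finset.mem_univ _, hα⟩
  · rw [notMem_support_iff.1 hδ, zero_mul]

lemma eval_substMonomial (p : Fin κ × Fin n → MvPolynomial (Fin κ × Fin n) ℂ)
    (α : JetExponent n κ m) (y : Fin κ × Fin n → ℂ) :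
    eval y (substMonomial p α) = ∏ v, eval y (p v) ^ α.toFinsupp v := by
  simp [substMonomial, map_prod, map_pow]

end JetPolynomials

end GreenGriffiths

end

noncomputable section

namespace GreenGriffiths

/-! ### Changes of charts -/

section Charts

variable {n : ℕ} {X : Type} [TopologicalSpace X] [ChartedSpace (Fin n → ℂ) X]
  {e e' : OpenPartialHomeomorph X (Fin n → ℂ)}

/-- A component of the change of charts. -/
def transition (e e' : OpenPartialHomeomorph X (Fin n → ℂ)) (i : Fin n) (z : Fin n → ℂ) : ℂ :=
  e' (e.symm z) i

/-- The Jacobian matrix of the change of charts. -/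
def jacobian (e e' : OpenPartialHomeomorph X (Fin n → ℂ)) (x : X) (i j : Fin n) : ℂ :=
  fderiv ℂ (transition e e' i) (e x) (Pi.single j 1)

lemma transition_eventuallyEq {X : Type} [TopologicalSpace X]
    {e e' : OpenPartialHomeomorph X (Fin n → ℂ)} {x : X} (hx : x ∈ e.source) (i : Fin n) :
    (fun y => e' y i) =ᶠ[nhds x] transition e e' i ∘ e := by
  filter_upwards [e.open_source.mem_nhds hx] with y hy
  simp [transition, e.left_inv hy]

variable [IsManifold 𝓘(ℂ, Fin n → ℂ) ω X]

lemma contMDiffAt_chart (he : e ∈ atlas (Fin n → ℂ) X) {x : X} (hx : x ∈ e.source) :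
    ContMDiffAt 𝓘(ℂ, Fin n → ℂ) 𝓘(ℂ, Fin n → ℂ) ω e x :=
  contMDiffAt_of_mem_maximalAtlas (IsManifold.subset_maximalAtlas he) hx

lemma contMDiffAt_chart_symm (he : e ∈ atlas (Fin n → ℂ) X) {z : Fin n → ℂ} (hz : z ∈ e.target) :
    ContMDiffAt 𝓘(ℂ, Fin n → ℂ) 𝓘(ℂ, Fin n → ℂ) ω e.symm z :=
  contMDiffAt_symm_of_mem_maximalAtlas (IsManifold.subset_maximalAtlas he) hz

lemma contMDiffAt_chart_apply (he : e ∈ atlas (Fin n → ℂ) X) {x : X} (hx : x ∈ e.source)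
    (i : Fin n) : ContMDiffAt 𝓘(ℂ, Fin n → ℂ) 𝓘(ℂ) ω (fun y => e y i) x :=
  (contMDiffAt_pi_space.1 (contMDiffAt_chart he hx)) i

lemma contDiffAt_transition (he : e ∈ atlas (Fin n → ℂ) X) (he' : e' ∈ atlas (Fin n → ℂ) X) {x : X}
    (hx : x ∈ e.source) (hx' : x ∈ e'.source) (i : Fin n) :
    ContDiffAt ℂ ω (transition e e' i) (e x) := by
  rw [← contMDiffAt_iff_contDiffAt]
  have h1 := contMDiffAt_chart_symm he (e.map_source hx)
  have h2 : ContMDiffAt 𝓘(ℂ, Fin n → ℂ) 𝓘(ℂ) ω (fun y => e' y i) (e.symm (e x)) := by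
    rw [e.left_inv hx]
    exact contMDiffAt_chart_apply he' hx' i
  exact h2.comp (e x) h1

lemma isHolFun_iteratedFDeriv_transition (he : e ∈ atlas (Fin n → ℂ) X)
    (he' : e' ∈ atlas (Fin n → ℂ) X) (i : Fin n) (k : ℕ) (v : Fin k → Fin n → ℂ) :
    IsHolFun n fun x : ↥(HolPrebundle.chartDomain e ⊓ HolPrebundle.chartDomain e') =>
      iteratedFDeriv ℂ k (transition e e' i) (e x) v := by
  rw [isHolFun_iff fun x => iteratedFDeriv ℂ k (transition e e' i) (e x) v]
  intro x hx
  have h1 : ContDiffAt ℂ ω (fun z => iteratedFDeriv ℂ k (transition e e' i) z v) (e x) :=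
    (ContinuousMultilinearMap.apply ℂ (fun _ : Fin k => Fin n → ℂ) ℂ v).contDiff.contDiffAt.comp
      (e x) ((contDiffAt_transition he he' hx.1 hx.2 i).iteratedFDeriv_right (m := ω) (i := k)
        le_top)
  exact (contMDiffAt_iff_contDiffAt.2 h1).comp x (contMDiffAt_chart he hx.1)

lemma isHolFun_jacobian (he : e ∈ atlas (Fin n → ℂ) X) (he' : e' ∈ atlas (Fin n → ℂ) X)
    (i j : Fin n) : IsHolFun n
      fun x : ↥(HolPrebundle.chartDomain e ⊓ HolPrebundle.chartDomain e') =>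
        jacobian e e' x i j := by
  have h := isHolFun_iteratedFDeriv_transition he he' i 1 fun _ => Pi.single j 1
  simp only [iteratedFDeriv_one_apply] at h
  exact h

lemma mfderiv_chart_apply (he : e ∈ atlas (Fin n → ℂ) X) {x : X} (hx : x ∈ e.source)
    (v : TangentSpace 𝓘(ℂ, Fin n → ℂ) x) (j : Fin n) :
    (mfderiv 𝓘(ℂ, Fin n → ℂ) 𝓘(ℂ, Fin n → ℂ) e x v : Fin n → ℂ) j = coordDiff e j x v := by
  have h := mfderiv_comp_apply (I := 𝓘(ℂ, Fin n → ℂ)) (I' := 𝓘(ℂ, Fin n → ℂ)) (I'' := 𝓘(ℂ))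
    (g := ContinuousLinearMap.proj (R := ℂ) (φ := fun _ : Fin n => ℂ) j) x
    (ContinuousLinearMap.mdifferentiableAt _)
    ((contMDiffAt_chart he hx).mdifferentiableAt (by simp)) v
  rw [mfderiv_eq_fderiv, ContinuousLinearMap.fderiv] at h
  exact h.symm

lemma coordDiff_eq_sum (he : e ∈ atlas (Fin n → ℂ) X) (he' : e' ∈ atlas (Fin n → ℂ) X) {x : X}
    (hx : x ∈ e.source) (hx' : x ∈ e'.source) (i : Fin n) :
    coordDiff e' i x = ∑ j, jacobian e e' x i j • coordDiff e j x := by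
  have h1 : MDifferentiableAt 𝓘(ℂ, Fin n → ℂ) 𝓘(ℂ) (transition e e' i) (e x) :=
    (contMDiffAt_iff_contDiffAt.2 (contDiffAt_transition he he' hx hx' i)).mdifferentiableAt
      (by simp)
  refine ContinuousLinearMap.ext fun v => ?_
  have h2 : coordDiff e' i x v = fderiv ℂ (transition e e' i) (e x)
      (mfderiv 𝓘(ℂ, Fin n → ℂ) 𝓘(ℂ, Fin n → ℂ) e x v) := by
    rw [← mfderiv_eq_fderiv]
    refine Eq.trans ?_ (mfderiv_comp_apply x h1
      ((contMDiffAt_chart he hx).mdifferentiableAt (by simp)) v)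
    exact congrArg (fun L : TangentSpace 𝓘(ℂ, Fin n → ℂ) x →L[ℂ] ℂ => L v)
      (transition_eventuallyEq hx i).mfderiv_eq
  rw [h2]
  conv_lhs => rw [pi_eq_sum_univ' (mfderiv 𝓘(ℂ, Fin n → ℂ) 𝓘(ℂ, Fin n → ℂ) e x v), map_sum]
  refine Eq.trans ?_ (sum_apply _ _ v).symm
  refine Finset.sum_congr rfl fun j _ => ?_
  rw [map_smul, smul_eq_mul, mul_comm]
  exact congrArg _ (mfderiv_chart_apply he hx v j)

/-- The differential of a chart is surjective, the differential of the inverse chart being a right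
inverse, so a relation can be tested on preimages of the standard basis vectors. -/
lemma linearIndependent_coordDiff (he : e ∈ atlas (Fin n → ℂ) X) {x : X} (hx : x ∈ e.source) :
    LinearIndependent ℂ fun i => coordDiff e i x := by
  rw [Fintype.linearIndependent_iff]
  intro g hg j
  have hsurj : ∃ v : TangentSpace 𝓘(ℂ, Fin n → ℂ) x,
      (mfderiv 𝓘(ℂ, Fin n → ℂ) 𝓘(ℂ, Fin n → ℂ) e x v : Fin n → ℂ) = Pi.single j 1 := by
    have h1 : MDifferentiableAt 𝓘(ℂ, Fin n → ℂ) 𝓘(ℂ, Fin n → ℂ) e (e.symm (e x)) := by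
      rw [e.left_inv hx]
      exact (contMDiffAt_chart he hx).mdifferentiableAt (by simp)
    have h2 := mfderiv_comp_apply (e x) h1
      ((contMDiffAt_chart_symm he (e.map_source hx)).mdifferentiableAt (by simp))
      (Pi.single j 1 : Fin n → ℂ)
    have h3 : e ∘ e.symm =ᶠ[nhds (e x)] id := by
      filter_upwards [e.open_target.mem_nhds (e.map_source hx)] with z hz
      exact e.right_inv hz
    have h4 := h3.mfderiv_eq (I := 𝓘(ℂ, Fin n → ℂ)) (I' := 𝓘(ℂ, Fin n → ℂ))
    rw [mfderiv_id] at h4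
    have h5 := congrArg (fun L : (Fin n → ℂ) →L[ℂ] (Fin n → ℂ) => L (Pi.single j 1)) h4
    have h6 := h2.symm.trans h5
    -- The vector found lives in the tangent space at `e.symm (e x)`; it is transported along the
    -- equality of this point with `x`.
    have h7 : ∀ y (_ : y = x) (w : TangentSpace 𝓘(ℂ, Fin n → ℂ) y),
        (mfderiv 𝓘(ℂ, Fin n → ℂ) 𝓘(ℂ, Fin n → ℂ) e y w : Fin n → ℂ) = Pi.single j 1 →
        ∃ v : TangentSpace 𝓘(ℂ, Fin n → ℂ) x,
          (mfderiv 𝓘(ℂ, Fin n → ℂ) 𝓘(ℂ, Fin n → ℂ) e x v : Fin n → ℂ) = Pi.single j 1 := by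
      rintro _ rfl w hw
      exact ⟨w, hw⟩
    exact h7 _ (e.left_inv hx) _ h6
  obtain ⟨v, hv⟩ := hsurj
  have h := congrArg (fun L : Cotangent n x => L v) hg
  simp only [sum_apply, smul_apply,
    ← mfderiv_chart_apply he hx, hv] at h
  simpa [Pi.single_apply] using h

end Charts

/-! ### Jets of discs under a change of chart -/

section Jets

open MvPolynomial

variable {n κ m : ℕ} {X : Type} [TopologicalSpace X] [ChartedSpace (Fin n → ℂ) X]
  {e e' : OpenPartialHomeomorph X (Fin n → ℂ)}

/-- The derivatives at `0` of a disc in a chart. -/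
def jetEval (e : OpenPartialHomeomorph X (Fin n → ℂ)) {x : X} (f : Disc n x)
    (p : Fin κ × Fin n) : ℂ :=
  iteratedDeriv (p.1.1 + 1) (fun t : ℂ => e (f.toFun t) p.2) 0

lemma jetMonomial_apply (e : OpenPartialHomeomorph X (Fin n → ℂ)) (α : JetExponent n κ m) (x : X)
    (f : Disc n x) : jetMonomial e α x f = ∏ p, jetEval e f p ^ α.toFinsupp p :=
  (Fintype.prod_prod_type fun p : Fin κ × Fin n => jetEval e f p ^ α.toFinsupp p).symm

/-- The variables `x_i^{(λ)}` of the chart `e'` as polynomials in those of `e`. -/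
def jetChange (e e' : OpenPartialHomeomorph X (Fin n → ℂ)) (x : X) (p : Fin κ × Fin n) :
    MvPolynomial (Fin κ × Fin n) ℂ :=
  chainPoly (transition e e' p.2) (e x) p.1

/-- Modulo smaller multidegrees, a change of charts acts on jet monomials by the linear substitution
given by the Jacobian. -/
lemma isLeading_jetChange {X : Type} [TopologicalSpace X]
    (e e' : OpenPartialHomeomorph X (Fin n → ℂ)) (x : X) (α : JetExponent n κ m) :
    IsLeading α.deg (substMonomial (jetChange e e' x) α)
      (substMonomial (fun p => linPoly (jacobian e e' x p.2) p.1) α) :=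
  isLeading_substMonomial (fun _ => isLeading_chainPoly _ _ _) α

/-- A function with values in the polynomials whose coefficients are holomorphic. -/
def IsHolPoly {σ : Type} {U : Opens X} (p : U → MvPolynomial σ ℂ) : Prop :=
  ∀ δ, IsHolFun n fun x => coeff δ (p x)

namespace IsHolPoly

variable {σ : Type} {U : Opens X}

lemma const (p : MvPolynomial σ ℂ) : IsHolPoly (n := n) fun _ : U => p := fun _ => IsHolFun.const _

lemma mul {p q : U → MvPolynomial σ ℂ} (hp : IsHolPoly (n := n) p) (hq : IsHolPoly (n := n) q) :
    IsHolPoly (n := n) fun x => p x * q x := by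
  classical
  intro δ
  simp only [coeff_mul]
  exact IsHolFun.sum _ fun a _ => (hp a.1).mul (hq a.2)

lemma smul {f : U → ℂ} {q : U → MvPolynomial σ ℂ} (hf : IsHolFun n f)
    (hq : IsHolPoly (n := n) q) : IsHolPoly (n := n) fun x => C (f x) * q x := by
  intro δ
  simp only [coeff_C_mul]
  exact hf.mul (hq δ)

lemma sum {ι : Type*} (s : Finset ι) {p : ι → U → MvPolynomial σ ℂ}
    (hp : ∀ i ∈ s, IsHolPoly (n := n) (p i)) : IsHolPoly (n := n) fun x => ∑ i ∈ s, p i x := by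
  intro δ
  simp only [coeff_sum]
  exact IsHolFun.sum _ fun i hi => hp i hi δ

lemma pow {p : U → MvPolynomial σ ℂ} (hp : IsHolPoly (n := n) p) (k : ℕ) :
    IsHolPoly (n := n) fun x => p x ^ k := by
  induction k with
  | zero => simpa using const 1
  | succ k ih =>
    simp only [pow_succ]
    exact ih.mul hp

lemma prod {ι : Type*} (s : Finset ι) {p : ι → U → MvPolynomial σ ℂ}
    (hp : ∀ i ∈ s, IsHolPoly (n := n) (p i)) : IsHolPoly (n := n) fun x => ∏ i ∈ s, p i x := by
  classical
  induction s using Finset.induction_on with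
  | empty => simpa using const 1
  | insert i s his ih =>
    simp only [Finset.prod_insert his]
    exact (hp i (Finset.mem_insert_self i s)).mul
      (ih fun j hj => hp j (Finset.mem_insert_of_mem hj))

end IsHolPoly

variable [IsManifold 𝓘(ℂ, Fin n → ℂ) ω X]

lemma contDiffAt_chart_disc (he : e ∈ atlas (Fin n → ℂ) X) {x : X} (hx : x ∈ e.source)
    (f : Disc n x) : ContDiffAt ℂ ω (fun t => e (f.toFun t)) 0 := by
  rw [← contMDiffAt_iff_contDiffAt]
  refine ContMDiffAt.comp (I' := 𝓘(ℂ, Fin n → ℂ)) 0 ?_ f.hol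
  rw [f.map_zero]
  exact contMDiffAt_chart he hx

lemma eval_jetChange (he : e ∈ atlas (Fin n → ℂ) X) (he' : e' ∈ atlas (Fin n → ℂ) X) {x : X}
    (hx : x ∈ e.source) (hx' : x ∈ e'.source) (f : Disc n x) (p : Fin κ × Fin n) :
    eval (jetEval e f) (jetChange e e' x p) = jetEval e' f p := by
  have hu := contDiffAt_chart_disc he hx f
  have hg := contDiffAt_transition he he' hx hx' p.2
  have h := eval_chainPoly (u := fun t => e (f.toFun t)) (t := 0) (g := transition e e' p.2)
    (by simpa only [f.map_zero] using hg) hu p.1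
  simp only [f.map_zero] at h
  refine h.trans (Filter.EventuallyEq.iteratedDeriv_eq _ ?_)
  have h1 := f.hol.continuousAt.eventually (f.map_zero.symm ▸ e.open_source.mem_nhds hx)
  filter_upwards [h1] with t ht
  simp [transition, e.left_inv ht]

lemma jetMonomial_eq_sum (he : e ∈ atlas (Fin n → ℂ) X) (he' : e' ∈ atlas (Fin n → ℂ) X) {x : X}
    (hx : x ∈ e.source) (hx' : x ∈ e'.source) (α : JetExponent n κ m) :
    jetMonomial e' α x = ∑ β : JetExponent n κ m,
      coeff β.toFinsupp (substMonomial (jetChange e e' x) α) • jetMonomial e β x := by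
  funext f
  rw [jetMonomial_apply, Finset.sum_apply]
  simp only [← eval_jetChange he he' hx hx', ← eval_substMonomial]
  refine (eval_eq_sum_jetExponent (substMonomial_mem_restrictSupport (p := jetChange e e' x)
    (fun v => chainPoly_mem_restrictSupport _ _ _) α) _).trans ?_
  exact Finset.sum_congr rfl fun β _ => by rw [Pi.smul_apply, jetMonomial_apply, smul_eq_mul]

lemma isHolPoly_jetChange (he : e ∈ atlas (Fin n → ℂ) X) (he' : e' ∈ atlas (Fin n → ℂ) X)
    (p : Fin κ × Fin n) : IsHolPoly (n := n)
      fun x : ↥(HolPrebundle.chartDomain e ⊓ HolPrebundle.chartDomain e') =>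
        jetChange e e' x.1 p :=
  IsHolPoly.sum _ fun _ _ => IsHolPoly.sum _ fun _ _ =>
    (IsHolPoly.const _).smul (isHolFun_iteratedFDeriv_transition he he' _ _ _)

lemma isHolFun_coeff_substMonomial (he : e ∈ atlas (Fin n → ℂ) X)
    (he' : e' ∈ atlas (Fin n → ℂ) X) (α β : JetExponent n κ m) : IsHolFun n
      fun x : ↥(HolPrebundle.chartDomain e ⊓ HolPrebundle.chartDomain e') =>
        coeff β.toFinsupp (substMonomial (jetChange e e' x.1) α) :=
  IsHolPoly.prod _ (fun v _ => (isHolPoly_jetChange he he' v).pow _) _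

/-- Every family of numbers is the family of the derivatives of a disc. -/
lemma exists_jetEval_eq (he : e ∈ atlas (Fin n → ℂ) X) {x : X} (hx : x ∈ e.source)
    (y : Fin κ × Fin n → ℂ) : ∃ f : Disc n x, jetEval e f = y := by
  -- The Taylor polynomial with the prescribed derivatives at 0, read in the chart; the factorials
  -- cancel those produced by differentiation.
  let u : ℂ → Fin n → ℂ := fun t i =>
    e x i + ∑ l : Fin κ, y (l, i) / ((l.1 + 1).factorial : ℂ) * t ^ (l.1 + 1)
  have hu : ContDiff ℂ ω u := by
    rw [contDiff_pi]
    intro i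
    fun_prop
  have hu0 : u 0 = e x := by
    funext i
    simp [u]
  have hu0' : u 0 ∈ e.target := hu0 ▸ e.map_source hx
  refine ⟨⟨fun t => e.symm (u t), by rw [hu0, e.left_inv hx], ?_⟩, ?_⟩
  · exact (contMDiffAt_chart_symm he hu0').comp 0
      (contMDiffAt_iff_contDiffAt.2 hu.contDiffAt)
  · funext p
    have h1 : (fun t => e (e.symm (u t)) p.2) =ᶠ[nhds 0] fun t => u t p.2 := by
      filter_upwards [hu.continuous.continuousAt.eventually (e.open_target.mem_nhds hu0')] with t ht
      rw [e.right_inv ht]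
    refine (h1.iteratedDeriv_eq _).trans ?_
    change iteratedDeriv (p.1.1 + 1) (fun t => e x p.2 + ∑ l : Fin κ,
      y (l, p.2) / ((l.1 + 1).factorial : ℂ) * t ^ (l.1 + 1)) 0 = _
    rw [iteratedDeriv_const_add (Nat.succ_pos _)]
    rw [iteratedDeriv_fun_sum fun l _ => by fun_prop]
    simp only [iteratedDeriv_const_mul_field, iteratedDeriv_fun_pow_zero]
    rw [Finset.sum_eq_single p.1]
    · simp only [if_true]
      exact div_mul_cancel₀ _ (Nat.cast_ne_zero.2 (Nat.factorial_ne_zero _))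
    · intro l _ hl
      rw [if_neg, Nat.cast_zero, mul_zero]
      intro h
      exact hl (Fin.ext (by omega))
    · simp

/-- Jets of discs take all values, so a linear relation between jet monomials is a polynomial
vanishing identically. -/
lemma linearIndependent_jetMonomial (he : e ∈ atlas (Fin n → ℂ) X) {x : X} (hx : x ∈ e.source) :
    LinearIndependent ℂ fun α : JetExponent n κ m => jetMonomial e α x := by
  rw [Fintype.linearIndependent_iff]
  intro g hg
  have h : ∑ α : JetExponent n κ m, monomial α.toFinsupp (g α) = 0 := by
    refine MvPolynomial.funext fun y => ?_
    obtain ⟨f, rfl⟩ := exists_jetEval_eq he hx y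
    have h1 := congrFun hg f
    rw [Finset.sum_apply] at h1
    rw [map_sum, map_zero, ← h1.trans (Pi.zero_apply f)]
    refine Finset.sum_congr rfl fun α _ => ?_
    rw [eval_monomial, Pi.smul_apply, jetMonomial_apply, smul_eq_mul,
      Finsupp.prod_fintype _ _ fun _ => pow_zero _]
  intro α
  classical
  have h2 := congrArg (coeff α.toFinsupp) h
  simpa [coeff_sum, coeff_monomial, JetExponent.toFinsupp_injective.eq_iff] using h2

end Jets

end GreenGriffiths

end

noncomputable section

namespace GreenGriffiths

/-! ### Trivializations of the Schur bundles -/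

section Schur

variable {ι : Type} [Fintype ι] {V : Type} [AddCommGroup V] [Module ℂ V]

lemma reindex_linearCombination {A : Type} [Fintype A] [DecidableEq A] (v : ι → V)
    (σ : Equiv.Perm A) (t : (A → ι) → ℂ) :
    PiTensorProduct.reindex ℂ (fun _ : A => V) σ
        (Fintype.linearCombination ℂ (fun I => PiTensorProduct.tprod ℂ fun c => v (I c)) t) =
      Fintype.linearCombination ℂ (fun I => PiTensorProduct.tprod ℂ fun c => v (I c))
        fun I => t (I ∘ σ) := by
  simp only [Fintype.linearCombination_apply, map_sum, map_smul, PiTensorProduct.reindex_tprod]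
  refine Fintype.sum_equiv (Equiv.arrowCongr σ (Equiv.refl ι)) _ _ fun I => ?_
  refine congrArg₂ _ (congrArg t ?_) rfl
  funext c
  simp

lemma youngSymmetrizer_linearCombination (μ : YoungDiagram) (v : ι → V)
    (t : (μ.cells → ι) → ℂ) :
    youngSymmetrizer μ V
        (Fintype.linearCombination ℂ (fun I => PiTensorProduct.tprod ℂ fun c => v (I c)) t) =
      Fintype.linearCombination ℂ (fun I => PiTensorProduct.tprod ℂ fun c => v (I c))
        (colAlt μ ι (rowSymm μ ι t)) := by
  have h : colAlt μ ι (rowSymm μ ι t) = ∑ q ∈ colPerms μ, ∑ p ∈ rowPerms μ,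
      ((Equiv.Perm.sign q : ℤ) : ℂ) • fun I => t ((I ∘ q) ∘ p) := by
    funext I
    simp only [colAlt_apply, rowSymm_apply, Finset.sum_apply, Pi.smul_apply, smul_eq_mul,
      Finset.mul_sum]
  rw [h, map_sum, youngSymmetrizer, LinearMap.sum_apply]
  refine Finset.sum_congr (by ext; simp [mem_colPerms]) fun q _ => ?_
  rw [map_sum, LinearMap.sum_apply]
  refine Finset.sum_congr (by ext; simp [mem_rowPerms]) fun p _ => ?_
  rw [map_smul, LinearMap.smul_apply, LinearMap.comp_apply, LinearEquiv.coe_coe,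
    LinearEquiv.coe_coe, reindex_linearCombination, reindex_linearCombination]

/-- Passing to coordinates intertwines the Young symmetrizer with `colAlt` after `rowSymm`, and
every tensor has coordinates; so the two images correspond. -/
lemma map_schurCoord (μ : YoungDiagram) (b : Module.Basis ι ℂ V) :
    (schurCoord μ ι).map (Fintype.linearCombination ℂ
      fun I : μ.cells → ι => PiTensorProduct.tprod ℂ fun c => b (I c)) = schurPower μ V := by
  have h1 : LinearMap.range (Fintype.linearCombination ℂ
      fun I : μ.cells → ι => PiTensorProduct.tprod ℂ fun c => b (I c)) = ⊤ := by
    rw [Fintype.range_linearCombination, ← (Basis.piTensorProduct fun _ : μ.cells => b).span_eq]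
    congr 2
    funext I
    exact (Basis.piTensorProduct_apply _ I).symm
  have h2 : youngSymmetrizer μ V ∘ₗ (Fintype.linearCombination ℂ
      fun I : μ.cells → ι => PiTensorProduct.tprod ℂ fun c => b (I c)) =
      (Fintype.linearCombination ℂ
        fun I : μ.cells → ι => PiTensorProduct.tprod ℂ fun c => b (I c)) ∘ₗ
        (colAlt μ ι ∘ₗ rowSymm μ ι) :=
    LinearMap.ext fun t => youngSymmetrizer_linearCombination μ b t
  rw [schurPower, schurCoord, ← LinearMap.range_comp, ← h2, LinearMap.range_comp, h1,
    LinearMap.range_eq_map]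

lemma linearIndependent_tprod {ι A : Type} [Fintype A] (b : Module.Basis ι ℂ V) :
    LinearIndependent ℂ fun I : A → ι => PiTensorProduct.tprod ℂ fun c => b (I c) := by
  have h := (Basis.piTensorProduct fun _ : A => b).linearIndependent
  have h1 : ⇑(Basis.piTensorProduct fun _ : A => b) = fun I : A → ι =>
      PiTensorProduct.tprod ℂ fun c => b (I c) :=
    funext fun I => Basis.piTensorProduct_apply _ I
  exact h1 ▸ h

lemma tprod_eq_sum {A : Type} [Fintype A] [DecidableEq A] {v v' : ι → V} {θ : ι → ι → ℂ}
    (h : ∀ i, v i = ∑ j, θ i j • v' j) (I : A → ι) :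
    (PiTensorProduct.tprod ℂ fun c => v (I c)) =
      ∑ J : A → ι, (∏ c, θ (I c) (J c)) • PiTensorProduct.tprod ℂ fun c => v' (J c) := by
  simp only [h]
  rw [MultilinearMap.map_sum]
  exact Finset.sum_congr rfl fun J _ => MultilinearMap.map_smul_univ _ _ _

lemma eq_sum_of_sum_tprod_eq {A : Type} [Fintype A] [DecidableEq A] (v : ι → V)
    (b : Module.Basis ι ℂ V) {θ : ι → ι → ℂ} (h : ∀ i, v i = ∑ j, θ i j • b j)
    {w w' : (A → ι) → ℂ} (hw : ∑ I, w I • PiTensorProduct.tprod ℂ (fun c => v (I c)) =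
      ∑ I, w' I • PiTensorProduct.tprod ℂ (fun c => b (I c))) (J : A → ι) :
    w' J = ∑ I, w I * ∏ c, θ (I c) (J c) := by
  simp only [tprod_eq_sum h, Finset.smul_sum, smul_smul] at hw
  rw [Finset.sum_comm] at hw
  simp only [← Finset.sum_smul] at hw
  exact (congrFun (linearIndependent_iff_injective_fintypeLinearCombination.1
    (linearIndependent_tprod b) hw) J).symm

variable {n : ℕ} {X : Type} [TopologicalSpace X] [ChartedSpace (Fin n → ℂ) X]

lemma IsHolFun.prod {U : Opens X}
    {A : Type} (s : Finset A) {f : A → U → ℂ} (hf : ∀ i ∈ s, IsHolFun n (f i)) :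
    IsHolFun n (fun x => ∏ i ∈ s, f i x) := by
  classical
  induction s using Finset.induction_on with
  | empty => simpa using IsHolFun.const 1
  | insert i s his ih =>
    simp only [Finset.prod_insert his]
    exact (hf i (Finset.mem_insert_self i s)).mul
      (ih fun j hj => hf j (Finset.mem_insert_of_mem hj))

/-- The trivializations of the Schur power of a bundle with frames which depend holomorphically on
each other. -/
def schurPowerTriv (μ : YoungDiagram) {V : X → Type} [∀ x, AddCommGroup (V x)]
    [∀ x, Module ℂ (V x)] (d : OpenPartialHomeomorph X (Fin n → ℂ) → ι → ∀ x, V x)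
    (b : ∀ e ∈ atlas (Fin n → ℂ) X, ∀ x ∈ e.source, Module.Basis ι ℂ (V x))
    (hb : ∀ e he x hx i, b e he x hx i = d e i x)
    (htr : ∀ e ∈ atlas (Fin n → ℂ) X, ∀ e' ∈ atlas (Fin n → ℂ) X,
      ∃ θ : ι → ι → ↥(HolPrebundle.chartDomain e ⊓ HolPrebundle.chartDomain e') → ℂ,
        (∀ i j, IsHolFun n (θ i j)) ∧ ∀ i x, d e i x.1 = ∑ j, θ i j x • d e' j x.1) :
    HolPrebundle.Triv (HolPrebundle.ofFrames (fun x => ⨂[ℂ] _ : μ.cells, V x)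
      (fun x => schurPower μ (V x)) (μ.cells → ι)
      fun e I x => PiTensorProduct.tprod ℂ fun c => d e (I c) x) (schurCoord μ ι) :=
  HolPrebundle.Triv.ofFrames
    (fun e he x hx => by
      have h := linearIndependent_tprod (A := μ.cells) (b e he x hx)
      simp only [hb] at h
      exact h)
    (fun e he e' he' => by
      obtain ⟨θ, hθ, h⟩ := htr e he e' he'
      exact ⟨fun I J x => ∏ c, θ (I c) (J c) x,
        fun I J => IsHolFun.prod _ fun c _ => hθ (I c) (J c),
        fun I x => tprod_eq_sum (fun i => h i x) I⟩)
    (schurCoord μ ι) fun e he x hx => by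
      have h := map_schurCoord μ (b e he x hx)
      simp only [hb] at h
      exact h

lemma eq_sum_of_schurPowerTriv_eq {μ : YoungDiagram} {V : X → Type} [∀ x, AddCommGroup (V x)]
    [∀ x, Module ℂ (V x)] {d : OpenPartialHomeomorph X (Fin n → ℂ) → ι → ∀ x, V x}
    {b : ∀ e ∈ atlas (Fin n → ℂ) X, ∀ x ∈ e.source, Module.Basis ι ℂ (V x)}
    (hb) (htr) {e e' : OpenPartialHomeomorph X (Fin n → ℂ)} (he he') {x : X} (hx hx')
    {θ : ι → ι → ℂ} (h : ∀ i, d e i x = ∑ j, θ i j • d e' j x) {w w' : schurCoord μ ι}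
    (hw : (schurPowerTriv μ d b hb htr).equiv e he x hx w =
      (schurPowerTriv μ d b hb htr).equiv e' he' x hx' w') (J : μ.cells → ι) :
    w'.1 J = ∑ I, w.1 I * ∏ c, θ (I c) (J c) := by
  have h1 : ∑ I, w.1 I • PiTensorProduct.tprod ℂ (fun c => d e (I c) x) =
      ∑ I, w'.1 I • PiTensorProduct.tprod ℂ (fun c => d e' (I c) x) :=
    congrArg (Subtype.val (p := fun v => v ∈ schurPower μ (V x))) hw
  simp only [← hb e' he' x hx'] at h1 h
  exact eq_sum_of_sum_tprod_eq _ _ h h1 J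

variable [IsManifold 𝓘(ℂ, Fin n → ℂ) ω X] {e e' : OpenPartialHomeomorph X (Fin n → ℂ)}

/-- The basis of the cotangent space defined by a chart. -/
def coordBasis (he : e ∈ atlas (Fin n → ℂ) X) {x : X} (hx : x ∈ e.source) :
    Module.Basis (Fin n) ℂ (Cotangent n x) :=
  Module.Basis.mk (linearIndependent_coordDiff he hx) (by
    have : FiniteDimensional ℂ (Cotangent n x) :=
      inferInstanceAs (FiniteDimensional ℂ ((Fin n → ℂ) →L[ℂ] ℂ))
    refine (LinearIndependent.span_eq_top_of_card_eq_finrank' (linearIndependent_coordDiff he hx)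
      ?_).ge
    have h := (LinearMap.toContinuousLinearMap (𝕜 := ℂ) (E := Fin n → ℂ) (F' := ℂ)).finrank_eq
    refine Eq.trans ?_ h
    rw [Module.finrank_linearMap]
    simp)

lemma coordBasis_apply (he : e ∈ atlas (Fin n → ℂ) X) {x : X} (hx : x ∈ e.source) (i : Fin n) :
    coordBasis he hx i = coordDiff e i x := Module.Basis.mk_apply _ _ _

/-- The trivializations of the Schur bundle. -/
def schurTriv (ℓ : Shape n) :
    HolPrebundle.Triv (schurBundle X ℓ) (schurCoord ℓ.diagram (Fin n)) :=
  schurPowerTriv ℓ.diagram (V := fun x : X => Cotangent n x) coordDiff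
    (fun _ he _ hx => coordBasis he hx) (fun _ he _ hx => coordBasis_apply he hx)
    fun e he e' he' => ⟨fun i j x => jacobian e' e x.1 i j,
      fun i j => IsHolFun.res (inf_comm _ _).le (isHolFun_jacobian he' he i j),
      fun i x => coordDiff_eq_sum he' he x.2.2 x.2.1 i⟩

/-- The transition functions of the Schur bundle: coordinates transform by the tensor power of the
Jacobian, one factor for each cell. -/
lemma eq_sum_of_schurTriv_eq {ℓ : Shape n} (he : e ∈ atlas (Fin n → ℂ) X)
    (he' : e' ∈ atlas (Fin n → ℂ) X) {x : X} (hx : x ∈ e.source) (hx' : x ∈ e'.source)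
    {w w' : schurCoord ℓ.diagram (Fin n)}
    (h : (schurTriv ℓ).equiv e he x hx w = (schurTriv ℓ).equiv e' he' x hx' w')
    (J : ℓ.diagram.cells → Fin n) :
    w'.1 J = ∑ I, w.1 I * ∏ c, jacobian e' e x (I c) (J c) :=
  eq_sum_of_schurPowerTriv_eq _ _ he he' hx hx' (coordDiff_eq_sum he' he hx' hx) h J

end Schur

end GreenGriffiths

end

noncomputable section

namespace GreenGriffiths

/-! ### Trivializations of the jet bundles -/

section Supported

/-- The functions which vanish outside `S`. -/
def supportedOn {B : Type} (S : Set B) : Submodule ℂ (B → ℂ) where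
  carrier := {w | ∀ i ∉ S, w i = 0}
  zero_mem' _ _ := rfl
  add_mem' hw hw' i hi := by simp [hw i hi, hw' i hi]
  smul_mem' c w hw i hi := by simp [hw i hi]

lemma map_supportedOn {B : Type} [Fintype B] {M : Type} [AddCommGroup M] [Module ℂ M] (S : Set B)
    (v : B → M) : (supportedOn S).map (Fintype.linearCombination ℂ v) =
      Submodule.span ℂ (v '' S) := by
  classical
  refine le_antisymm ?_ (Submodule.span_le.2 ?_)
  · rintro _ ⟨w, hw, rfl⟩
    rw [Fintype.linearCombination_apply]
    refine sum_mem fun i _ => ?_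
    by_cases hi : i ∈ S
    · exact Submodule.smul_mem _ _ (Submodule.subset_span ⟨i, hi, rfl⟩)
    · rw [hw i hi, zero_smul]
      exact zero_mem _
  · rintro _ ⟨i, hi, rfl⟩
    refine ⟨Pi.single i 1, fun j hj => Pi.single_eq_of_ne (by rintro rfl; exact hj hi) _, ?_⟩
    simp [Fintype.linearCombination_apply, Pi.single_apply]

end Supported

/-! ### The colexicographic filtration, its graded pieces and their transitions -/

section Jets

open MvPolynomial

variable {n κ m : ℕ} {X : Type} [TopologicalSpace X] [ChartedSpace (Fin n → ℂ) X]
  [IsManifold 𝓘(ℂ, Fin n → ℂ) ω X] {e e' : OpenPartialHomeomorph X (Fin n → ℂ)}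

/-- The set of exponents `S` contains with each exponent those of smaller multidegree. -/
def IsColexLower (S : Set (JetExponent n κ m)) : Prop :=
  ∀ α ∈ S, ∀ β : JetExponent n κ m, toColex β.deg ≤ toColex α.deg → β ∈ S

/-- A change of charts never raises the multidegree, so the span of the monomials of a lower set of
multidegrees does not depend on the chart. -/
lemma span_jetMonomial_le {S : Set (JetExponent n κ m)} (hS : IsColexLower S)
    (he : e ∈ atlas (Fin n → ℂ) X) (he' : e' ∈ atlas (Fin n → ℂ) X) {x : X} (hx : x ∈ e.source)
    (hx' : x ∈ e'.source) :
    Submodule.span ℂ ((fun α => jetMonomial e' α x) '' S) ≤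
      Submodule.span ℂ ((fun α => jetMonomial e α x) '' S) := by
  rw [Submodule.span_le]
  rintro _ ⟨α, hα, rfl⟩
  simp only [jetMonomial_eq_sum he he' hx hx']
  refine sum_mem fun β _ => ?_
  by_cases hβ : toColex β.deg ≤ toColex α.deg
  · exact Submodule.smul_mem _ _ (Submodule.subset_span ⟨β, hS α hα β hβ, rfl⟩)
  · rw [(isLeading_jetChange e e' x α).coeff_eq_zero hβ, zero_smul]
    exact zero_mem _

lemma span_jetMonomial {S : Set (JetExponent n κ m)} (hS : IsColexLower S)
    (he : e ∈ atlas (Fin n → ℂ) X) {x : X} (hx : x ∈ e.source) :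
    Submodule.span ℂ ((fun α => jetMonomial e α x) '' S) = jetPolynomials S x :=
  le_antisymm (span_jetMonomial_le hS (chart_mem_atlas _ x) he (mem_chart_source _ x) hx)
    (span_jetMonomial_le hS he (chart_mem_atlas _ x) hx (mem_chart_source _ x))

/-- The trivializations of the bundle of jet polynomials with exponents in `S`. -/
def jetTriv {S : Set (JetExponent n κ m)} (hS : IsColexLower S) :
    HolPrebundle.Triv (jetBundle X S) (supportedOn S) :=
  HolPrebundle.Triv.ofFrames (b := jetMonomial)
    (fun _ he _ hx => linearIndependent_jetMonomial he hx)
    (fun e he e' he' => ⟨fun α β x => coeff β.toFinsupp (substMonomial (jetChange e' e x.1) α),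
      fun α β => IsHolFun.res (inf_comm _ _).le (isHolFun_coeff_substMonomial he' he α β),
      fun α x => jetMonomial_eq_sum he' he x.2.2 x.2.1 α⟩)
    (supportedOn S) fun e he x hx => by
      rw [map_supportedOn]
      exact span_jetMonomial hS he hx

lemma isColexLower_univ : IsColexLower (Set.univ : Set (JetExponent n κ m)) :=
  fun _ _ _ _ => Set.mem_univ _

lemma isColexLower_le (d : Fin κ → ℕ) :
    IsColexLower {α : JetExponent n κ m | toColex α.deg ≤ toColex d} :=
  fun _ hα _ hβ => hβ.trans hα

lemma isColexLower_lt (d : Fin κ → ℕ) :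
    IsColexLower {α : JetExponent n κ m | toColex α.deg < toColex d} :=
  fun _ hα _ hβ => hβ.trans_lt hα

/-- The model of the graded piece of multidegree `d`. -/
abbrev GrModel (n : ℕ) {κ m : ℕ} (d : MultiDegree κ m) : Type :=
  supportedOn {α : JetExponent n κ m | toColex α.deg ≤ toColex d.1} ⧸
    (supportedOn {α : JetExponent n κ m | toColex α.deg < toColex d.1}).comap
      (supportedOn {α : JetExponent n κ m | toColex α.deg ≤ toColex d.1}).subtype

/-- The trivializations of the graded pieces. -/
def grPieceTriv (d : MultiDegree κ m) :
    HolPrebundle.Triv ((filtration n X d).quotient (filtrationLT d)) (GrModel n d) :=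
  HolPrebundle.Triv.quotient (jetTriv (isColexLower_le d.1)) (filtrationLT d) _
    fun e he x hx => by
      have hlt : ∀ w : supportedOn {α : JetExponent n κ m | toColex α.deg ≤ toColex d.1},
          w.1 ∈ supportedOn {α : JetExponent n κ m | toColex α.deg < toColex d.1} ↔
          (jetTriv (isColexLower_le d.1)).equiv e he x hx w ∈ filtrationLT d x := by
        intro w
        change _ ↔ (∑ α, w.1 α • jetMonomial e α x) ∈ jetPolynomials _ x
        rw [← span_jetMonomial (isColexLower_lt d.1) he hx, ← map_supportedOn]
        constructor
        · exact fun h => ⟨w.1, h, rfl⟩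
        · rintro ⟨w', hw', h⟩
          rwa [linearIndependent_iff_injective_fintypeLinearCombination.1
            (linearIndependent_jetMonomial he hx) h] at hw'
      refine le_antisymm ?_ fun v hv => ?_
      · rintro _ ⟨w, hw, rfl⟩
        exact (hlt w).1 hw
      · obtain ⟨w, rfl⟩ := ((jetTriv (isColexLower_le d.1)).equiv e he x hx).surjective v
        exact ⟨w, (hlt w).2 hv, rfl⟩

lemma multiDegree_finite (κ m : ℕ) : Finite (MultiDegree κ m) := by
  refine Finite.of_injective (fun d : MultiDegree κ m => fun l : Fin κ =>
    (⟨d.1 l, ?_⟩ : Fin (m + 1))) fun d d' h => Subtype.ext (funext fun l =>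
      congrArg Fin.val (congrFun h l))
  have h1 := Finset.single_le_sum (f := fun l : Fin κ => (l.1 + 1) * d.1 l)
    (fun _ _ => Nat.zero_le _) (Finset.mem_univ l)
  have h2 : d.1 l ≤ (l.1 + 1) * d.1 l := Nat.le_mul_of_pos_left _ (Nat.succ_pos _)
  exact Nat.lt_succ_of_le (h2.trans (h1.trans d.2.le))

instance (κ m : ℕ) : Fintype (MultiDegree κ m) := @Fintype.ofFinite _ (multiDegree_finite κ m)

instance (κ m : ℕ) : DecidableEq (MultiDegree κ m) := Classical.decEq _

/-- The multidegree as an index of the filtration. -/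
def JetExponent.multiDegree (α : JetExponent n κ m) : MultiDegree κ m := ⟨α.deg, α.2⟩

/-- The part of multidegree `d` of a family of coefficients. -/
def degreePart (n : ℕ) (d : MultiDegree κ m) :
    (JetExponent n κ m → ℂ) →ₗ[ℂ] (JetExponent n κ m → ℂ) where
  toFun w α := if α.multiDegree = d then w α else 0
  map_add' w w' := by ext α; simp only [Pi.add_apply]; split <;> simp
  map_smul' c w := by ext α; simp

lemma degreePart_apply (d : MultiDegree κ m) (w : JetExponent n κ m → ℂ) (α : JetExponent n κ m) :
    degreePart n d w α = if α.multiDegree = d then w α else 0 := rfl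

lemma degreePart_mem (d : MultiDegree κ m) (w : JetExponent n κ m → ℂ) : degreePart n d w ∈
    supportedOn {α : JetExponent n κ m | toColex α.deg ≤ toColex d.1} := by
  intro α hα
  rw [degreePart_apply, if_neg]
  rintro rfl
  exact hα (le_refl (toColex α.deg))

/-- The class of the part of multidegree `d`. -/
def toGrModel (n : ℕ) (d : MultiDegree κ m) : (JetExponent n κ m → ℂ) →ₗ[ℂ] GrModel n d :=
  Submodule.mkQ _ ∘ₗ (degreePart n d).codRestrict _ (degreePart_mem d)

/-- The part of multidegree `d` of a class. -/
def ofGrModel (n : ℕ) (d : MultiDegree κ m) : GrModel n d →ₗ[ℂ] (JetExponent n κ m → ℂ) :=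
  Submodule.liftQ _ (degreePart n d ∘ₗ Submodule.subtype _) (by
    rintro w hw
    rw [LinearMap.mem_ker]
    funext α
    change (if α.multiDegree = d then w.1 α else 0) = 0
    split_ifs with h
    · refine hw α ?_
      subst h
      exact lt_irrefl (toColex α.deg)
    · rfl)

lemma ofGrModel_toGrModel (d : MultiDegree κ m) (w : JetExponent n κ m → ℂ) :
    ofGrModel n d (toGrModel n d w) = degreePart n d w := by
  refine (Submodule.liftQ_apply _ _ _).trans ?_
  funext α
  change (if α.multiDegree = d then (if α.multiDegree = d then w α else 0) else 0) =
    if α.multiDegree = d then w α else 0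
  split_ifs <;> rfl

lemma toGrModel_ofGrModel (d : MultiDegree κ m) (v : GrModel n d) :
    toGrModel n d (ofGrModel n d v) = v := by
  obtain ⟨w, rfl⟩ := Submodule.mkQ_surjective _ v
  refine (Submodule.Quotient.eq _).2 fun α hα => ?_
  change degreePart n d (degreePart n d w.1) α - w.1 α = 0
  rw [degreePart_apply, degreePart_apply]
  split_ifs with h
  · exact sub_self _
  · rw [w.2 α, sub_zero]
    intro h1
    have h2 : toColex α.deg ≤ toColex d.1 := h1
    exact hα (h2.lt_of_ne fun h3 => h (Subtype.ext (toColex.injective h3)))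

lemma toGrModel_ofGrModel_of_ne {d d' : MultiDegree κ m} (h : d ≠ d') (v : GrModel n d) :
    toGrModel n d' (ofGrModel n d v) = 0 := by
  obtain ⟨w, rfl⟩ := Submodule.mkQ_surjective _ v
  refine (Submodule.Quotient.mk_eq_zero _).2 fun α _ => ?_
  change degreePart n d' (degreePart n d w.1) α = 0
  rw [degreePart_apply, degreePart_apply]
  split_ifs with h1 h2
  · exact absurd (h2.symm.trans h1) h
  · rfl
  · rfl

/-- Families of coefficients decompose according to multidegrees. -/
def grModelEquiv (n κ m : ℕ) :
    (JetExponent n κ m → ℂ) ≃ₗ[ℂ] ⨁ d : MultiDegree κ m, GrModel n d :=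
  LinearEquiv.ofLinearMap
    (∑ d, DirectSum.lof ℂ (MultiDegree κ m) (fun d => GrModel n d) d ∘ₗ toGrModel n d)
    (DirectSum.toModule ℂ _ _ fun d => ofGrModel n d)
    (by
      refine DirectSum.linearMap_ext ℂ fun d => LinearMap.ext fun v => ?_
      simp only [LinearMap.comp_apply, DirectSum.toModule_lof, LinearMap.sum_apply,
        LinearMap.id_apply]
      rw [Finset.sum_eq_single d, toGrModel_ofGrModel]
      · intro d' _ hd'
        rw [toGrModel_ofGrModel_of_ne (Ne.symm hd'), map_zero]
      · simp)
    (by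
      refine LinearMap.ext fun w => ?_
      simp only [LinearMap.comp_apply, LinearMap.sum_apply, map_sum, DirectSum.toModule_lof,
        LinearMap.id_apply, ofGrModel_toGrModel]
      funext α
      rw [Finset.sum_apply]
      simp [degreePart_apply])

lemma grModelEquiv_apply (w : JetExponent n κ m → ℂ) (d : MultiDegree κ m) :
    grModelEquiv n κ m w d = toGrModel n d w := by
  change (∑ d, DirectSum.lof ℂ (MultiDegree κ m) (fun d => GrModel n d) d ∘ₗ toGrModel n d) w d = _
  rw [LinearMap.sum_apply]
  refine (DFinsupp.finsetSum_apply _ _ _).trans ?_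
  rw [Finset.sum_eq_single d]
  · exact DirectSum.lof_apply (M := fun d : MultiDegree κ m => GrModel n d) ℂ d _
  · intro d' _ hd'
    exact DirectSum.of_eq_of_ne (β := fun d : MultiDegree κ m => GrModel n d) _ _ _ (Ne.symm hd')
  · simp

/-- The trivializations of the graded bundle. -/
def grTriv (n κ m : ℕ) (X : Type) [TopologicalSpace X] [ChartedSpace (Fin n → ℂ) X]
    [IsManifold 𝓘(ℂ, Fin n → ℂ) ω X] :
    HolPrebundle.Triv (GrEGG n κ m X) (JetExponent n κ m → ℂ) :=
  (HolPrebundle.Triv.directSum fun d : MultiDegree κ m => grPieceTriv d).congr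
    (grModelEquiv n κ m)

/-- On the graded bundle the nonlinear terms of a change of charts vanish: transitions are the
linear substitutions by the Jacobian, as for the polynomials of the Schur model. -/
lemma grTriv_eq (he : e ∈ atlas (Fin n → ℂ) X) (he' : e' ∈ atlas (Fin n → ℂ) X) {x : X}
    (hx : x ∈ e.source) (hx' : x ∈ e'.source) {w w' : JetExponent n κ m → ℂ}
    (h : ∀ β, w' β = ∑ α, w α * coeff β.toFinsupp
      (substMonomial (fun p => linPoly (jacobian e' e x p.2) p.1) α)) :
    (grTriv n κ m X).equiv e he x hx w = (grTriv n κ m X).equiv e' he' x hx' w' := by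
  refine DFinsupp.ext fun d => ?_
  change (grPieceTriv d).equiv e he x hx (grModelEquiv n κ m w d) =
    (grPieceTriv d).equiv e' he' x hx' (grModelEquiv n κ m w' d)
  rw [grModelEquiv_apply, grModelEquiv_apply]
  refine (Submodule.Quotient.eq (filtrationLT d x)).2 ?_
  change (∑ α, degreePart n d w α • jetMonomial e α x) -
    (∑ α, degreePart n d w' α • jetMonomial e' α x) ∈
    jetPolynomials {α : JetExponent n κ m | toColex α.deg < toColex d.1} x
  -- Between exponents of multidegree `d`, the linear substitution and the full change of charts
  -- have the same coefficients; between different multidegrees the linear one has none.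
  have h1 : ∀ β, degreePart n d w' β = ∑ α, degreePart n d w α *
      (if β.multiDegree = d then
        coeff β.toFinsupp (substMonomial (jetChange e' e x) α) else 0) := by
    intro β
    simp only [degreePart_apply]
    by_cases hβ : β.multiDegree = d
    · rw [if_pos hβ, h]
      refine Finset.sum_congr rfl fun α _ => ?_
      rw [if_pos hβ]
      by_cases hα : α.multiDegree = d
      · rw [if_pos hα, (isLeading_jetChange e' e x α).coeff_eq]
        exact congrArg Subtype.val (hβ.trans hα.symm)
      · rw [if_neg hα, zero_mul, coeff_eq_zero_of_mem_restrictSupport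
          (isLeading_jetChange e' e x α).mem, mul_zero]
        exact fun h2 => hα ((Subtype.ext (show α.deg = d.1 from
          Eq.trans (Eq.symm h2) (congrArg Subtype.val hβ))))
    · simp [hβ]
  simp only [h1, Finset.sum_smul]
  rw [Finset.sum_comm, ← Finset.sum_sub_distrib]
  refine sum_mem fun α _ => ?_
  simp only [mul_smul, ← Finset.smul_sum, ← smul_sub]
  by_cases hα : α.multiDegree = d
  · refine Submodule.smul_mem _ _ ?_
    -- After subtracting the terms of multidegree `d`, the rest of the expansion has strictly
    -- smaller multidegree.
    rw [jetMonomial_eq_sum he' he hx' hx, ← Finset.sum_sub_distrib]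
    refine sum_mem fun β _ => ?_
    rw [← sub_smul, ← span_jetMonomial (isColexLower_lt d.1) he' hx']
    subst hα
    split_ifs with hβ
    · rw [sub_self, zero_smul]
      exact zero_mem _
    · rw [sub_zero]
      by_cases h2 : toColex β.deg ≤ toColex α.deg
      · refine Submodule.smul_mem _ _ (Submodule.subset_span ⟨β, lt_of_le_of_ne h2 fun h3 =>
          hβ (Subtype.ext ?_), rfl⟩)
        exact toColex.injective h3
      · rw [(isLeading_jetChange e' e x α).coeff_eq_zero h2, zero_smul]
        exact zero_mem _
  · rw [degreePart_apply, if_neg hα, zero_smul]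
    exact zero_mem _

end Jets

end GreenGriffiths

end

noncomputable section

namespace GreenGriffiths

/-! ### Tensors attached to tableaux and jet polynomials -/

section Model

open MvPolynomial

variable {n κ m : ℕ}

/-- The index set of the decomposition into Schur powers. -/
abbrev SchurIndex (n κ m : ℕ) : Type := Σ ℓ : Shape n, Fin (ℓ.multiplicity κ m)

/-- The numbering of the tableaux. -/
def SchurIndex.equiv (n κ m : ℕ) : SchurIndex n κ m ≃ Σ ℓ : Shape n, WeightedTableau ℓ κ m :=
  Equiv.sigmaCongrRight fun ℓ => (Finite.equivFin (WeightedTableau ℓ κ m)).symm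

instance : Fintype (SchurIndex n κ m) := Fintype.ofEquiv _ (SchurIndex.equiv n κ m).symm

/-- The tableau with a given number. -/
def SchurIndex.tableau (i : SchurIndex n κ m) : WeightedTableau i.1 κ m :=
  (SchurIndex.equiv n κ m i).2

/-- The entries of the tableau with a given number, decreased by one. -/
def SchurIndex.fill (i : SchurIndex n κ m) : i.1.diagram.cells → Fin κ := i.tableau.toBounded.fill

lemma SchurIndex.sum_fill (i : SchurIndex n κ m) : ∑ c, ((i.fill c : ℕ) + 1) = m := by
  refine Eq.trans ?_ i.tableau.2.2
  rw [← Finset.sum_coe_sort i.1.diagram.cells]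
  exact Finset.sum_congr rfl fun c _ => i.tableau.toBounded.fill_add_one c

/-- The model of the fibres of the direct sum of the Schur bundles. -/
abbrev SchurModel (n κ m : ℕ) : Type :=
  ⨁ i : SchurIndex n κ m, schurCoord i.1.diagram (Fin n)

/-- The polynomial defined by tensors attached to tableaux. -/
def tensorPoly (n κ m : ℕ) : SchurModel n κ m →ₗ[ℂ] MvPolynomial (Fin κ × Fin n) ℂ where
  toFun a := ∑ i, ∑ I : i.1.diagram.cells → Fin n,
    monomial (content fun c => (i.fill c, I c)) ((a i).1 I)
  map_add' a b := by
    simp only [DirectSum.add_apply, Submodule.coe_add, Pi.add_apply, map_add,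
      Finset.sum_add_distrib]
  map_smul' r a := by
    simp only [DirectSum.smul_apply, Submodule.coe_smul, Pi.smul_apply, map_smul,
      Finset.smul_sum, RingHom.id_apply]

lemma tensorPoly_apply (a : SchurModel n κ m) : tensorPoly n κ m a =
    ∑ i, ∑ I : i.1.diagram.cells → Fin n,
      monomial (content fun c => (i.fill c, I c)) ((a i).1 I) := rfl

lemma monomial_content {A Z : Type} [Fintype A] (f : A → Z) (r : ℂ) :
    monomial (content f) r = C r * ∏ c, X (f c) := by
  conv_lhs => rw [← mul_one r, ← C_mul_monomial, content, monomial_sum_one]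
  rfl

lemma tensorPoly_mem_restrictSupport (a : SchurModel n κ m) : tensorPoly n κ m a ∈
    restrictSupport ℂ {δ | weight κ (multidegree n κ δ) = m} := by
  refine sum_mem fun i _ => sum_mem fun I _ => (monomial_mem_restrictSupport ℂ).2 (Or.inl ?_)
  rw [Set.mem_ofPred_eq, content]
  simp only [map_sum, multidegree_single, weight_single]
  exact i.sum_fill

lemma SchurIndex.fill_mk (ℓ : Shape n) (T : WeightedTableau ℓ κ m) :
    SchurIndex.fill ⟨ℓ, Finite.equivFin (WeightedTableau ℓ κ m) T⟩ = T.toBounded.fill :=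
  congrArg (fun T : WeightedTableau ℓ κ m => T.toBounded.fill)
    ((Finite.equivFin (WeightedTableau ℓ κ m)).symm_apply_apply T)

lemma tensorPoly_injective : Function.Injective (tensorPoly n κ m) := by
  rw [injective_iff_map_eq_zero]
  intro a ha
  have key := eq_zero_of_sum_content_eq_zero (n := n) (κ := κ) (m := m) (ι := Fin n)
    (fun j => (a ⟨j.1, Finite.equivFin (WeightedTableau j.1 κ m) j.2⟩).1)
    (fun j => (a ⟨j.1, Finite.equivFin (WeightedTableau j.1 κ m) j.2⟩).2) fun δ => by
      have h := congrArg (coeff δ) ha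
      rw [tensorPoly_apply, coeff_sum, coeff_zero] at h
      rw [← h]
      refine Fintype.sum_equiv (SchurIndex.equiv n κ m).symm _ _ fun j => ?_
      obtain ⟨ℓ, T⟩ := j
      change _ = coeff δ (∑ I : ℓ.diagram.cells → Fin n, monomial
        (content fun c => (SchurIndex.fill ⟨ℓ, Finite.equivFin (WeightedTableau ℓ κ m) T⟩ c, I c))
        ((a ⟨ℓ, Finite.equivFin (WeightedTableau ℓ κ m) T⟩).1 I))
      rw [coeff_sum, Finset.sum_filter, SchurIndex.fill_mk]
      refine Finset.sum_congr rfl fun I _ => ?_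
      rw [coeff_monomial]
      congr
  refine DFinsupp.ext fun i => Subtype.ext ?_
  obtain ⟨ℓ, k⟩ := i
  obtain ⟨T, rfl⟩ := (Finite.equivFin (WeightedTableau ℓ κ m)).surjective k
  exact key ⟨ℓ, T⟩

lemma eq_sum_monomial {p : MvPolynomial (Fin κ × Fin n) ℂ}
    (hp : p ∈ restrictSupport ℂ {δ | weight κ (multidegree n κ δ) = m}) :
    p = ∑ α : JetExponent n κ m, monomial α.toFinsupp (coeff α.toFinsupp p) := by
  classical
  ext δ
  rw [coeff_sum]
  by_cases hδ : weight κ (multidegree n κ δ) = m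
  · obtain ⟨α, rfl⟩ := JetExponent.exists_toFinsupp_eq hδ
    simp [coeff_monomial, JetExponent.toFinsupp_injective.eq_iff]
  · rw [coeff_eq_zero_of_mem_restrictSupport hp hδ]
    refine (Finset.sum_eq_zero fun α _ => ?_).symm
    rw [coeff_monomial, if_neg]
    rintro rfl
    exact hδ α.2

/-- The coefficients of the polynomial defined by tensors attached to tableaux. -/
def tensorCoeff (n κ m : ℕ) : SchurModel n κ m →ₗ[ℂ] (JetExponent n κ m → ℂ) :=
  LinearMap.pi (fun α => MvPolynomial.lcoeff ℂ α.toFinsupp) ∘ₗ tensorPoly n κ m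

lemma tensorCoeff_apply (a : SchurModel n κ m) (α : JetExponent n κ m) :
    tensorCoeff n κ m a α = coeff α.toFinsupp (tensorPoly n κ m a) := rfl

lemma tensorPoly_eq_sum (a : SchurModel n κ m) : tensorPoly n κ m a =
    ∑ α : JetExponent n κ m, monomial α.toFinsupp (tensorCoeff n κ m a α) :=
  eq_sum_monomial (tensorPoly_mem_restrictSupport a)

lemma tensorCoeff_injective : Function.Injective (tensorCoeff n κ m) := fun a b h =>
  tensorPoly_injective (by rw [tensorPoly_eq_sum, tensorPoly_eq_sum, h])

/-- The Robinson-Schensted-Knuth map injects the exponents into pairs of tableaux: one numbers a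
summand, and those of the other kind are no more numerous than the dimension of that summand. -/
lemma card_jetExponent_le :
    Fintype.card (JetExponent n κ m) ≤ Module.finrank ℂ (SchurModel n κ m) := by
  let f : JetExponent n κ m → Σ i : SchurIndex n κ m, BoundedTableau i.1 n := fun α =>
    ⟨⟨(rsk α).1, Finite.equivFin (WeightedTableau (rsk α).1 κ m) (rsk α).2.2⟩, (rsk α).2.1⟩
  let g : (Σ i : SchurIndex n κ m, BoundedTableau i.1 n) →
      Σ ℓ : Shape n, BoundedTableau ℓ n × WeightedTableau ℓ κ m := fun x =>
    ⟨x.1.1, x.2, (Finite.equivFin (WeightedTableau x.1.1 κ m)).symm x.1.2⟩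
  have hgf : ∀ α, g (f α) = rsk α := fun α => congrArg
    (fun T => (⟨(rsk α).1, (rsk α).2.1, T⟩ :
      Σ ℓ : Shape n, BoundedTableau ℓ n × WeightedTableau ℓ κ m))
    ((Finite.equivFin (WeightedTableau (rsk α).1 κ m)).symm_apply_apply (rsk α).2.2)
  have hf : Function.Injective f := fun α β h =>
    rsk_injective (by rw [← hgf α, ← hgf β, h])
  have h1 := Nat.card_le_card_of_injective f hf
  rw [Nat.card_eq_fintype_card, Nat.card_sigma] at h1
  refine h1.trans ?_
  rw [Module.finrank_directSum]
  exact Finset.sum_le_sum fun i _ => card_boundedTableau_le i.1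

/-- Injectivity bounds the dimension of the source by the number of monomials, and
`card_jetExponent_le` gives the opposite inequality. -/
lemma tensorCoeff_bijective : Function.Bijective (tensorCoeff n κ m) := by
  refine ⟨tensorCoeff_injective, ?_⟩
  have h : Module.finrank ℂ (SchurModel n κ m) = Module.finrank ℂ (JetExponent n κ m → ℂ) :=
    le_antisymm (LinearMap.finrank_le_finrank_of_injective
      (tensorCoeff_injective (n := n) (κ := κ) (m := m)))
      (by rw [Module.finrank_fintype_fun_eq_card]; exact card_jetExponent_le)
  exact (LinearMap.injective_iff_surjective_of_finrank_eq_finrank (V := SchurModel n κ m)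
    (V₂ := JetExponent n κ m → ℂ) h).1 tensorCoeff_injective

/-- Tensors attached to tableaux correspond to jet polynomials. -/
def tensorCoeffEquiv (n κ m : ℕ) : SchurModel n κ m ≃ₗ[ℂ] (JetExponent n κ m → ℂ) :=
  LinearEquiv.ofBijective (tensorCoeff n κ m) tensorCoeff_bijective

/-- The correspondence is compatible with linear substitutions. -/
lemma tensorCoeff_eq_sum (A : Fin n → Fin n → ℂ) {a a' : SchurModel n κ m}
    (h : ∀ i J, (a' i).1 J = ∑ I, (a i).1 I * ∏ c, A (I c) (J c)) (β : JetExponent n κ m) :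
    tensorCoeff n κ m a' β = ∑ α, tensorCoeff n κ m a α *
      coeff β.toFinsupp (substMonomial (fun p => linPoly (A p.2) p.1) α) := by
  let θ : MvPolynomial (Fin κ × Fin n) ℂ →ₐ[ℂ] MvPolynomial (Fin κ × Fin n) ℂ :=
    aeval fun p => linPoly (A p.2) p.1
  have h1 : θ (tensorPoly n κ m a) = tensorPoly n κ m a' := by
    simp only [tensorPoly_apply, map_sum]
    refine Finset.sum_congr rfl fun i _ => ?_
    simp only [h, monomial_content, map_mul, map_prod, map_sum]
    rw [Finset.sum_comm]
    refine Finset.sum_congr rfl fun I _ => ?_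
    -- Expanding the product of linear forms, one choice of index per cell, produces the tensor
    -- power of `A` acting on coordinates.
    have h2 : ∏ c, θ (X (i.fill c, I c)) =
        ∑ J : i.1.diagram.cells → Fin n, ∏ c, (C (A (I c) (J c)) * X (i.fill c, J c)) := by
      have h3 := Finset.prod_univ_sum (fun _ : i.1.diagram.cells => (Finset.univ : Finset (Fin n)))
        fun c j => (C (A (I c) j) * X (i.fill c, j) : MvPolynomial (Fin κ × Fin n) ℂ)
      rw [Fintype.piFinset_univ] at h3
      rw [← h3]
      exact Finset.prod_congr rfl fun c _ => aeval_X _ _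
    rw [h2, Finset.mul_sum]
    refine Finset.sum_congr rfl fun J _ => ?_
    rw [Finset.prod_mul_distrib, mul_assoc, algHom_C]
    rfl
  rw [tensorCoeff_apply, ← h1, tensorPoly_eq_sum a, map_sum, coeff_sum]
  refine Finset.sum_congr rfl fun α _ => ?_
  rw [aeval_monomial, algebraMap_eq, coeff_C_mul, Finsupp.prod_fintype _ _ fun _ => pow_zero _]
  rfl

end Model

/-! ### The isomorphism of bundles -/

section Iso

variable (n κ m : ℕ) (X : Type) [TopologicalSpace X] [ChartedSpace (Fin n → ℂ) X]
  [IsManifold 𝓘(ℂ, Fin n → ℂ) ω X]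

/-- The graded bundle is isomorphic to a direct sum of Schur bundles. -/
def grIso : HolPrebundle.Iso (GrEGG n κ m X)
    (HolPrebundle.directSum fun i : SchurIndex n κ m => schurBundle X i.1) :=
  haveI : DecidableEq (SchurIndex n κ m) := Classical.decEq _
  (grTriv n κ m X).iso (HolPrebundle.Triv.directSum fun i : SchurIndex n κ m => schurTriv i.1)
    (tensorCoeffEquiv n κ m).symm fun e he e' he' x hx hx' v => by
      set τ := HolPrebundle.Triv.directSum fun i : SchurIndex n κ m => schurTriv (X := X) i.1
      obtain ⟨w, rfl⟩ := ((grTriv n κ m X).equiv e he x hx).surjective v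
      obtain ⟨a, rfl⟩ := (tensorCoeffEquiv n κ m).surjective w
      rw [LinearEquiv.symm_apply_apply, LinearEquiv.symm_apply_apply]
      -- Here `a'` is the vector of Schur coordinates in `e'` of the point with coordinates `a` in
      -- `e`; both sides of the gluing condition become this same point.
      obtain ⟨a', ha'⟩ := (τ.equiv e' he' x hx').surjective (τ.equiv e he x hx a)
      have h1 : ∀ i J, (a' i).1 J = ∑ I, (a i).1 I * ∏ c, jacobian e' e x (I c) (J c) :=
        fun i J => eq_sum_of_schurTriv_eq he he' hx hx'
          (congrArg (fun v : ⨁ i : SchurIndex n κ m, (schurBundle X i.1).Fib x => v i) ha'.symm) J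
      have h2 : (grTriv n κ m X).equiv e he x hx (tensorCoeffEquiv n κ m a) =
          (grTriv n κ m X).equiv e' he' x hx' (tensorCoeffEquiv n κ m a') :=
        grTriv_eq he he' hx hx' fun β => tensorCoeff_eq_sum _ h1 β
      rw [h2, LinearEquiv.symm_apply_apply, LinearEquiv.symm_apply_apply, ha']

end Iso

end GreenGriffiths

end

noncomputable section

namespace GreenGriffiths

/-! ### Dimensions of the cohomology of the jet bundles -/

section Cohomology

variable {n κ m : ℕ} {X : Type} [TopologicalSpace X] [ChartedSpace (Fin n → ℂ) X]

lemma cardinal_sum_eq_sum {ι : Type} [Fintype ι] (f : ι → Cardinal.{0}) :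
    Cardinal.sum f = ∑ i, f i := by
  classical
  have h : ∀ s : Finset ι,
      Cardinal.mk {x : Σ i, (f i).out | x.1 ∈ s} = ∑ i ∈ s, f i := by
    intro s
    induction s using Finset.induction_on with
    | empty => simp
    | insert i s his ih =>
      have h1 : {x : Σ i, (f i).out | x.1 ∈ insert i s} =
          {x : Σ i, (f i).out | x.1 = i} ∪ {x : Σ i, (f i).out | x.1 ∈ s} := by
        ext x
        simp
      rw [h1, Cardinal.mk_union_of_disjoint, ih, Finset.sum_insert his]
      · refine congrArg (· + _) ?_
        exact (Cardinal.mk_congr (Equiv.sigmaSubtype (β := fun i => (f i).out) i)).trans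
          (Cardinal.mk_out _)
      · refine Set.disjoint_left.2 fun x hx hx' => his ?_
        have h2 : x.1 = i := hx
        exact h2 ▸ hx'
  rw [← h Finset.univ, Cardinal.sum]
  refine Cardinal.mk_congr (Equiv.Set.univ _).symm |>.trans ?_
  congr
  simp

lemma h_eq_zero_of_subsingleton {E : HolPrebundle n X} (hE : ∀ x, Subsingleton (E.Fib x)) (q : ℕ) :
    E.h q = 0 := by
  have h1 : 𝟙 E.sheaf = 0 := by
    rw [← HolPrebundle.sheafMap_id, ← HolPrebundle.sheafMap_zero]
    exact HolPrebundle.sheafMap_congr _ _ fun x v => (hE x).elim _ _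
  have h2 : Subsingleton (E.cohomology q) := by
    refine subsingleton_of_forall_eq 0 fun v => ?_
    have h3 := LinearMap.congr_fun (extMap_id
      ((constantSheaf (Opens.grothendieckTopology X) (ModuleCat.{0} ℂ)).obj (ModuleCat.of ℂ ℂ))
      E.sheaf q) v
    rw [h1, extMap_zero] at h3
    exact h3.symm
  exact rank_subsingleton' _ _

lemma jetPolynomials_mono {S S' : Set (JetExponent n κ m)} (h : S ⊆ S') (x : X) :
    jetPolynomials S x ≤ jetPolynomials S' x :=
  Submodule.span_mono (Set.image_mono h)

/-- The cohomology of the filtration. -/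
lemma h_filtration_le (d : MultiDegree κ m) (q : ℕ) :
    (filtration n X d).h q ≤
      (jetBundle X {α : JetExponent n κ m | toColex α.deg < toColex d.1}).h q +
        ((filtration n X d).quotient (filtrationLT d)).h q := by
  have hle : ∀ x : X, jetPolynomials {α : JetExponent n κ m | toColex α.deg < toColex d.1} x ≤
      jetPolynomials {α : JetExponent n κ m | toColex α.deg ≤ toColex d.1} x :=
    jetPolynomials_mono fun α (h : toColex α.deg < toColex d.1) => h.le
  -- Holomorphy in a subbundle is tested with all jet monomials, so the inclusion preserves and
  -- reflects it by definition; local lifting is the definition of holomorphy in the quotient.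
  refine HolPrebundle.h_le_add (F := filtration n X d)
    (G := (filtration n X d).quotient (filtrationLT d)) (fun x => Submodule.inclusion (hle x))
    (fun x => (filtrationLT d x).mkQ) (fun U s => Iff.rfl) (fun U s hs x₀ => ?_)
    (fun x => Submodule.inclusion_injective (hle x)) (fun x => ?_) (fun U s hs => hs) q
  · exact ⟨U, le_rfl, x₀.2, s, hs, fun _ => rfl⟩
  · refine Eq.trans ?_ (Submodule.ker_mkQ (filtrationLT d x)).symm
    exact Submodule.range_inclusion _ _ (hle x)

/-- Induction on the number of multidegrees, removing the largest one. As `s` is a lower set, all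
multidegrees up to this one belong to `s`, so the bundle is a member of the filtration and what
remains is the preceding subbundle. -/
lemma h_jetBundle_le (s : Finset (MultiDegree κ m))
    (hs : ∀ d ∈ s, ∀ d' : MultiDegree κ m, toColex d'.1 ≤ toColex d.1 → d' ∈ s) (q : ℕ) :
    (jetBundle X {α : JetExponent n κ m | α.multiDegree ∈ s}).h q ≤
      ∑ d ∈ s, ((filtration n X d).quotient (filtrationLT d)).h q := by
  induction hk : s.card generalizing s with
  | zero =>
    rw [Finset.card_eq_zero] at hk
    subst hk
    rw [h_eq_zero_of_subsingleton, Finset.sum_empty]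
    intro x
    have h1 : jetPolynomials {α : JetExponent n κ m | α.multiDegree ∈ (∅ : Finset _)} x = ⊥ := by
      rw [jetPolynomials]
      simp
    refine subsingleton_of_forall_eq 0 fun v => Subtype.ext ?_
    exact (Submodule.mem_bot ℂ).1 (h1 ▸ v.2)
  | succ k ih =>
    obtain ⟨d, hd, hmax⟩ := s.exists_max_image (fun d => toColex d.1)
      (Finset.card_pos.1 (hk ▸ Nat.succ_pos k))
    have h1 : {α : JetExponent n κ m | α.multiDegree ∈ s} =
        {α : JetExponent n κ m | toColex α.deg ≤ toColex d.1} := by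
      ext α
      exact ⟨fun h => hmax _ h, fun h => hs d hd _ h⟩
    have h2 : {α : JetExponent n κ m | α.multiDegree ∈ s.erase d} =
        {α : JetExponent n κ m | toColex α.deg < toColex d.1} := by
      ext α
      constructor
      · intro h
        have h3 : α.multiDegree ∈ s.erase d := h
        exact lt_of_le_of_ne (hmax _ (Finset.mem_of_mem_erase h3)) fun h4 =>
          Finset.ne_of_mem_erase h3 (Subtype.ext (toColex.injective h4))
      · intro h
        have h3 : toColex α.deg < toColex d.1 := h
        refine Finset.mem_erase.2 ⟨?_, hs d hd _ h3.le⟩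
        rintro rfl
        exact lt_irrefl _ h3
    have h5 := ih (s.erase d) (fun d₁ hd₁ d₂ hd₂ => by
      refine Finset.mem_erase.2 ⟨?_, hs d₁ (Finset.mem_of_mem_erase hd₁) d₂ hd₂⟩
      rintro rfl
      refine Finset.ne_of_mem_erase hd₁ (Subtype.ext (toColex.injective ?_))
      exact le_antisymm (hmax _ (Finset.mem_of_mem_erase hd₁)) hd₂) (by
        rw [Finset.card_erase_of_mem hd, hk]; rfl)
    rw [h1, ← Finset.add_sum_erase s _ hd, add_comm]
    rw [h2] at h5
    exact (h_filtration_le d q).trans (add_le_add_left h5 _)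

lemma h_EGG_le (q : ℕ) : (EGG n κ m X).h q ≤ (GrEGG n κ m X).h q := by
  have h := h_jetBundle_le (n := n) (X := X) (Finset.univ : Finset (MultiDegree κ m))
    (fun _ _ _ _ => Finset.mem_univ _) q
  have h1 : {α : JetExponent n κ m | α.multiDegree ∈ (Finset.univ : Finset (MultiDegree κ m))} =
      Set.univ := by
    ext α
    exact ⟨fun _ => Set.mem_univ _, fun _ => Finset.mem_univ _⟩
  rw [h1] at h
  refine h.trans (le_of_eq ?_)
  rw [GrEGG, HolPrebundle.h_directSum, cardinal_sum_eq_sum]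

/-- The summands are grouped by shape, each shape being repeated as often as its multiplicity. All
but finitely many multiplicities are 0, so the sum over all shapes causes no trouble. -/
lemma h_directSum_schurBundle (q : ℕ) :
    (HolPrebundle.directSum fun i : SchurIndex n κ m => schurBundle X i.1).h q =
      Cardinal.sum fun ℓ : Shape n =>
        (ℓ.multiplicity κ m : Cardinal.{0}) * (schurBundle X ℓ).h q := by
  rw [HolPrebundle.h_directSum]
  have h1 : (Cardinal.sum fun i : SchurIndex n κ m => (schurBundle X i.1).h q) =
      Cardinal.mk (Σ i : SchurIndex n κ m, ((schurBundle X i.1).h q).out) := by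
    rw [Cardinal.mk_sigma]
    simp only [Cardinal.mk_out]
  rw [h1, Cardinal.mk_congr (Equiv.sigmaAssoc fun (ℓ : Shape n) (_ : Fin (ℓ.multiplicity κ m)) =>
    ((schurBundle X ℓ).h q).out), Cardinal.mk_sigma]
  refine congrArg Cardinal.sum (funext fun ℓ => ?_)
  rw [Cardinal.mk_sigma]
  simp

end Cohomology

end GreenGriffiths

end

theorem mainTheorem2 (n κ m : ℕ) (X : Type) [TopologicalSpace X]
    [ChartedSpace (Fin n → ℂ) X] [IsManifold 𝓘(ℂ, Fin n → ℂ) ω X] :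
    (GreenGriffiths.EGG n κ m X).IsVectorBundle ∧
    (GreenGriffiths.GrEGG n κ m X).IsVectorBundle ∧
    (∀ ℓ : GreenGriffiths.Shape n, (GreenGriffiths.schurBundle X ℓ).IsVectorBundle) ∧
    Nonempty (GreenGriffiths.HolPrebundle.Iso (GreenGriffiths.GrEGG n κ m X)
      (GreenGriffiths.HolPrebundle.directSum
        fun i : (Σ ℓ : GreenGriffiths.Shape n, Fin (ℓ.multiplicity κ m)) =>
          GreenGriffiths.schurBundle X i.1)) ∧
    ∀ q : ℕ, (GreenGriffiths.EGG n κ m X).h q ≤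
      Cardinal.sum fun ℓ : GreenGriffiths.Shape n =>
        (ℓ.multiplicity κ m : Cardinal.{0}) * (GreenGriffiths.schurBundle X ℓ).h q := by
  refine ⟨GreenGriffiths.HolPrebundle.Triv.isVectorBundle
      (GreenGriffiths.jetTriv GreenGriffiths.isColexLower_univ),
    (GreenGriffiths.grTriv n κ m X).isVectorBundle,
    fun ℓ => (GreenGriffiths.schurTriv ℓ).isVectorBundle,
    ⟨GreenGriffiths.grIso n κ m X⟩, fun q => ?_⟩
  refine (GreenGriffiths.h_EGG_le q).trans (le_of_eq ?_)
  rw [GreenGriffiths.HolPrebundle.h_congr (GreenGriffiths.grIso n κ m X) q]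
  exact GreenGriffiths.h_directSum_schurBundle q
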